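/- We use French notation: rows are numbered from bottom to top, columns from left to right, and $(i,j)$ is the cell in row $i$ and column $j$, with $i,j\ge 1$. **Hook-valued tableaux.** A hook-valued tableau is a filling of the Young diagram of a partition in which each box contains a semistandard Young tableau of hook shape with a hook entry $h$, leg entries $h<L_1<\dots<L_\ell$ and arm entries $h\le A_1\le\dots\le A_k$ (positive integers, $\ell,k\ge 0$), such that any entry of a box is $\le$ any entry of the box directly to its right and $<$ any entry of the box directly above it. **Arm bumping $\mathcal A_b$.** If $T$ has no arm entries, $\mathcal A_b(T)=T$. Otherwise let $c$ be the rightmost column containing an arm entry, $a$ the largest arm entry in column $c$, and $(r,c)$ the cell containing it. Remove one arm entry $a$ from $(r,c)$. If column $c+1$ has an entry $\ge a$, let $k$ be the smallest such entry, in the cell $(\tilde r,c+1)$ say; replace $k$ by $a$ and add $k$ to $(\tilde r,c+1)$ as an arm entry. If there is no such entry, create a new cell $(\tilde r,c+1)$ at the top of column $c+1$, with hook entry $a$. In both cases, if $\tilde r=r$, move all leg entries of $(r,c)$ that are $>a$ to $(r,c+1)$ as leg entries. **Leg bumping $\mathcal L_b$.** If $T$ has no leg entries, $\mathcal L_b(T)=T$.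 Otherwise let $r$ be the topmost row containing a leg entry, $\ell$ the largest leg entry in row $r$, and $(r,c)$ the cell containing it. Remove the leg entry $\ell$ from $(r,c)$. If row $r+1$ has an entry $>\ell$, let $k$ be the smallest such entry (its leftmost occurrence), in the cell $(r+1,\tilde c)$ say; replace $k$ by $\ell$ and add $k$ to $(r+1,\tilde c)$ as a leg entry. If there is no such entry, create a new cell $(r+1,\tilde c)$ at the end of row $r+1$, with hook entry $\ell$. In both cases, if $\tilde c=c$, move all arm entries of $(r,c)$ that are $\ge\ell$ to $(r+1,c)$ as arm entries. **Uncrowding.** If $T$ has no arm entries, $\mathcal A(T)=T$; otherwise $\mathcal A(T)=\mathcal A_b^m(T)$ for the smallest $m$ such that the shape of $\mathcal A_b^m(T)$ is strictly larger than that of $T$. The map $\mathcal L$ is defined from $\mathcal L_b$ and leg entries in the same way. For a word $f_n\cdots f_1$ in $\{\mathcal A,\mathcal L\}$ let $T_0=T$ and $T_i=f_i(T_{i-1})$. Then $\mathcal U_{f_n\cdots f_1}(T)=(P,Q)$, where $P=T_n$ and $Q$ is the filling of the skew shape $\mathrm{shape}(T_n)/\mathrm{shape}(T)$ in which, for each $i$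 with $T_i\neq T_{i-1}$, the cell of $\mathrm{shape}(T_i)/\mathrm{shape}(T_{i-1})$ contains $\alpha_c$ if $f_i=\mathcal A$ and $c$ is the rightmost column of $T_{i-1}$ containing an arm entry, and $\beta_r$ if $f_i=\mathcal L$ and $r$ is the topmost row of $T_{i-1}$ containing a leg entry. If $T$ has $a$ arm entries and $\ell$ leg entries, then $\mathcal U_{\mathcal L^\infty\mathcal A^\infty}(T)$ denotes the common value of $\mathcal U_{\mathcal L^N\mathcal A^M}(T)$ for all $M\ge a$ and $N\ge\ell$, and $\mathcal U_{\mathcal A^\infty\mathcal L^\infty}(T)$ the common value of $\mathcal U_{\mathcal A^M\mathcal L^N}(T)$ for all such $M,N$. **Shuffle.** Let $Q$ be a filling of a skew shape $\mu/\lambda$ with letters $\alpha_k,\beta_k$ such that: (i) (flagged) $Q(i,j)=\alpha_k$ implies $0<k<j$, and $Q(i,j)=\beta_k$ implies $0<k<i$; (ii) ($\alpha$-column-strict) if $\alpha_k$ is weakly southwest of $\alpha_m$ then $k\ge m$, and distinct $\alpha$'s in the same column have different indices; (iii) ($\beta$-row-strict) if $\beta_k$ is weakly southwest of $\beta_m$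 then $k\ge m$, and distinct $\beta$'s in the same row have different indices; (iv) ($(\alpha,\beta)$-sorted) for some partition $\nu$ with $\lambda\subseteq\nu\subseteq\mu$ the $\alpha$'s occupy $\nu/\lambda$ and the $\beta$'s occupy $\mu/\nu$. Then $\mathsf{shuff}(Q)$ is obtained as follows. As long as some $\alpha$ has a $\beta$ directly above it or directly to its right, choose among all such $\alpha$'s those with the smallest index, and among these the rightmost one. Move it repeatedly, until there is no $\beta$ directly above it or directly to its right: if only one of these two cells contains a $\beta$, interchange the $\alpha$ with this $\beta$; if $\beta_k$ is above and $\beta_j$ is to the right, interchange the $\alpha$ with $\beta_k$ if $k>j$ and with $\beta_j$ if $k\le j$. **Theorem.** Let $T$ be a hook-valued tableau and set $(P_1,Q_1)=\mathcal U_{\mathcal L^\infty\mathcal A^\infty}(T)$ and $(P_2,Q_2)=\mathcal U_{\mathcal A^\infty\mathcal L^\infty}(T)$. Then $Q_1$ satisfies (i)–(iv), so that $\mathsf{shuff}(Q_1)$ is defined, and 1. $P_2=P_1$; 2. $Q_2=\mathsf{shuff}(Q_1)$. -/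

import Mathlib

/-!
Conventions. French notation; cells are pairs `(row, column)` counted from `0`, as in Mathlib's
`YoungDiagram`, so that the cell `(i, j)` here is the cell in row `i + 1` and column `j + 1` in the
usual counting from `1`. The indices of `α` and `β` are counted from `1`.
-/

namespace Uncrowding

/-- Iterate `f`, starting at `x`, until `P` holds for the first time: `f^[m] x` for the smallest
`m` with `P (f^[m] x)`. -/
noncomputable def iterateUntil {X : Type} (f : X → X) (P : X → Prop) (x : X) : X :=
  f^[sInf {m : ℕ | P (f^[m] x)}] x

/-! ### Hook-valued tableaux -/

/-- The content of a box: a hook entry, leg entries (strictly increasing, hence a finite set) and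
arm entries (weakly increasing, hence a multiset). -/
@[ext]
structure Hook where
  hook : ℕ
  legs : Finset ℕ
  arms : Multiset ℕ

namespace Hook

/-- The content of a position that is not a box. -/
def empty : Hook := ⟨0, ∅, 0⟩

/-- All entries of a box. -/
def entries (b : Hook) : Multiset ℕ := b.hook ::ₘ (b.legs.val + b.arms)

/-- The box holds a semistandard Young tableau of hook shape with positive entries. -/
def IsSemistandard (b : Hook) : Prop :=
  0 < b.hook ∧ (∀ l ∈ b.legs, b.hook < l) ∧ (∀ a ∈ b.arms, b.hook ≤ a)

/-- Replace the entry `k` of a box by `x`. If `k` is the hook entry it is the hook entry that is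
replaced, since it stands to the left of arm entries that are equal to it. -/
def replace (b : Hook) (k x : ℕ) : Hook :=
  if k = b.hook then { b with hook := x }
  else if k ∈ b.legs then { b with legs := insert x (b.legs.erase k) }
  else { b with arms := x ::ₘ b.arms.erase k }

end Hook

/-- A filling of a finite set of cells by hooks. -/
@[ext]
structure Filling where
  shape : Finset (ℕ × ℕ)
  box : ℕ × ℕ → Hook

namespace Filling

/-- Hook-valued tableaux. -/
structure IsHVT (T : Filling) : Prop where
  isLowerSet : IsLowerSet (T.shape : Set (ℕ × ℕ))
  box_eq_empty : ∀ p, p ∉ T.shape → T.box p = Hook.empty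
  semistandard : ∀ p ∈ T.shape, (T.box p).IsSemistandard
  row_weak : ∀ i j, (i, j + 1) ∈ T.shape →
    ∀ x ∈ (T.box (i, j)).entries, ∀ y ∈ (T.box (i, j + 1)).entries, x ≤ y
  col_strict : ∀ i j, (i + 1, j) ∈ T.shape →
    ∀ x ∈ (T.box (i, j)).entries, ∀ y ∈ (T.box (i + 1, j)).entries, x < y

/-- The number of arm entries. -/
def armCount (T : Filling) : ℕ := ∑ p ∈ T.shape, (T.box p).arms.card

/-- The number of leg entries. -/
def legCount (T : Filling) : ℕ := ∑ p ∈ T.shape, (T.box p).legs.card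

/-- The cells of row `i`. -/
def row (T : Filling) (i : ℕ) : Finset (ℕ × ℕ) := T.shape.filter fun p => p.1 = i

/-- The cells of column `j`. -/
def col (T : Filling) (j : ℕ) : Finset (ℕ × ℕ) := T.shape.filter fun p => p.2 = j

/-- The entries that occur in one of the given cells. -/
def entriesIn (T : Filling) (s : Finset (ℕ × ℕ)) : Finset ℕ :=
  s.biUnion fun p => (T.box p).entries.toFinset

/-! #### Arm uncrowding -/

/-- The cells that contain an arm entry. -/
def armCells (T : Filling) : Finset (ℕ × ℕ) := T.shape.filter fun p => (T.box p).arms ≠ 0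

/-- The rightmost column containing an arm. -/
def armCol (T : Filling) : ℕ := T.armCells.sup Prod.snd

/-- The largest arm entry in the rightmost column containing an arm. -/
def armEntry (T : Filling) : ℕ := (T.col T.armCol).sup fun p => (T.box p).arms.sup

/-- The row of the cell containing the arm entry `armEntry` in column `armCol` (a unique cell, for
a hook-valued tableau). -/
def armRow (T : Filling) : ℕ :=
  ((T.col T.armCol).filter fun p => T.armEntry ∈ (T.box p).arms).sup Prod.fst

/-- The entries `k ≥ a` in the column `c + 1`, where `a` is the arm entry to be bumped. -/
def armTargets (T : Filling) : Finset ℕ :=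
  (T.entriesIn (T.col (T.armCol + 1))).filter fun k => T.armEntry ≤ k

/-- Arm-uncrowding bumping. -/
def armBump (T : Filling) : Filling :=
  if T.armCells.Nonempty then
    let r := T.armRow
    let c := T.armCol
    let a := T.armEntry
    let b := T.box (r, c)
    let bigLegs := b.legs.filter fun l => a < l
    if h : T.armTargets.Nonempty then
      let k := T.armTargets.min' h
      -- the (unique) row of column `c + 1` that contains `k`
      let r' := ((T.col (c + 1)).filter fun p => k ∈ (T.box p).entries).sup Prod.fst
      let moved := if r = r' then bigLegs else ∅
      let b' := (T.box (r', c + 1)).replace k a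
      { shape := T.shape
        box := Function.update
          (Function.update T.box (r, c) ⟨b.hook, b.legs \ moved, b.arms.erase a⟩)
          (r', c + 1) ⟨b'.hook, b'.legs ∪ moved, k ::ₘ b'.arms⟩ }
    else
      let r' := (T.col (c + 1)).card
      let moved := if r = r' then bigLegs else ∅
      { shape := insert (r', c + 1) T.shape
        box := Function.update
          (Function.update T.box (r, c) ⟨b.hook, b.legs \ moved, b.arms.erase a⟩)
          (r', c + 1) ⟨a, moved, 0⟩ }
  else T

/-- Single-arm-uncrowding. -/
noncomputable def singleArm (T : Filling) : Filling :=
  if T.armCells.Nonempty then iterateUntil armBump (fun S => T.shape ⊂ S.shape) T else T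

/-! #### Leg uncrowding -/

/-- The cells that contain a leg entry. -/
def legCells (T : Filling) : Finset (ℕ × ℕ) := T.shape.filter fun p => (T.box p).legs ≠ ∅

/-- The topmost row containing a leg. -/
def legRow (T : Filling) : ℕ := T.legCells.sup Prod.fst

/-- The largest leg entry in the topmost row containing a leg. -/
def legEntry (T : Filling) : ℕ := (T.row T.legRow).sup fun p => (T.box p).legs.sup id

/-- The column of the cell containing the leg entry `legEntry` in row `legRow` (a unique cell, for
a hook-valued tableau). -/
def legCol (T : Filling) : ℕ :=
  ((T.row T.legRow).filter fun p => T.legEntry ∈ (T.box p).legs).sup Prod.snd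

/-- The entries `k > ℓ` in the row `r + 1`, where `ℓ` is the leg entry to be bumped. -/
def legTargets (T : Filling) : Finset ℕ :=
  (T.entriesIn (T.row (T.legRow + 1))).filter fun k => T.legEntry < k

/-- Leg-uncrowding bumping. If the smallest `k > ℓ` occurs several times in row `r + 1`, the
leftmost occurrence is bumped. The arm entries that move up with `ℓ` are those that are at
least `ℓ`, and they move to the cell `(r + 1, c)`. -/
def legBump (T : Filling) : Filling :=
  if T.legCells.Nonempty then
    let r := T.legRow
    let c := T.legCol
    let l := T.legEntry
    let b := T.box (r, c)
    let bigArms := b.arms.filter fun a => l ≤ a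
    if h : T.legTargets.Nonempty then
      let k := T.legTargets.min' h
      -- the leftmost column of row `r + 1` that contains `k`
      let cols := ((T.row (r + 1)).filter fun p => k ∈ (T.box p).entries).image Prod.snd
      let c' := if h' : cols.Nonempty then cols.min' h' else 0
      let moved := if c = c' then bigArms else 0
      let b' := (T.box (r + 1, c')).replace k l
      { shape := T.shape
        box := Function.update
          (Function.update T.box (r, c) ⟨b.hook, b.legs.erase l, b.arms - moved⟩)
          (r + 1, c') ⟨b'.hook, insert k b'.legs, b'.arms + moved⟩ }
    else
      let c' := (T.row (r + 1)).card
      let moved := if c = c' then bigArms else 0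
      { shape := insert (r + 1, c') T.shape
        box := Function.update
          (Function.update T.box (r, c) ⟨b.hook, b.legs.erase l, b.arms - moved⟩)
          (r + 1, c') ⟨l, ∅, moved⟩ }
  else T

/-- Single-leg-uncrowding. -/
noncomputable def singleLeg (T : Filling) : Filling :=
  if T.legCells.Nonempty then iterateUntil legBump (fun S => T.shape ⊂ S.shape) T else T

end Filling

/-! ### Mixed tableaux -/

/-- The letters `α_k` and `β_k`. -/
inductive Letter where
  | alpha (k : ℕ)
  | beta (k : ℤ)
  deriving DecidableEq

/-- A partial filling by letters, together with an inner and an outer shape. -/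
@[ext]
structure Recording where
  inner : Finset (ℕ × ℕ)
  outer : Finset (ℕ × ℕ)
  entry : ℕ × ℕ → Option Letter

namespace Recording

/-- Mixed tableaux of skew shape `outer / inner`. -/
structure IsMixed (Q : Recording) : Prop where
  inner_isLowerSet : IsLowerSet (Q.inner : Set (ℕ × ℕ))
  outer_isLowerSet : IsLowerSet (Q.outer : Set (ℕ × ℕ))
  inner_subset : Q.inner ⊆ Q.outer
  entry_isSome : ∀ p, (Q.entry p).isSome ↔ p ∈ Q.outer ∧ p ∉ Q.inner
  alpha_pos : ∀ p k, Q.entry p = some (.alpha k) → 0 < k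

/-- Flagged-mixed tableaux. -/
structure IsFlaggedMixed (Q : Recording) : Prop extends Q.IsMixed where
  alpha_flag : ∀ i j k, Q.entry (i, j) = some (.alpha k) → 0 < k ∧ k < j + 1
  beta_flag : ∀ i j k, Q.entry (i, j) = some (.beta k) → 0 < k ∧ k < (i : ℤ) + 1

/-- `α`-column-strict; `p ≤ q` says that `p` is weakly southwest of `q`. -/
def AlphaColStrict (Q : Recording) : Prop :=
  ∀ p q k m, Q.entry p = some (.alpha k) → Q.entry q = some (.alpha m) →
    (p ≤ q → m ≤ k) ∧ (p ≠ q → p.2 = q.2 → k ≠ m)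

/-- `β`-row-strict. -/
def BetaRowStrict (Q : Recording) : Prop :=
  ∀ p q k m, Q.entry p = some (.beta k) → Q.entry q = some (.beta m) →
    (p ≤ q → m ≤ k) ∧ (p ≠ q → p.1 = q.1 → k ≠ m)

/-- `(α, β)`-sorted. -/
def AlphaBetaSorted (Q : Recording) : Prop :=
  ∃ ν : YoungDiagram, Q.inner ⊆ ν.cells ∧ ν.cells ⊆ Q.outer ∧
    (∀ p, (∃ k, Q.entry p = some (.alpha k)) ↔ p ∈ ν ∧ p ∉ Q.inner) ∧
    (∀ p, (∃ k, Q.entry p = some (.beta k)) ↔ p ∈ Q.outer ∧ p ∉ ν)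

/-- The tableaux to which the shuffle is applied. -/
structure IsShufflable (Q : Recording) : Prop where
  isFlaggedMixed : Q.IsFlaggedMixed
  alphaColStrict : Q.AlphaColStrict
  betaRowStrict : Q.BetaRowStrict
  alphaBetaSorted : Q.AlphaBetaSorted

/-! #### The jeu de taquin shuffle -/

/-- The index of the `α` in a cell, if the cell contains an `α`. -/
def alphaAt (Q : Recording) (p : ℕ × ℕ) : Option ℕ :=
  match Q.entry p with
  | some (.alpha k) => some k
  | _ => none

/-- The index of the `β` in a cell, if the cell contains a `β`. -/
def betaAt (Q : Recording) (p : ℕ × ℕ) : Option ℤ :=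
  match Q.entry p with
  | some (.beta k) => some k
  | _ => none

/-- The cell directly above. -/
def up (p : ℕ × ℕ) : ℕ × ℕ := (p.1 + 1, p.2)

/-- The cell directly to the right. -/
def right (p : ℕ × ℕ) : ℕ × ℕ := (p.1, p.2 + 1)

/-- Interchange the entries of two cells. -/
def switch (Q : Recording) (p q : ℕ × ℕ) : Recording :=
  { Q with entry := Q.entry ∘ Equiv.swap p q }

/-- No `β` directly above or directly to the right of `p`. -/
def Settled (Q : Recording) (p : ℕ × ℕ) : Prop :=
  Q.betaAt (up p) = none ∧ Q.betaAt (right p) = none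

/-- One switch of the `α` in the current cell, together with its new cell. -/
def slideStep : Recording × (ℕ × ℕ) → Recording × (ℕ × ℕ) := fun (Q, p) =>
  match Q.betaAt (up p), Q.betaAt (right p) with
  | none, none => (Q, p)
  | some _, none => (Q.switch p (up p), up p)
  | none, some _ => (Q.switch p (right p), right p)
  | some k, some j =>
    if j < k then (Q.switch p (up p), up p) else (Q.switch p (right p), right p)

/-- The switching process for the `α` in the cell `p`. -/
noncomputable def slide (Q : Recording) (p : ℕ × ℕ) : Recording :=
  (iterateUntil slideStep (fun s => s.1.Settled s.2) (Q, p)).1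

/-- The cells with an `α` that have a `β` directly above or directly to the right. -/
def movable (Q : Recording) : Finset (ℕ × ℕ) :=
  Q.outer.filter fun p => (Q.alphaAt p).isSome ∧
    ((Q.betaAt (up p)).isSome ∨ (Q.betaAt (right p)).isSome)

/-- The indices of the movable `α`s. -/
def movableIndices (Q : Recording) : Finset ℕ :=
  Q.movable.image fun p => (Q.alphaAt p).getD 0

/-- One round of the shuffle: the switching process is applied to the rightmost one among the
movable `α`s with the smallest index. -/
noncomputable def shuffleRound (Q : Recording) : Recording :=
  if h : Q.movableIndices.Nonempty then
    let s := Q.movable.filter fun p => Q.alphaAt p = some (Q.movableIndices.min' h)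
    let c := s.sup Prod.snd
    let r := (s.filter fun p => p.2 = c).sup Prod.fst
    Q.slide (r, c)
  else Q

/-- The jeu de taquin shuffle. -/
noncomputable def shuff (Q : Recording) : Recording :=
  iterateUntil shuffleRound (fun R => R.movable = ∅) Q

end Recording

/-! ### The uncrowding map -/

/-- The alphabet of uncrowding words. -/
inductive Op where
  | A
  | L

/-- One step of the uncrowding map: apply the operator to the current tableau and record `α_c`
(respectively `β_r`) in the new cell. -/
noncomputable def uncrowdStep (f : Op) (s : Filling × (ℕ × ℕ → Option Letter)) :
    Filling × (ℕ × ℕ → Option Letter) :=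
  match f with
  | .A =>
    if s.1.armCells.Nonempty then
      (s.1.singleArm, fun p => if p ∈ s.1.singleArm.shape \ s.1.shape then
        some (.alpha (s.1.armCol + 1)) else s.2 p)
    else s
  | .L =>
    if s.1.legCells.Nonempty then
      (s.1.singleLeg, fun p => if p ∈ s.1.singleLeg.shape \ s.1.shape then
        some (.beta (s.1.legRow + 1)) else s.2 p)
    else s

/-- The uncrowding map of a word `f_n ⋯ f_1`, given as the list `[f_n, …, f_1]`; the last letter of
the list acts first. The result is the pair of insertion tableau and recording tableau. -/
noncomputable def uncrowd (w : List Op) (T : Filling) : Filling × Recording :=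
  let s := w.foldr uncrowdStep (T, fun _ => none)
  (s.1, ⟨T.shape, s.1.shape, s.2⟩)

end Uncrowding

/-! Transposition exchanges arm bumping with leg bumping, except that weak and strict inequalities
trade places. Both are therefore treated as a single operation on arrays of hooks: `Valid β γ` with
`β + γ = 1` records which direction is weak, a leg bump of `F` is an arm bump of `F.transpose`, and
every local statement needs only one proof.

The core is the local commutation `bump_square`. An arm bump and a leg bump that start from the same
array can be completed to a commutative square, in which opposite sides create the same cell or both
create none. The only exception is that both create the same cell `(p, q)`. Let `a` be the arm and
`l` the leg. If `a < l + β`, so that `a` may stand to the left of `l`, then arm first puts `a` into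
the cell and `l` to its right, while leg first puts `l` into the cell, from where `a` bumps it to
the right; both orders end by creating `(p, q + 1)`. Otherwise the transposed statement holds, with
`(p + 1, q)`. Pasting such squares (`run_strip`, `Run.square`) shows that uncrowding one arm
commutes with uncrowding one leg. The two new cells are unaffected by the order, or they coincide
and the cell created second is, in both orders, the same neighbour above or to the right. Hence
`uncrowdGrid p q` is a commutative grid, and `P₂ = P₁` is its last corner.

The grid is a growth diagram. `Q₁` and `Q₂` list the cells added along its two extreme paths, and
crossing one square of the grid either changes nothing or switches an `α` with an adjacent `β`.
Moving the path across the grid one `α` at a time, the last one first, turns `Q₁` into `Q₂`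
(`SwitchGrid`). It remains to see that the shuffle makes the same choices. Consecutive arm runs
start in weakly decreasing columns, and from the same column they end further and further to the
right (`Run.col_le`, `Run.col_lt_col`), by an argument like the bumping lemma for Robinson–Schensted
insertion. So the last `α` not yet moved has the smallest index and is the rightmost with this
index. The transposed fact for legs shows that the rule for two competing `β`s picks the one that
was added first (`slideStep_eq`). The same monotonicity gives the strictness conditions on `Q₁`, and
the flag condition holds because a run ends strictly beyond its starting column. -/

namespace Uncrowding

/-! ### Arrays of hooks and a single bump, self-dual under transposition -/

/-- An array of hooks on a (possibly infinite) shape, with legs and arms treated alike. -/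
@[ext]
structure HookArray where
  sh : ℕ → ℕ → Prop
  hook : ℕ → ℕ → ℕ
  legs : ℕ → ℕ → Multiset ℕ
  arms : ℕ → ℕ → Multiset ℕ

namespace HookArray

/-- Exchange rows with columns, and legs with arms. -/
def transpose (F : HookArray) : HookArray :=
  ⟨fun i j => F.sh j i, fun i j => F.hook j i, fun i j => F.arms j i, fun i j => F.legs j i⟩

/-- `x` is an entry of the position `(i, j)`. -/
def Ent (F : HookArray) (i j x : ℕ) : Prop :=
  x = F.hook i j ∨ x ∈ F.legs i j ∨ x ∈ F.arms i j

/-- Semistandardness, where `x` may stand to the left of `y` if `x < y + β` and below `y` if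
`x < y + γ`. For `β = 1`, `γ = 0` these are the hook-valued tableaux, for `β = 0`, `γ = 1` their
transposes. -/
structure Valid (β γ : ℕ) (F : HookArray) : Prop where
  weight : β + γ = 1
  lower : ∀ {i j i' j'}, F.sh i j → i' ≤ i → j' ≤ j → F.sh i' j'
  hook_off : ∀ {i j}, ¬ F.sh i j → F.hook i j = 0
  legs_off : ∀ {i j}, ¬ F.sh i j → F.legs i j = 0
  arms_off : ∀ {i j}, ¬ F.sh i j → F.arms i j = 0
  legs_gt : ∀ {i j x}, x ∈ F.legs i j → F.hook i j < x + γ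
  arms_gt : ∀ {i j x}, x ∈ F.arms i j → F.hook i j < x + β
  row : ∀ {i j x y}, F.sh i (j + 1) → F.Ent i j x → F.Ent i (j + 1) y → x < y + β
  col : ∀ {i j x y}, F.sh (i + 1) j → F.Ent i j x → F.Ent (i + 1) j y → x < y + γ
  legs_nodup : γ = 0 → ∀ i j, (F.legs i j).Nodup
  arms_nodup : β = 0 → ∀ i j, (F.arms i j).Nodup

/-- The arm entry `a` in the cell `(r, c)` is the next one to be bumped. -/
structure ArmSel (F : HookArray) (r c a : ℕ) : Prop where
  mem : a ∈ F.arms r c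
  right : ∀ i j, c < j → F.arms i j = 0
  max : ∀ i x, x ∈ F.arms i c → x ≤ a

/-- The entry `a` is inserted into the cell `(s, c + 1)`. It bumps `k` if `b` is true, and the cell
is new if `b` is false. -/
structure ArmTgt (β : ℕ) (F : HookArray) (c a s k : ℕ) (b : Bool) : Prop where
  below_sh : ∀ i, i < s → F.sh i (c + 1)
  below : ∀ i x, i < s → F.Ent i (c + 1) x → x + β ≤ a
  old_sh : b = true → F.sh s (c + 1)
  old_mem : b = true → k = F.hook s (c + 1) ∨ k ∈ F.legs s (c + 1)
  old_le : b = true → a < k + β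
  old_min : b = true → ∀ x, F.Ent s (c + 1) x → a < x + β → k ≤ x
  new_sh : b = false → ¬ F.sh s (c + 1)
  new_eq : b = false → k = F.hook s (c + 1)

/-- The result of bumping `a` from `(r, c)` into `(s, c + 1)`. -/
def armRes (γ : ℕ) (F : HookArray) (r c a s k : ℕ) (b : Bool) : HookArray where
  sh i j := F.sh i j ∨ (i = s ∧ j = c + 1)
  hook i j := if i = s ∧ j = c + 1 ∧ k = F.hook i j then a else F.hook i j
  legs i j :=
    if i = r ∧ j = c then (F.legs i j).filter fun x => ¬ (s = r ∧ a < x + γ)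
    else if i = s ∧ j = c + 1 then
      (if k = F.hook i j then F.legs i j else a ::ₘ (F.legs i j).erase k) +
        (F.legs r c).filter fun x => s = r ∧ a < x + γ
    else F.legs i j
  arms i j :=
    if i = r ∧ j = c then (F.arms i j).erase a
    else if i = s ∧ j = c + 1 then (if b = true then {k} else 0) + F.arms i j
    else F.arms i j

/-- One bump out of column `c` into the cell `(s, c + 1)`. -/
def ArmStep (β γ : ℕ) (F F' : HookArray) (c a s k : ℕ) (b : Bool) : Prop :=
  ∃ r, F.ArmSel r c a ∧ F.ArmTgt β c a s k b ∧ F' = F.armRes γ r c a s k b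

variable {β γ : ℕ} {F F' X Y : HookArray} {r c a s k : ℕ} {b : Bool}

theorem ent_hook (F : HookArray) (i j : ℕ) : F.Ent i j (F.hook i j) := Or.inl rfl

theorem ent_of_legs {i j x : ℕ} (h : x ∈ F.legs i j) : F.Ent i j x := Or.inr (Or.inl h)

theorem ent_of_arms {i j x : ℕ} (h : x ∈ F.arms i j) : F.Ent i j x := Or.inr (Or.inr h)

namespace Valid

/-- The conditions are self-dual once `β` and `γ` trade places, which lets each fact about arms
serve for legs as well. -/
theorem transpose (h : F.Valid β γ) : F.transpose.Valid γ β where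
  weight := by have := h.weight; omega
  lower := fun a b c => h.lower a c b
  hook_off := fun a => h.hook_off a
  legs_off := fun a => h.arms_off a
  arms_off := fun a => h.legs_off a
  legs_gt := fun a => h.arms_gt a
  arms_gt := fun a => h.legs_gt a
  row := fun a b c => h.col a (by unfold Ent at *; tauto) (by unfold Ent at *; tauto)
  col := fun a b c => h.row a (by unfold Ent at *; tauto) (by unfold Ent at *; tauto)
  legs_nodup := fun a i j => h.arms_nodup a j i
  arms_nodup := fun a i j => h.legs_nodup a j i

theorem sh_of_legs (h : F.Valid β γ) {i j x : ℕ} (hx : x ∈ F.legs i j) : F.sh i j := by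
  by_contra hn
  simp [h.legs_off hn] at hx

theorem sh_of_arms (h : F.Valid β γ) {i j x : ℕ} (hx : x ∈ F.arms i j) : F.sh i j := by
  by_contra hn
  simp [h.arms_off hn] at hx

theorem hook_le (h : F.Valid β γ) {i j x : ℕ} (hx : F.Ent i j x) : F.hook i j ≤ x := by
  have := h.weight
  rcases hx with rfl | hx | hx
  · exact le_rfl
  · have := h.legs_gt hx; omega
  · have := h.arms_gt hx; omega

theorem row_lt (h : F.Valid β γ) {i j j' x y : ℕ} (hs : F.sh i j') (hj : j < j')
    (hx : F.Ent i j x) (hy : F.Ent i j' y) : x < y + β := by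
  have hw := h.weight
  induction j', hj using Nat.le_induction generalizing y with
  | base => exact h.row hs hx hy
  | succ n hn ih =>
    have h1 := ih (h.lower hs le_rfl (Nat.le_succ n)) (F.ent_hook i n)
    have h2 := h.row hs (F.ent_hook i n) hy
    omega

theorem col_lt (h : F.Valid β γ) {i i' j x y : ℕ} (hs : F.sh i' j) (hi : i < i')
    (hx : F.Ent i j x) (hy : F.Ent i' j y) : x < y + γ :=
  h.transpose.row_lt (F := F.transpose) hs hi (by unfold Ent at *; tauto)
    (by unfold Ent at *; tauto)

/-- Of the two steps around the corner `(i, j')` exactly one is strict, as `β + γ = 1`. -/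
theorem diag_lt (h : F.Valid β γ) {i i' j j' x y : ℕ} (hs : F.sh i' j') (hi : i < i')
    (hj : j < j') (hx : F.Ent i j x) (hy : F.Ent i' j' y) : x < y := by
  have h1 := h.row_lt (h.lower hs hi.le le_rfl) hj hx (F.ent_hook i j')
  have h2 := h.col_lt hs hi (F.ent_hook i j') hy
  have := h.weight
  omega

/-- An arm entry never moves up. -/
theorem tgt_le (h : F.Valid β γ) (hs : F.ArmSel r c a) (ht : F.ArmTgt β c a s k b) : s ≤ r := by
  by_contra hn
  have hn : r < s := by omega
  have h1 := h.row (ht.below_sh r hn) (ent_of_arms hs.mem) (F.ent_hook _ _)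
  have h2 := ht.below r _ hn (F.ent_hook _ _)
  omega

/-- When the entry stays in its row it replaces the hook entry. -/
theorem tgt_hook (h : F.Valid β γ) (hs : F.ArmSel r c a) (ht : F.ArmTgt β c a r k b) :
    k = F.hook r (c + 1) := by
  cases b
  · exact ht.new_eq rfl
  · have h1 := h.row (ht.old_sh rfl) (ent_of_arms hs.mem) (F.ent_hook _ _)
    have h2 := ht.old_min rfl _ (F.ent_hook _ _) h1
    have h3 : F.Ent r (c + 1) k := by
      rcases ht.old_mem rfl with h | h
      · exact Or.inl h
      · exact Or.inr (Or.inl h)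
    have := h.hook_le h3
    omega

end Valid

/-! ### A bump preserves semistandardness -/

theorem mem_legs_res {i j x : ℕ} (h : x ∈ (F.armRes γ r c a s k b).legs i j) :
    x ∈ F.legs i j ∧ ¬ (i = r ∧ j = c ∧ s = r ∧ a < x + γ) ∨
      i = s ∧ j = c + 1 ∧ (x = a ∧ k ≠ F.hook s (c + 1) ∨
        s = r ∧ x ∈ F.legs r c ∧ a < x + γ) := by
  unfold armRes at h
  dsimp only at h
  split_ifs at h with h1 h2 h3 <;> (try simp only [Multiset.mem_filter, Multiset.mem_add,
    Multiset.mem_cons] at h)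
  · left; exact ⟨h.1, fun hh => h.2 hh.2.2⟩
  · obtain ⟨rfl, rfl⟩ := h2
    rcases h with h | h
    · left; exact ⟨h, by omega⟩
    · right; exact ⟨rfl, rfl, Or.inr ⟨h.2.1, h.1, h.2.2⟩⟩
  · obtain ⟨rfl, rfl⟩ := h2
    rcases h with (h | h) | h
    · right; exact ⟨rfl, rfl, Or.inl ⟨h, h3⟩⟩
    · left; exact ⟨Multiset.mem_of_mem_erase h, by omega⟩
    · right; exact ⟨rfl, rfl, Or.inr ⟨h.2.1, h.1, h.2.2⟩⟩
  · left; exact ⟨h, by omega⟩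

theorem mem_arms_res {i j x : ℕ} (h : x ∈ (F.armRes γ r c a s k b).arms i j) :
    x ∈ F.arms i j ∨ i = s ∧ j = c + 1 ∧ b = true ∧ x = k := by
  unfold armRes at h
  dsimp only at h
  split_ifs at h with h1 h2 h3
  · exact Or.inl (Multiset.mem_of_mem_erase h)
  · simp at h; tauto
  · simp at h; tauto
  · exact Or.inl h

/-- The entries after a bump, with what is known about them. -/
theorem ent_res (hv : F.Valid β γ) (hs : F.ArmSel r c a) (ht : F.ArmTgt β c a s k b) {i j x : ℕ}
    (h : (F.armRes γ r c a s k b).Ent i j x) :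
    (F.Ent i j x ∨ i = s ∧ j = c + 1 ∧ (x = a ∨ s = r ∧ x ∈ F.legs r c ∧ a < x + γ)) ∧
      (i = r → j = c → s = r → x < a + β) ∧ (i = s → j = c + 1 → b = false → x = a ∨ s = r ∧ x ∈ F.legs r c ∧ a < x + γ) := by
  have hw := hv.weight
  have hr := hv.sh_of_arms hs.mem
  refine ⟨?_, ?_, ?_⟩
  · rcases h with h | h | h
    · unfold armRes at h
      dsimp only at h
      split_ifs at h with h1
      · right; exact ⟨h1.1, h1.2.1, Or.inl h⟩
      · left; exact Or.inl h
    · rcases mem_legs_res h with h | h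
      · exact Or.inl (ent_of_legs h.1)
      · exact Or.inr ⟨h.1, h.2.1, h.2.2.imp (fun h => h.1) id⟩
    · rcases mem_arms_res h with h | ⟨rfl, rfl, hb, rfl⟩
      · exact Or.inl (ent_of_arms h)
      · rcases ht.old_mem hb with h | h
        · exact Or.inl (Or.inl h)
        · exact Or.inl (ent_of_legs h)
  · rintro rfl rfl rfl
    rcases h with h | h | h
    · simp [armRes] at h
      have := hv.arms_gt hs.mem
      omega
    · rcases mem_legs_res h with h | h
      · by_contra hn
        exact h.2 ⟨rfl, rfl, rfl, by omega⟩
      · omega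
    -- The removed `a` was a largest arm. A second copy can stay behind only if `β = 1`, and then `x
    -- = a` is allowed.
    · simp only [armRes, and_self, if_true] at h
      have h1 := hs.max _ _ (Multiset.mem_of_mem_erase h)
      by_cases hb : β = 0
      · have := (Multiset.Nodup.mem_erase_iff (hv.arms_nodup hb _ _)).1 h
        omega
      · omega
  · rintro rfl rfl rfl
    have hn := ht.new_sh rfl
    rcases h with h | h | h
    · simp [armRes, ht.new_eq] at h
      exact Or.inl h
    · rcases mem_legs_res h with h | h
      · simp [hv.legs_off hn] at h
      · exact h.2.2.imp (fun h => h.1) id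
    · rcases mem_arms_res h with h | h
      · simp [hv.arms_off hn] at h
      · simp at h

/-- The target row satisfies `s ≤ r`. If `s < r`, the left neighbour of the target is bounded
through the hook of `(r, c)`. If `s = r`, then `a` becomes the hook to the right of its old cell,
and the legs with `a < x + γ` are exactly those that could no longer stand to the left of it; these
move along. -/
theorem Valid.armRes (hv : F.Valid β γ) (hs : F.ArmSel r c a) (ht : F.ArmTgt β c a s k b) :
    (F.armRes γ r c a s k b).Valid β γ := by
  have hw := hv.weight
  have hr := hv.sh_of_arms hs.mem
  have hsr := hv.tgt_le hs ht
  have hk : b = true → F.Ent s (c + 1) k := fun hb => (ht.old_mem hb).imp id Or.inl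
  have hsc : F.sh s c := hv.lower hr hsr le_rfl
  have hha := hv.arms_gt hs.mem
  have hhk : b = true → F.hook s (c + 1) ≤ k := fun hb => hv.hook_le (hk hb)
  have hkr : s = r → k = F.hook s (c + 1) := by rintro rfl; exact hv.tgt_hook hs ht
  refine ⟨hw, ?_, ?_, ?_, ?_, ?_, ?_, ?_, ?_, ?_, ?_⟩
  · rintro i j i' j' (h | ⟨rfl, rfl⟩) hi hj
    · exact Or.inl (hv.lower h hi hj)
    · rcases Nat.lt_or_ge i' i with h | h
      · exact Or.inl (hv.lower (ht.below_sh i' h) le_rfl hj)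
      · obtain rfl : i' = i := by omega
        rcases Nat.lt_or_ge j' (c + 1) with h | h
        · exact Or.inl (hv.lower hsc le_rfl (by omega))
        · exact Or.inr ⟨rfl, by omega⟩
  · intro i j h
    have h : ¬ F.sh i j ∧ ¬ (i = s ∧ j = c + 1) := not_or.1 h
    have := hv.hook_off h.1
    simp only [HookArray.armRes]
    split_ifs with h1
    · exact absurd ⟨h1.1, h1.2.1⟩ h.2
    · exact this
  · intro i j h
    have h : ¬ F.sh i j ∧ ¬ (i = s ∧ j = c + 1) := not_or.1 h
    simp only [HookArray.armRes, h.2, if_false, hv.legs_off h.1]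
    simp
  · intro i j h
    have h : ¬ F.sh i j ∧ ¬ (i = s ∧ j = c + 1) := not_or.1 h
    simp only [HookArray.armRes, h.2, if_false, hv.arms_off h.1]
    simp
  · intro i j x h
    simp only [HookArray.armRes]
    rcases mem_legs_res h with ⟨h', -⟩ | ⟨rfl, rfl, h'⟩ <;> clear h
    · split_ifs with h1
      · obtain ⟨rfl, rfl, h1⟩ := h1
        have := hv.legs_gt h'
        cases b
        · simp [hv.legs_off (ht.new_sh rfl)] at h'
        · have := ht.old_le rfl; omega
      · exact hv.legs_gt h'
    · rcases h' with ⟨rfl, h⟩ | h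
      · rw [if_neg (by tauto)]
        by_contra hn
        cases b
        · exact h (ht.new_eq rfl)
        · have := ht.old_min rfl _ (F.ent_hook _ _) (by omega)
          have := hhk rfl
          omega
      · rw [if_pos ⟨rfl, rfl, hkr h.1⟩]
        omega
  · intro i j x h
    simp only [HookArray.armRes]
    rcases mem_arms_res h with h' | ⟨rfl, rfl, hb, rfl⟩ <;> clear h
    · split_ifs with h1
      · obtain ⟨rfl, rfl, h1⟩ := h1
        simp [hs.right i (c + 1) (by omega)] at h'
      · exact hv.arms_gt h'
    · split_ifs with h1
      · exact ht.old_le hb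
      · have := hhk hb
        have : x ≠ F.hook i (c + 1) := fun h => h1 ⟨rfl, rfl, h⟩
        omega
  · intro i j x y h hx hy
    have h1 := ent_res hv hs ht hx
    have h2 := ent_res hv hs ht hy
    rcases h with h | ⟨rfl, hj⟩
    · rcases h1.1 with hx' | ⟨rfl, rfl, hx'⟩
      · rcases h2.1 with hy' | ⟨rfl, hj, hy'⟩
        · exact hv.row h hx' hy'
        · obtain rfl : j = c := by omega
          have h3 : x < a + β := by
            rcases Nat.lt_or_ge i r with h | h
            · have := hv.col_lt hr h hx' (F.ent_hook _ _)
              omega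
            · exact h1.2.1 (by omega) rfl (by omega)
          rcases hy' with rfl | hy'
          · exact h3
          · omega
      · have hb : b = true := by
          by_contra hb
          exact ht.new_sh (by simpa using hb) (hv.lower h le_rfl (by omega))
        rcases h2.1 with hy' | ⟨_, hj, _⟩
        · rcases hx' with rfl | hx'
          · have := hv.row h (hk hb) hy'
            have := ht.old_le hb
            omega
          · rw [hx'.1] at hy' h
            have := hv.row_lt h (by omega) (ent_of_legs hx'.2.1) hy'
            omega
        · omega
    · obtain rfl : j = c := by omega
      rcases h1.1 with hx' | h
      · have h3 : x < a + β := by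
          rcases Nat.lt_or_ge i r with h | h
          · have := hv.col_lt hr h hx' (F.ent_hook _ _)
            omega
          · exact h1.2.1 (by omega) rfl (by omega)
        rcases h2.1 with hy' | ⟨_, hj, hy'⟩
        · by_cases hb : b = true
          · exact hv.row (ht.old_sh hb) hx' hy'
          · have := h2.2.2 rfl hj (by simpa using hb)
            omega
        · omega
      · omega
  · intro i j x y h hx hy
    have h1 := ent_res hv hs ht hx
    have h2 := ent_res hv hs ht hy
    have hlt : i + 1 = s → j = c + 1 → F.Ent i j x → x < a + γ := by
      rintro rfl rfl hx'
      have := ht.below i x (by omega) hx'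
      omega
    rcases h1.1 with hx' | ⟨rfl, rfl, hx'⟩
    · rcases h2.1 with hy' | ⟨hi, hj, hy'⟩
      · by_cases hc : F.sh (i + 1) j
        · exact hv.col hc hx' hy'
        · rcases h with h | ⟨rfl, rfl⟩
          · exact absurd h hc
          · have hb : b = false := by
              by_contra hb
              exact hc (ht.old_sh (by simpa using hb))
            have h3 := h2.2.2 rfl rfl hb
            have := hlt rfl rfl hx'
            omega
      · have := hlt hi hj hx'
        omega
    · replace h : F.sh (i + 1) (c + 1) := by
        rcases h with h | h
        · exact h
        · omega
      rcases h2.1 with hy' | ⟨hi, hj, _⟩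
      · have hb : b = true := by
          by_contra hb
          exact ht.new_sh (by simpa using hb) (hv.lower h (by omega) le_rfl)
        rcases hx' with rfl | ⟨rfl, hx', -⟩
        · have := hv.col h (hk hb) hy'
          have := ht.old_le hb
          omega
        · have := hv.diag_lt h (by omega) (by omega) (ent_of_legs hx') hy'
          omega
      · omega
  · intro hg i j
    have hn := hv.legs_nodup hg
    simp only [HookArray.armRes]
    split_ifs with h1 h2 h3
    · exact (hn _ _).filter _
    · refine (Multiset.nodup_add).2 ⟨hn _ _, (hn _ _).filter _, ?_⟩
      rw [Multiset.disjoint_left]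
      intro x hx hx'
      obtain ⟨rfl, rfl⟩ := h2
      simp only [Multiset.mem_filter] at hx'
      obtain ⟨hx1, rfl, hx2⟩ := hx'
      have := hv.row (hv.sh_of_legs hx) (ent_of_legs hx1) (F.ent_hook _ _)
      have := hv.legs_gt hx
      omega
    · obtain ⟨rfl, rfl⟩ := h2
      have hne : i ≠ r := fun h => h3 (hkr h)
      simp only [hne, false_and, Multiset.filter_false, add_zero, Multiset.nodup_cons]
      refine ⟨?_, (hn _ _).erase _⟩
      rw [Multiset.Nodup.mem_erase_iff (hn _ _)]
      rintro ⟨h4, h5⟩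
      cases b
      · exact h3 (ht.new_eq rfl)
      · have := ht.old_min rfl _ (ent_of_legs h5) (by omega)
        have := ht.old_le rfl
        omega
    · exact hn _ _
  · intro hg i j
    have hn := hv.arms_nodup hg
    simp only [HookArray.armRes]
    split_ifs with h1 h2 h3
    · exact (hn _ _).erase _
    · obtain ⟨rfl, rfl⟩ := h2
      simp [hs.right i (c + 1) (by omega)]
    · simpa using hn _ _
    · exact hn _ _

theorem ArmStep.valid (h : ArmStep β γ F F' c a s k b) (hv : F.Valid β γ) : F'.Valid β γ := by
  obtain ⟨r, hs, ht, rfl⟩ := h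
  exact hv.armRes hs ht

end HookArray
end Uncrowding

namespace Uncrowding
namespace HookArray

variable {β γ : ℕ} {F F' X Y Z W : HookArray} {r c a s k : ℕ} {b : Bool}

/-! ### Bumps are determined by the array -/

/-- The arm `a` cannot occur in two cells of one column: the hook of the upper cell would lie
between the two copies, with one of the two inequalities strict. -/
theorem ArmSel.unique {r' c' a' : ℕ} (hv : F.Valid β γ) (h : F.ArmSel r c a)
    (h' : F.ArmSel r' c' a') : r = r' ∧ c = c' ∧ a = a' := by
  have hc : c = c' := by
    rcases lt_trichotomy c c' with hc | hc | hc
    · have := h'.mem; simp [h.right _ _ hc] at this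
    · exact hc
    · have := h.mem; simp [h'.right _ _ hc] at this
  subst hc
  have ha : a = a' := le_antisymm (h'.max _ _ h.mem) (h.max _ _ h'.mem)
  subst ha
  refine ⟨?_, rfl, rfl⟩
  have hw := hv.weight
  have h1 := hv.arms_gt h.mem
  have h2 := hv.arms_gt h'.mem
  rcases lt_trichotomy r r' with hc | hc | hc
  · have := hv.col_lt (hv.sh_of_arms h'.mem) hc (ent_of_arms h.mem) (F.ent_hook _ _)
    omega
  · exact hc
  · have := hv.col_lt (hv.sh_of_arms h.mem) hc (ent_of_arms h'.mem) (F.ent_hook _ _)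
    omega

theorem ArmTgt.ent (h : F.ArmTgt β c a s k b) (hb : b = true) : F.Ent s (c + 1) k :=
  (h.old_mem hb).imp id Or.inl

theorem ArmTgt.unique {s' k' : ℕ} {b' : Bool} (h : F.ArmTgt β c a s k b)
    (h' : F.ArmTgt β c a s' k' b') : s = s' ∧ k = k' ∧ b = b' := by
  have aux : ∀ {s k s' k' : ℕ} {b b' : Bool}, F.ArmTgt β c a s k b → F.ArmTgt β c a s' k' b' →
      ¬ s < s' := by
    intro s k s' k' b b' h h' hlt
    have hb : b = true := by
      by_contra hb
      exact h.new_sh (by simpa using hb) (h'.below_sh _ hlt)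
    have h1 := h'.below _ _ hlt (h.ent hb)
    have h2 := h.old_le hb
    omega
  have hs : s = s' := by
    have := aux h h'
    have := aux h' h
    omega
  subst hs
  cases b <;> cases b'
  · exact ⟨rfl, (h.new_eq rfl).trans (h'.new_eq rfl).symm, rfl⟩
  · exact absurd (h'.old_sh rfl) (h.new_sh rfl)
  · exact absurd (h.old_sh rfl) (h'.new_sh rfl)
  · exact ⟨rfl, le_antisymm (h.old_min rfl _ (h'.ent rfl) (h'.old_le rfl))
      (h'.old_min rfl _ (h.ent rfl) (h.old_le rfl)), rfl⟩

theorem ArmStep.unique {c' a' s' k' : ℕ} {b' : Bool} {F'' : HookArray} (hv : F.Valid β γ)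
    (h : ArmStep β γ F F' c a s k b) (h' : ArmStep β γ F F'' c' a' s' k' b') :
    F' = F'' ∧ c = c' ∧ a = a' ∧ s = s' ∧ k = k' ∧ b = b' := by
  obtain ⟨r, h1, h2, rfl⟩ := h
  obtain ⟨r', h1', h2', rfl⟩ := h'
  obtain ⟨rfl, rfl, rfl⟩ := h1.unique hv h1'
  obtain ⟨rfl, rfl, rfl⟩ := h2.unique h2'
  exact ⟨rfl, rfl, rfl, rfl, rfl, rfl⟩

/-! ### How a bump of an arm interferes with the next bump of a leg -/

theorem ent_transpose {i j x : ℕ} : F.transpose.Ent i j x ↔ F.Ent j i x := by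
  unfold Ent transpose; tauto

/-- An arm bump never carries legs into another row: `a` becomes a leg only in place of a leg, and
legs move along only within their row. -/
theorem legs_row_zero (ht : F.ArmTgt β c a s k b) {i : ℕ}
    (h : ∀ j, F.legs i j = 0) (j : ℕ) : (F.armRes γ r c a s k b).legs i j = 0 := by
  rw [Multiset.eq_zero_iff_forall_notMem]
  intro x hx
  rcases mem_legs_res hx with hx' | ⟨rfl, rfl, hx'⟩ <;> clear hx
  · simp [h] at hx'
  · rcases hx' with ⟨rfl, hx⟩ | ⟨rfl, hx, _⟩
    · cases b
      · exact hx (ht.new_eq rfl)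
      · have := ht.old_mem rfl
        simp [h, hx] at this
    · simp [h] at hx

/-- If `a` becomes a leg, it replaces a leg of the same row that is at least as large. -/
theorem legs_row_le (hw : β + γ = 1) (ht : F.ArmTgt β c a s k b) {i l : ℕ}
    (h : ∀ j, ∀ x ∈ F.legs i j, x ≤ l) (j x : ℕ)
    (hx : x ∈ (F.armRes γ r c a s k b).legs i j) : x ≤ l := by
  rcases mem_legs_res hx with hx' | ⟨rfl, rfl, hx'⟩ <;> clear hx
  · exact h _ _ hx'.1
  · rcases hx' with ⟨rfl, hx⟩ | ⟨rfl, hx, _⟩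
    · cases b
      · exact absurd (ht.new_eq rfl) hx
      · have h1 := ht.old_le rfl
        have := h _ _ ((ht.old_mem rfl).resolve_left hx)
        omega
    · exact h _ _ hx

/-- The next leg to be bumped is the same one after an arm was bumped, if it is still there. -/
theorem sel_leg_res (hw : β + γ = 1) (ht : F.ArmTgt β c a s k b) {i j j' l : ℕ}
    (hs : F.transpose.ArmSel j i l) (h : l ∈ (F.armRes γ r c a s k b).legs i j') :
    (F.armRes γ r c a s k b).transpose.ArmSel j' i l where
  mem := h
  right := fun p q hq => legs_row_zero ht (fun y => hs.right y q hq) p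
  max := fun p x hx => legs_row_le hw ht (fun y z hz => hs.max y z hz) p x hx

/-- The next leg to be bumped has the same target after an arm was bumped. -/
theorem tgt_leg_res (hv : F.Valid β γ) (hs : F.ArmSel r c a) (ht : F.ArmTgt β c a s k b)
    {i j l t m : ℕ} {d : Bool} (hs' : F.transpose.ArmSel j i l)
    (ht' : F.transpose.ArmTgt γ i l t m d) (h₁ : s = i + 1 → t ≠ c + 1)
    (h₂ : d = true → t = c → r = i + 1 → m = a →
      m = F.hook (i + 1) t ∨ 2 ≤ (F.arms (i + 1) t).count a) :
    (F.armRes γ r c a s k b).transpose.ArmTgt γ i l t m d := by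
  have hw := hv.weight
  -- Row `i` is the topmost row with legs, so the entries above it are hooks and arms.
  have hz : ∀ p, F.legs (i + 1) p = 0 := fun p => hs'.right p (i + 1) (by omega)
  have hhook : (F.armRes γ r c a s k b).hook (i + 1) t = F.hook (i + 1) t := by
    simp only [armRes]
    rw [if_neg]
    rintro ⟨h, h', -⟩
    exact h₁ h.symm h'
  have hent : ∀ p x, (F.armRes γ r c a s k b).Ent (i + 1) p x →
      F.Ent (i + 1) p x ∨ i + 1 = s ∧ p = c + 1 ∧ x = a := by
    intro p x h
    rcases (ent_res hv hs ht h).1 with h' | ⟨rfl, rfl, h'⟩ <;> clear h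
    · exact Or.inl h'
    · rcases h' with rfl | ⟨rfl, h, -⟩
      · exact Or.inr ⟨rfl, rfl, rfl⟩
      · simp [hz] at h
  refine ⟨?_, ?_, ?_, ?_, ?_, ?_, ?_, ?_⟩
  · exact fun p hp => Or.inl (ht'.below_sh p hp)
  · intro p x hp hx
    rw [ent_transpose] at hx
    rcases hent p x hx with hx | ⟨rfl, rfl, rfl⟩
    · exact ht'.below p x hp (ent_transpose.2 hx)
    -- The entry `a` has come to stand to the left of the target of `l`. It took the place of `k`,
    -- which `l` could not bump, and `a` is no larger than `k`.
    · have hb : b = true := by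
        by_contra hb
        exact ht.new_sh (by simpa using hb) (ht'.below_sh _ hp)
      have h3 := ht'.below _ k hp (ent_transpose.2 (ht.ent hb))
      have h4 := ht.old_le hb
      omega
  · exact fun hd => Or.inl (ht'.old_sh hd)
  · intro hd
    change m = (F.armRes γ r c a s k b).hook (i + 1) t ∨ m ∈ (F.armRes γ r c a s k b).arms (i + 1) t
    rw [hhook]
    rcases ht'.old_mem hd with h | h
    · exact Or.inl h
    · change m ∈ F.arms (i + 1) t at h
      simp only [armRes]
      split_ifs with h3 h4
      · by_cases hma : m = a
        · refine (h₂ hd h3.2 h3.1.symm hma).imp id fun h5 => ?_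
          rw [hma, ← Multiset.count_pos, Multiset.count_erase_self]
          omega
        · exact Or.inr ((Multiset.mem_erase_of_ne hma).2 h)
      · exact absurd h4.2 (h₁ h4.1.symm)
      · exact absurd h4.2 (h₁ h4.1.symm)
      · exact Or.inr h
  · exact ht'.old_le
  · intro hd x hx hlx
    rw [ent_transpose] at hx
    rcases hent t x hx with hx | ⟨h3, h4, rfl⟩
    · exact ht'.old_min hd x (ent_transpose.2 hx) hlx
    · exact absurd h4 (h₁ h3.symm)
  · rintro hd (h | h)
    · exact ht'.new_sh hd h
    · exact h₁ h.1.symm h.2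
  · intro hd
    change m = (F.armRes γ r c a s k b).hook (i + 1) t
    rw [hhook]
    exact ht'.new_eq hd

theorem count_erase_ite (x y : ℕ) (M : Multiset ℕ) :
    (M.erase y).count x = if x = y then M.count x - 1 else M.count x := by
  split_ifs with h
  · subst h; exact Multiset.count_erase_self _ _
  · exact Multiset.count_erase_of_ne h _

end HookArray
end Uncrowding

/-! ### The generic commuting square -/

namespace Uncrowding
namespace HookArray

variable {β γ : ℕ} {F F' X Y Z W : HookArray} {r c a s k : ℕ} {b : Bool}

/-- The hypotheses exclude each way in which the changes to the legs could collide: a common target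
(`h₁`), `l` bumping the only copy of the arm `a` (`h₂`), `a` bumping the only copy of the leg `l`
(`h₂'`), and `l` moving along with `a` (`h₃'`). -/
theorem legs_comm (hv : F.Valid β γ) (hs : F.ArmSel r c a) (ht : F.ArmTgt β c a s k b)
    {i j l t m : ℕ} {d : Bool} (hs' : F.transpose.ArmSel j i l)
    (ht' : F.transpose.ArmTgt γ i l t m d) (h₁ : s = i + 1 → t ≠ c + 1)
    (h₂ : d = true → t = c → r = i + 1 → m = a →
      m = F.hook (i + 1) t ∨ 2 ≤ (F.arms (i + 1) t).count a)
    (h₂' : b = true → s = i → j = c + 1 → k = l →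
      k = F.hook s (c + 1) ∨ 2 ≤ (F.legs s (c + 1)).count l)
    (h₃' : r = i → c = j → s = r → l + γ ≤ a) (p q : ℕ) :
    ((F.transpose.armRes β j i l t m d).transpose.armRes γ r c a s k b).legs p q =
      ((F.armRes γ r c a s k b).transpose.armRes β j i l t m d).transpose.legs p q := by
  have hw := hv.weight
  have hz : ∀ p, F.legs (i + 1) p = 0 := fun p => hs'.right p (i + 1) (by omega)
  -- The leg bump may turn `m` into a leg of the very cell that holds `a`. Such a new leg must not
  -- move along with `a`; it does not, because `m` is the hook or an arm of this cell and the arms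
  -- are at most `a`.
  have hm : r = i + 1 → t = c → d = true → ¬ a < m + γ := by
    rintro rfl rfl hd h
    rcases ht'.old_mem hd with h3 | h3
    · have := hv.arms_gt hs.mem
      have h3 : m = F.hook (i + 1) t := h3
      omega
    · have h4 := hs.max _ _ h3
      have h5 := hv.arms_gt hs.mem
      have h6 : m = a := by omega
      rcases h₂ hd rfl rfl h6 with h7 | h7
      · omega
      · have := Multiset.nodup_iff_count_le_one.1 (hv.arms_nodup (by omega) (i + 1) t) a
        omega
  have hl : l ∈ F.legs i j := hs'.mem
  have hlc : 0 < (F.legs i j).count l := Multiset.count_pos.2 hl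
  have hY : ∀ p q, (F.transpose.armRes β j i l t m d).transpose.legs p q =
      if q = j ∧ p = i then (F.legs p q).erase l
      else if q = t ∧ p = i + 1 then (if d = true then {m} else 0) + F.legs p q
      else F.legs p q := fun p q => rfl
  have hYh : (F.transpose.armRes β j i l t m d).transpose.hook s (c + 1) = F.hook s (c + 1) := by
    refine if_neg ?_
    rintro ⟨h, h', -⟩
    exact h₁ h' h.symm
  have hmv : ((F.transpose.armRes β j i l t m d).transpose.legs r c).filter
      (fun x => s = r ∧ a < x + γ) = (F.legs r c).filter (fun x => s = r ∧ a < x + γ) := by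
    by_cases hsr : s = r
    · rw [hY]
      split_ifs with h3 h4 h5
      · ext x
        have := h₃' h3.2 h3.1 hsr
        simp only [Multiset.count_filter, count_erase_ite]
        split_ifs <;> omega
      · have := hm h4.2 h4.1.symm h5
        simp [h4.2, hz, Multiset.filter_singleton]
        omega
      · simp
      · rfl
    · simp [hsr]
  have hX : ∀ p q, ((F.armRes γ r c a s k b).transpose.armRes β j i l t m d).transpose.legs p q =
      if q = j ∧ p = i then ((F.armRes γ r c a s k b).legs p q).erase l
      else if q = t ∧ p = i + 1 then
        (if d = true then {m} else 0) + (F.armRes γ r c a s k b).legs p q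
      else (F.armRes γ r c a s k b).legs p q := fun p q => rfl
  rw [hX]
  generalize hG : (F.transpose.armRes β j i l t m d).transpose = G at *
  simp only [armRes]
  by_cases hP1 : p = r ∧ q = c
  · simp only [hP1, and_self, if_true]
    rw [hY]
    split_ifs with h3 h4 h5
    · ext x
      have := h₃' h3.2 h3.1
      simp only [Multiset.count_filter, count_erase_ite]
      split_ifs <;> omega
    · have := hm h4.2 h4.1.symm h5
      simp [h4.2, hz, Multiset.filter_singleton]
      omega
    · simp
    · rfl
  · by_cases hP2 : p = s ∧ q = c + 1
    · simp only [hP2, and_self, if_true]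
      rw [hmv, hYh, hY]
      have hne : ¬ (s = r ∧ c + 1 = c) := by omega
      simp only [hne, if_false]
      by_cases h3 : c + 1 = j ∧ s = i
      · obtain ⟨rfl, rfl⟩ := h3
        simp only [and_self, if_true]
        by_cases hk : k = F.hook s (c + 1)
        · simp only [hk, if_true]
          rw [Multiset.erase_add_left_pos _ hl]
        · simp only [hk, if_false]
          cases b
          · exact absurd (ht.new_eq rfl) hk
          have hk' := (ht.old_mem rfl).resolve_left hk
          have hkl : k = l → 2 ≤ (F.legs s (c + 1)).count l :=
            fun h => (h₂' rfl rfl rfl h).resolve_left hk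
          have hkc := Multiset.count_pos.2 hk'
          ext x
          simp only [Multiset.count_add, Multiset.count_cons, count_erase_ite]
          rcases eq_or_ne x l with rfl | hxl
          · by_cases hkx : x = k
            · have := hkl hkx.symm
              simp only [hkx, if_true] at this ⊢
              split_ifs <;> omega
            · simp only [hkx, if_true, if_false]
              omega
          · simp only [hxl, if_false]
      · have h4 : ¬ (c + 1 = t ∧ s = i + 1) := fun h => h₁ h.2 h.1.symm
        simp only [h3, h4, if_false]
    · simp only [hP1, hP2, if_false]
      rw [hY]

/-- This is `legs_comm` for the transposed array, read from right to left; `h₃` is the transposed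
form of `h₃'`. -/
theorem arms_comm (hv : F.Valid β γ) (hs : F.ArmSel r c a) (ht : F.ArmTgt β c a s k b)
    {i j l t m : ℕ} {d : Bool} (hs' : F.transpose.ArmSel j i l)
    (ht' : F.transpose.ArmTgt γ i l t m d) (h₁ : s = i + 1 → t ≠ c + 1)
    (h₂ : d = true → t = c → r = i + 1 → m = a →
      m = F.hook (i + 1) t ∨ 2 ≤ (F.arms (i + 1) t).count a)
    (h₂' : b = true → s = i → j = c + 1 → k = l →
      k = F.hook s (c + 1) ∨ 2 ≤ (F.legs s (c + 1)).count l)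
    (h₃ : r = i → c = j → t = j → a + β ≤ l) (p q : ℕ) :
    ((F.transpose.armRes β j i l t m d).transpose.armRes γ r c a s k b).arms p q =
      ((F.armRes γ r c a s k b).transpose.armRes β j i l t m d).transpose.arms p q := by
  have := legs_comm hv.transpose hs' ht' hs ht (fun h h' => h₁ h' h)
    (fun h h' h'' h3 => h₂' h h' h'' h3) (fun h h' h'' h3 => h₂ h h' h'' h3)
    (fun h h' h'' => h₃ h'.symm h.symm h'') q p
  exact this.symm

/-- The generic case: the two bumps do not influence each other. -/
theorem res_comm (hv : F.Valid β γ) (hs : F.ArmSel r c a) (ht : F.ArmTgt β c a s k b)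
    {i j l t m : ℕ} {d : Bool} (hs' : F.transpose.ArmSel j i l)
    (ht' : F.transpose.ArmTgt γ i l t m d) (h₁ : s = i + 1 → t ≠ c + 1)
    (h₂ : d = true → t = c → r = i + 1 → m = a →
      m = F.hook (i + 1) t ∨ 2 ≤ (F.arms (i + 1) t).count a)
    (h₂' : b = true → s = i → j = c + 1 → k = l →
      k = F.hook s (c + 1) ∨ 2 ≤ (F.legs s (c + 1)).count l)
    (h₃ : r = i → c = j → t = j → a + β ≤ l) (h₃' : r = i → c = j → s = r → l + γ ≤ a) :
    (F.transpose.armRes β j i l t m d).transpose.armRes γ r c a s k b =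
      ((F.armRes γ r c a s k b).transpose.armRes β j i l t m d).transpose := by
  refine HookArray.ext ?_ ?_ ?_ ?_
  · funext p q
    simp only [armRes, transpose, or_assoc, and_comm (a := q = t), or_comm (b := p = i + 1 ∧ q = t)]
  · funext p q
    simp only [armRes, transpose]
    by_cases h : p = s ∧ q = c + 1
    · obtain ⟨rfl, rfl⟩ := h
      have : ¬ (c + 1 = t ∧ p = i + 1) := fun h => h₁ h.2 h.1.symm
      simp only [true_and, ← and_assoc, this, false_and, if_false]
    · simp only [← and_assoc, h, false_and, if_false]
  · funext p q
    exact legs_comm hv hs ht hs' ht' h₁ h₂ h₂' h₃' p q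
  · funext p q
    exact arms_comm hv hs ht hs' ht' h₁ h₂ h₂' h₃ p q

end HookArray
end Uncrowding

/-! ### Closing the square: independent bumps, and an arm that moves with a leg -/

namespace Uncrowding
namespace HookArray

variable {β γ : ℕ} {F F' X Y Z W : HookArray} {r c a s k : ℕ} {b : Bool}

/-- `ArmStep` without the entries. -/
def AStep (β γ : ℕ) (F F' : HookArray) (c s : ℕ) (b : Bool) : Prop :=
  ∃ a k, ArmStep β γ F F' c a s k b

/-- A bump of an arm leading to `X` and a bump of a leg leading to `Y` can be completed to a
commutative square. -/
def Commutes (β γ : ℕ) (X Y : HookArray) (c s : ℕ) (b : Bool) (i t : ℕ) (d : Bool) : Prop :=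
  ∃ Z s' t', AStep β γ Y Z c s' b ∧ AStep γ β X.transpose Z.transpose i t' d ∧
    (b = false → s' = s) ∧ (d = false → t' = t)

theorem Commutes.transpose {i t : ℕ} {d : Bool}
    (h : Commutes γ β Y.transpose X.transpose i t d c s b) : Commutes β γ X Y c s b i t d := by
  obtain ⟨Z, s', t', h1, h2, h3, h4⟩ := h
  exact ⟨Z.transpose, t', s', h2, h1, h4, h3⟩

theorem mem_legs_res_of_mem {i j l : ℕ} (hl : l ∈ F.legs i j)
    (h₂' : s = i → j = c + 1 → k = l →
      k = F.hook s (c + 1) ∨ 2 ≤ (F.legs s (c + 1)).count l)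
    (h₃' : r = i → c = j → s = r → l + γ ≤ a) : l ∈ (F.armRes γ r c a s k b).legs i j := by
  simp only [armRes]
  split_ifs with h1 h2 h3
  · refine Multiset.mem_filter.2 ⟨hl, fun h => ?_⟩
    have := h₃' h1.1.symm h1.2.symm h.1
    omega
  · exact Multiset.mem_add.2 (Or.inl hl)
  · obtain ⟨rfl, rfl⟩ := h2
    refine Multiset.mem_add.2 (Or.inl (Multiset.mem_cons_of_mem ?_))
    by_cases hkl : l = k
    · have := (h₂' rfl rfl hkl.symm).resolve_left h3
      rw [← hkl, ← Multiset.count_pos, Multiset.count_erase_self]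
      omega
    · exact (Multiset.mem_erase_of_ne hkl).2 hl
  · exact hl

/-- Performed second, each bump still has its selected entry, its target and its bumped entry, so
`res_comm` closes the square. -/
theorem commutes_of_disjoint (hv : F.Valid β γ) (hs : F.ArmSel r c a) (ht : F.ArmTgt β c a s k b)
    {i j l t m : ℕ} {d : Bool} (hs' : F.transpose.ArmSel j i l)
    (ht' : F.transpose.ArmTgt γ i l t m d) (h₁ : s = i + 1 → t ≠ c + 1)
    (h₂ : d = true → t = c → r = i + 1 → m = a →
      m = F.hook (i + 1) t ∨ 2 ≤ (F.arms (i + 1) t).count a)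
    (h₂' : b = true → s = i → j = c + 1 → k = l →
      k = F.hook s (c + 1) ∨ 2 ≤ (F.legs s (c + 1)).count l)
    (h₃ : r = i → c = j → t = j → a + β ≤ l) (h₃' : r = i → c = j → s = r → l + γ ≤ a) :
    Commutes β γ (F.armRes γ r c a s k b) (F.transpose.armRes β j i l t m d).transpose
      c s b i t d := by
  have hw := hv.weight
  -- For a new cell the exclusion is automatic, since `k` is then the hook by convention.
  have h₂f : s = i → j = c + 1 → k = l →
      k = F.hook s (c + 1) ∨ 2 ≤ (F.legs s (c + 1)).count l := by
    cases b
    · exact fun _ _ _ => Or.inl (ht.new_eq rfl)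
    · exact h₂' rfl
  have h₂g : t = c → r = i + 1 → m = a →
      m = F.hook (i + 1) t ∨ 2 ≤ (F.arms (i + 1) t).count a := by
    cases d
    · exact fun _ _ _ => Or.inl (ht'.new_eq rfl)
    · exact h₂ rfl
  refine ⟨_, s, t, ⟨a, k, r, ?_, ?_, rfl⟩, ⟨l, m, j, ?_, ?_, ?_⟩, fun _ => rfl, fun _ => rfl⟩
  · exact sel_leg_res (F := F.transpose) (by omega) ht' hs
      (mem_legs_res_of_mem (F := F.transpose) (i := c) (j := r) hs.mem
        (fun h h' h'' => h₂g h h' h'') (fun h h' h'' => h₃ h'.symm h.symm h''))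
  · exact tgt_leg_res hv.transpose hs' ht' hs ht (fun h h' => h₁ h' h) h₂'
  · exact sel_leg_res hw ht hs' (mem_legs_res_of_mem hs'.mem h₂f h₃')
  · exact tgt_leg_res hv hs ht hs' ht' h₁ h₂
  · rw [res_comm hv hs ht hs' ht' h₁ h₂ h₂' h₃ h₃']
    rfl

/-- The arm moves up with the leg in its cell. -/
theorem commutes_of_moved (hv : F.Valid β γ) {i l m : ℕ} {d : Bool} (hs : F.ArmSel i c a)
    (ht : F.ArmTgt β c a s k b) (hs' : F.transpose.ArmSel c i l)
    (ht' : F.transpose.ArmTgt γ i l c m d) (hla : l < a + β) :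
    Commutes β γ (F.armRes γ i c a s k b) (F.transpose.armRes β c i l c m d).transpose
      c s b i c d := by
  have hw := hv.weight
  have hsi := hv.tgt_le hs ht
  have hm : m = F.hook (i + 1) c := hv.transpose.tgt_hook hs' ht'
  have ha : a ∈ (F.arms i c).filter fun x => l < x + β := Multiset.mem_filter.2 ⟨hs.mem, hla⟩
  -- After the leg bump `a` sits in row `i + 1`, while its target stays in row `s ≤ i`.
  refine ⟨_, s, c, ⟨a, k, i + 1, ?_, ?_, rfl⟩, ⟨l, m, c, ?_, ?_, ?_⟩, fun _ => rfl, fun _ => rfl⟩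
  · refine sel_leg_res (F := F.transpose) (by omega) ht' hs ?_
    simp only [armRes, transpose]
    simp [hm, hs.mem, hla]
  · exact tgt_leg_res hv.transpose hs' ht' hs ht (by omega) (by omega)
  · exact sel_leg_res hw ht hs' (mem_legs_res_of_mem hs'.mem (by omega) (by omega))
  · exact tgt_leg_res hv hs ht hs' ht' (by omega) (by omega)
  -- All legs of the cell are at most `l`, hence too small to move along with `a`.
  · have hl : ∀ x ∈ F.legs i c, ¬ a < x + γ := by
      intro x hx h
      have := hs'.max c x hx
      omega
    refine HookArray.ext ?_ ?_ ?_ ?_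
    · funext q p
      simp only [armRes, transpose, or_assoc, and_comm (a := q = c),
        or_comm (b := p = i + 1 ∧ q = c)]
    · funext q p
      simp only [armRes, transpose]
      grind
    · funext q p
      change ((F.transpose.armRes β c i l c m d).transpose.armRes γ (i + 1) c a s k b).arms p q = _
      have hf : (F.arms i c).filter (fun x => ¬ l < x + β) =
          ((F.arms i c).erase a).filter (fun x => ¬ l < x + β) := by
        ext x
        simp only [Multiset.count_filter, count_erase_ite]
        split_ifs <;> omega
      have hf' : ((F.arms i c).filter (fun x => l < x + β)).erase a =
          ((F.arms i c).erase a).filter (fun x => l < x + β) := by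
        ext x
        simp only [Multiset.count_filter, count_erase_ite]
        split_ifs <;> omega
      simp only [armRes, transpose]
      by_cases h1 : p = i ∧ q = c
      · obtain ⟨rfl, rfl⟩ := h1
        simpa using hf
      by_cases h2 : p = i + 1 ∧ q = c
      · obtain ⟨rfl, rfl⟩ := h2
        simpa [hm, show i + 1 ≠ s by omega, ← hf'] using Multiset.erase_add_right_pos _ ha
      simp [h1, h2, and_comm (a := q = c)]
    · funext q p
      change ((F.transpose.armRes β c i l c m d).transpose.armRes γ (i + 1) c a s k b).legs p q = _
      have hf : (F.legs i c).filter (fun x => ¬ (s = i ∧ a < x + γ)) = F.legs i c :=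
        Multiset.filter_eq_self.2 fun x hx h => hl x hx h.2
      have hf' : (F.legs i c).filter (fun x => s = i ∧ a < x + γ) = 0 :=
        Multiset.filter_eq_nil.2 fun x hx h => hl x hx h.2
      have hsi' : s ≠ i + 1 := by omega
      simp only [armRes, transpose, hf', hsi', false_and, not_false_eq_true, Multiset.filter_true,
        Multiset.filter_false, add_zero]
      by_cases h1 : p = i ∧ q = c
      · obtain ⟨rfl, rfl⟩ := h1
        simp only [and_self, if_true, hf]
        simp
      by_cases h2 : p = i + 1 ∧ q = c
      · obtain ⟨rfl, rfl⟩ := h2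
        simp
      by_cases h3 : p = s ∧ q = c + 1
      · obtain ⟨rfl, rfl⟩ := h3
        simp
      · simp [h1, h2, h3, and_comm (a := q = c)]

end HookArray
end Uncrowding

/-! ### Squares with interaction: a bumped leg and common targets -/

namespace Uncrowding
namespace HookArray

variable {β γ : ℕ} {F F' X Y Z W : HookArray} {r c a s k : ℕ} {b : Bool}

/-- The leg to be bumped is the entry that is bumped by the arm. -/
theorem commutes_of_bumped (hv : F.Valid β γ) {i l t m : ℕ} {d : Bool} (hs : F.ArmSel r c a)
    (ht : F.ArmTgt β c a i l true) (hs' : F.transpose.ArmSel (c + 1) i l)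
    (ht' : F.transpose.ArmTgt γ i l t m d) (hlh : l ≠ F.hook i (c + 1))
    (hc : (F.legs i (c + 1)).count l < 2) :
    Commutes β γ (F.armRes γ r c a i l true)
      (F.transpose.armRes β (c + 1) i l t m d).transpose c i true i t d := by
  -- Arm first: `a` takes the place of the leg `l`, which becomes an arm; then the leg `a` moves up
  -- and carries the arm `l` with it. Leg first: `l` becomes the hook of `(i + 1, c + 1)`, where `a`
  -- bumps it. Both orders leave the hook `a` and the arm `l` in `(i + 1, c + 1)`.
  have hw := hv.weight
  have hir : i < r := by
    refine lt_of_le_of_ne (hv.tgt_le hs ht) ?_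
    rintro rfl
    exact hlh (hv.tgt_hook hs ht)
  have hal : a < l + β := ht.old_le rfl
  have hr := hv.sh_of_arms hs.mem
  have hha := hv.arms_gt hs.mem
  have hrow : ∀ p x, p < c → F.Ent (i + 1) p x → x < a + β := by
    intro p x hp hx
    rcases Nat.lt_or_ge (i + 1) r with h | h
    · have := hv.diag_lt hr h hp hx (F.ent_hook _ _)
      omega
    · obtain rfl : r = i + 1 := by omega
      exact hv.row_lt hr hp hx (ent_of_arms hs.mem)
  have hz : ∀ p, F.legs (i + 1) p = 0 := fun p => hs'.right p (i + 1) (by omega)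
  have hrowc : ∀ x, F.Ent (i + 1) c x → x < a + β ∨ r = i + 1 ∧ x ∈ F.arms r c := by
    intro x hx
    rcases Nat.lt_or_ge (i + 1) r with h | h
    · have := hv.col_lt hr h hx (F.ent_hook _ _)
      omega
    · obtain rfl : r = i + 1 := by omega
      rcases hx with hx | hx | hx
      · omega
      · simp [hz] at hx
      · exact Or.inr ⟨rfl, hx⟩
  have hsc : F.sh (i + 1) c := hv.lower hr hir le_rfl
  -- In row `i + 1` the cells up to column `c` exist, and their entries are at most `a`, too small
  -- to be bumped by `l`.
  obtain rfl : t = c + 1 := by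
    refine le_antisymm (hv.transpose.tgt_le hs' ht') ?_
    by_contra hn
    have hd : d = true := by
      by_contra hd
      exact ht'.new_sh (by simpa using hd) (hv.lower hsc le_rfl (by omega))
    have hm : F.Ent (i + 1) t m := ent_transpose.1 (ht'.ent hd)
    have := ht'.old_le hd
    rcases Nat.lt_or_ge t c with h | h
    · have := hrow t m h hm
      omega
    · obtain rfl : t = c := by omega
      rcases hrowc m hm with h | h
      · omega
      · have := hs.max _ _ h.2
        omega
  have hza : ∀ p, F.arms p (c + 1) = 0 := fun p => hs.right p (c + 1) (by omega)
  have hhl : F.hook i (c + 1) + β ≤ a := by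
    by_contra hn
    have h1 := ht.old_min rfl _ (F.ent_hook _ _) (by omega)
    have h2 : F.hook i (c + 1) < l + γ := hv.legs_gt hs'.mem
    omega
  have hmh : m = F.hook (i + 1) (c + 1) := by
    cases d
    · exact ht'.new_eq rfl
    · rcases ht'.old_mem rfl with h | h
      · exact h
      · change m ∈ F.arms (i + 1) (c + 1) at h
        simp [hza] at h
  have hlm : d = true → l < m + γ := ht'.old_le
  have hirn : i ≠ r := by omega
  have hrs : r ≠ i := by omega
  have hll : l ∈ F.legs i (c + 1) := hs'.mem
  refine ⟨_, i + 1, c + 1, ⟨a, l, r, ?_, ?_, rfl⟩, ⟨a, m, c + 1, ?_, ?_, ?_⟩, by simp,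
    fun _ => rfl⟩
  · exact sel_leg_res (F := F.transpose) (by omega) ht' hs
      (mem_legs_res_of_mem (F := F.transpose) (i := c) (j := r) hs.mem
        (by omega) (by omega))
  · have hvY := (hv.transpose.armRes hs' ht').transpose
    have hYh : (F.transpose.armRes β (c + 1) i l (c + 1) m d).transpose.hook (i + 1) (c + 1) = l :=
      if_pos ⟨rfl, rfl, hmh⟩
    refine ⟨?_, ?_, fun _ => Or.inr ⟨rfl, rfl⟩, fun _ => Or.inl hYh.symm, fun _ => hal, ?_,
      by simp, by simp⟩
    · exact fun p hp => Or.inl (hv.lower (ht.old_sh rfl) (by omega) le_rfl)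
    · intro p x hp hx
      have hx' := hx
      rw [← ent_transpose] at hx
      rcases (ent_res hv.transpose hs' ht' hx).1 with h | h
      · rw [ent_transpose] at h
        rcases Nat.lt_or_ge p i with hpi | hpi
        · exact ht.below p x hpi h
        · obtain rfl : p = i := by omega
          rcases h with h | h | h
          · omega
          -- Minimality of `l` among the candidates leaves only `x = l`, but its single copy has
          -- moved up.
          · by_contra hn
            have h1 := ht.old_min rfl x (ent_of_legs h) (by omega)
            have h2 := hs'.max _ x h
            obtain rfl : x = l := by omega
            rcases hx' with h | h | h
            · simp [armRes, transpose] at h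
              exact hlh h
            · change x ∈ if _ then _ else _ at h
              simp only [and_self, if_true] at h
              have h := Multiset.count_pos.2 h
              rw [Multiset.count_erase_self] at h
              simp only [transpose] at h
              omega
            · rcases mem_legs_res (F := F.transpose) (b := d) h with h | h
              · simp [transpose, hza] at h
              · omega
          · simp [hza] at h
      · omega
    · intro _ x hx _
      have := hvY.hook_le hx
      rwa [hYh] at this
  · refine ⟨?_, fun p q hq => legs_row_zero ht (fun y => hs'.right y q hq) p, ?_⟩
    · simp [armRes, transpose, hlh]
    · intro p x hx
      rcases mem_legs_res (b := true) hx with ⟨hx', -⟩ | h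
      · rcases lt_trichotomy p (c + 1) with h | h | h
        · have := hv.row_lt (hv.sh_of_legs hll) h (ent_of_legs hx') (F.ent_hook _ _)
          omega
        · subst h
          change x ∈ if _ then _ else _ at hx
          simp only [hlh, if_false, hirn, false_and, and_self, if_true, Multiset.filter_false,
            add_zero, Multiset.mem_cons] at hx
          rcases hx with hx | hx
          · exact hx.le
          · by_contra hn
            have h1 := ht.old_min rfl x (ent_of_legs hx') (by omega)
            have h2 := hs'.max _ x hx'
            obtain rfl : x = l := by omega
            have h := Multiset.count_pos.2 hx
            rw [Multiset.count_erase_self] at h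
            omega
        · have h1 := hv.row_lt (hv.sh_of_legs hx') h (ent_of_legs hll) (F.ent_hook _ _)
          have h2 := hv.legs_gt hx'
          have h3 := hs'.max _ x hx'
          omega
      · rcases h.2.2 with h | h
        · exact h.1.le
        · exact absurd h.1 hirn
  · have hXh : (F.armRes γ r c a i l true).hook (i + 1) (c + 1) = F.hook (i + 1) (c + 1) :=
      if_neg (by omega)
    have hXe : ∀ p x, (F.armRes γ r c a i l true).Ent (i + 1) p x → F.Ent (i + 1) p x := by
      intro p x h
      rcases (ent_res hv hs ht h).1 with h | h
      · exact h
      · omega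
    refine ⟨?_, ?_, fun hd => Or.inl (ht'.old_sh hd), fun _ => Or.inl (hmh.trans hXh.symm),
      ?_, ?_, ?_, fun _ => hmh.trans hXh.symm⟩
    · exact fun p hp => Or.inl (hv.lower hsc le_rfl (by omega))
    · intro p x hp hx
      rw [ent_transpose] at hx
      suffices x < a + β by omega
      rcases Nat.lt_or_ge p c with h | h
      · exact hrow p x h (hXe p x hx)
      · obtain rfl : p = c := by omega
        rcases hrowc x (hXe p x hx) with h | ⟨rfl, h⟩
        · exact h
        · have h1 := hs.max _ _ h
          by_contra hn
          -- The only arm in question is `a` itself. It has left the cell, and for `β = 0` there is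
          -- no second copy.
          have hb : β = 0 := by omega
          obtain rfl : x = a := by omega
          rcases hx with h | h | h
          · have h : x = F.hook (i + 1) p := by simpa [armRes] using h
            omega
          · rcases mem_legs_res h with h | h
            · simp [hz] at h
            · omega
          · simp only [armRes, and_self, if_true] at h
            have := (Multiset.Nodup.mem_erase_iff (hv.arms_nodup hb _ _)).1 h
            omega
    · intro hd
      have := hlm hd
      omega
    · intro hd x hx _
      have := hv.hook_le (hXe _ _ (ent_transpose.1 hx))
      omega
    · rintro hd (h | h)
      · exact ht'.new_sh hd h
      · omega
  · refine HookArray.ext ?_ ?_ ?_ ?_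
    · funext q p
      simp only [armRes, transpose]
      apply propext
      constructor
      · rintro ((h | h) | h)
        · exact Or.inl (Or.inl h)
        · exact Or.inr h
        · exact Or.inr h.symm
      · rintro ((h | h) | h)
        · exact Or.inl (Or.inl h)
        · rw [h.1, h.2]; exact Or.inl (Or.inl (ht.old_sh rfl))
        · exact Or.inl (Or.inr h)
    · funext q p
      change ((F.transpose.armRes β (c + 1) i l (c + 1) m d).transpose.armRes
        γ r c a (i + 1) l true).hook p q = _
      simp only [armRes, transpose]
      by_cases h1 : p = i + 1 ∧ q = c + 1
      · obtain ⟨rfl, rfl⟩ := h1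
        simp [hmh]
      by_cases h2 : p = i ∧ q = c + 1
      · obtain ⟨rfl, rfl⟩ := h2
        simp [hlh]
      have h1' : ¬ (q = c + 1 ∧ p = i + 1) := fun h => h1 h.symm
      simp only [← and_assoc, h1, h1', h2, false_and, if_false]
    · funext q p
      change ((F.transpose.armRes β (c + 1) i l (c + 1) m d).transpose.armRes
        γ r c a (i + 1) l true).arms p q = _
      simp only [armRes, transpose]
      by_cases h1 : p = i + 1 ∧ q = c + 1
      · obtain ⟨rfl, rfl⟩ := h1
        simp [hmh, hza, hal, Multiset.filter_singleton]
      by_cases h2 : p = i ∧ q = c + 1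
      · obtain ⟨rfl, rfl⟩ := h2
        simp [hza, Multiset.filter_singleton, hal]
      simp [h1, h2, and_comm (a := q = c + 1)]
    · funext q p
      change ((F.transpose.armRes β (c + 1) i l (c + 1) m d).transpose.armRes
        γ r c a (i + 1) l true).legs p q = _
      simp only [armRes, transpose]
      by_cases h1 : p = i + 1 ∧ q = c + 1
      · obtain ⟨rfl, rfl⟩ := h1
        by_cases h3 : i + 1 = r
        · subst h3
          simp [hmh, hz]
        · simp [hmh, hz, h3]
      by_cases h2 : p = i ∧ q = c + 1
      · obtain ⟨rfl, rfl⟩ := h2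
        simp [hlh, hirn]
      by_cases h3 : p = r ∧ q = c
      · obtain ⟨rfl, rfl⟩ := h3
        by_cases h4 : i + 1 = p
        · subst h4
          simp [hz]
        · simp [h4, hirn]
      simp [h1, h2, h3, and_comm (a := q = c + 1)]

/-- Both bumps have the same target, which exists already. -/
theorem commutes_of_same_target (hv : F.Valid β γ) {i j l m : ℕ} (hs : F.ArmSel r c a)
    (ht : F.ArmTgt β c a (i + 1) k true) (hs' : F.transpose.ArmSel j i l)
    (ht' : F.transpose.ArmTgt γ i l (c + 1) m true) (hal : a < l + β) :
    Commutes β γ (F.armRes γ r c a (i + 1) k true)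
      (F.transpose.armRes β j i l (c + 1) m true).transpose c (i + 1) true i (c + 1) true := by
  -- In both orders the common target ends with hook `a`, arm `l` and its old hook as a leg: if `l`
  -- comes second it bumps the old hook, by then an arm, and if `a` comes second it bumps the new
  -- hook `l`.
  have hw := hv.weight
  have hir := hv.tgt_le hs ht
  have hcj := hv.transpose.tgt_le hs' ht'
  have hz : ∀ p, F.legs (i + 1) p = 0 := fun p => hs'.right p (i + 1) (by omega)
  have hza : ∀ p, F.arms p (c + 1) = 0 := fun p => hs.right p (c + 1) (by omega)
  have hlm : l < m + γ := ht'.old_le rfl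
  have hsh : F.sh (i + 1) (c + 1) := ht.old_sh rfl
  obtain rfl : k = F.hook (i + 1) (c + 1) := by
    rcases ht.old_mem rfl with h | h
    · exact h
    · simp [hz] at h
  obtain rfl : m = F.hook (i + 1) (c + 1) := by
    rcases ht'.old_mem rfl with h | h
    · exact h
    · change m ∈ F.arms (i + 1) (c + 1) at h
      simp [hza] at h
  have hcj' : j ≠ c := by omega
  have hir' : i ≠ r := by omega
  have hha : F.hook (i + 1) (c + 1) ≠ a := by omega
  have hmv : (F.arms i j).filter (fun x => c + 1 = j ∧ l < x + β) = 0 := by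
    by_cases h : c + 1 = j
    · subst h
      simp [hza]
    · simp [h]
  have hmv' : (F.legs r c).filter (fun x => i + 1 = r ∧ a < x + γ) = 0 := by
    by_cases h : i + 1 = r
    · subst h
      simp [hz]
    · simp [h]
  refine ⟨_, i + 1, c + 1, ⟨a, l, r, ?_, ?_, rfl⟩, ⟨l, F.hook (i + 1) (c + 1), j, ?_, ?_, ?_⟩,
    by simp, by simp⟩
  · exact sel_leg_res (F := F.transpose) (by omega) ht' hs
      (mem_legs_res_of_mem (F := F.transpose) (i := c) (j := r) hs.mem
        (by omega) (by omega))
  · have hvY := (hv.transpose.armRes hs' ht').transpose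
    have hYh : (F.transpose.armRes β j i l (c + 1) (F.hook (i + 1) (c + 1)) true).transpose.hook
        (i + 1) (c + 1) = l := if_pos ⟨rfl, rfl, rfl⟩
    refine ⟨fun p hp => Or.inl (ht.below_sh p hp), ?_, fun _ => Or.inr ⟨rfl, rfl⟩,
      fun _ => Or.inl hYh.symm, fun _ => hal, ?_, by simp, by simp⟩
    · intro p x hp hx
      rw [← ent_transpose] at hx
      rcases (ent_res hv.transpose hs' ht' hx).1 with h | h
      · exact ht.below p x hp (ent_transpose.1 h)
      · omega
    · intro _ x hx _
      have := hvY.hook_le hx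
      rwa [hYh] at this
  · exact sel_leg_res hw ht hs' (mem_legs_res_of_mem hs'.mem (by omega) (by omega))
  · refine ⟨fun p hp => Or.inl (ht'.below_sh p hp), ?_, fun _ => Or.inr ⟨rfl, rfl⟩,
      fun _ => Or.inr ?_, fun _ => hlm, ?_, by simp, by simp⟩
    · intro p x hp hx
      rw [ent_transpose] at hx
      rcases (ent_res hv hs ht hx).1 with h | h
      · exact ht'.below p x hp (ent_transpose.2 h)
      · omega
    · simp [armRes, transpose]
    · intro _ x hx hlx
      rw [ent_transpose] at hx
      rcases (ent_res hv hs ht hx).1 with h | ⟨_, _, h | ⟨rfl, h, -⟩⟩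
      · exact hv.hook_le h
      · omega
      · simp [hz] at h
  · refine HookArray.ext ?_ ?_ ?_ ?_
    · funext q p
      simp only [armRes, transpose, and_comm (a := p = i + 1), or_assoc, or_self]
    · funext q p
      change ((F.transpose.armRes β j i l (c + 1) (F.hook (i + 1) (c + 1)) true).transpose.armRes
        γ r c a (i + 1) l true).hook p q = _
      simp only [armRes, transpose]
      by_cases h1 : p = i + 1 ∧ q = c + 1
      · obtain ⟨rfl, rfl⟩ := h1
        simp [hha]
      have h1' : ¬ (q = c + 1 ∧ p = i + 1) := fun h => h1 h.symm
      simp only [← and_assoc, h1, h1', false_and, if_false]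
    · funext q p
      change ((F.transpose.armRes β j i l (c + 1) (F.hook (i + 1) (c + 1)) true).transpose.armRes
        γ r c a (i + 1) l true).arms p q = _
      simp only [armRes, transpose]
      by_cases h1 : p = i + 1 ∧ q = c + 1
      · obtain ⟨rfl, rfl⟩ := h1
        simp [hza, hha, hmv, hcj', hir']
      have h1' : ¬ (q = c + 1 ∧ p = i + 1) := fun h => h1 h.symm
      by_cases h2 : p = i ∧ q = j
      · obtain ⟨rfl, rfl⟩ := h2
        simp [hcj', hir']
      have h2' : ¬ (q = j ∧ p = i) := fun h => h2 h.symm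
      simp only [h1, h1', h2', if_false]
    · funext q p
      change ((F.transpose.armRes β j i l (c + 1) (F.hook (i + 1) (c + 1)) true).transpose.armRes
        γ r c a (i + 1) l true).legs p q = _
      simp only [armRes, transpose]
      by_cases h1 : p = i + 1 ∧ q = c + 1
      · obtain ⟨rfl, rfl⟩ := h1
        simp [hz, hmv', hcj'.symm, hir'.symm]
      have h1' : ¬ (q = c + 1 ∧ p = i + 1) := fun h => h1 h.symm
      by_cases h2 : p = r ∧ q = c
      · obtain ⟨rfl, rfl⟩ := h2
        simp [hcj'.symm]
      simp only [h1, h1', h2, if_false]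

/-- Both bumps create the same cell. -/
theorem square_of_same_new (hv : F.Valid β γ) {i j l m : ℕ} (hs : F.ArmSel r c a)
    (ht : F.ArmTgt β c a (i + 1) k false) (hs' : F.transpose.ArmSel j i l)
    (ht' : F.transpose.ArmTgt γ i l (c + 1) m false) (hal : a < l + β) :
    ∃ W Z, AStep β γ (F.transpose.armRes β j i l (c + 1) m false).transpose W c (i + 1) true ∧
      AStep β γ W Z (c + 1) (i + 1) false ∧
      AStep γ β (F.armRes γ r c a (i + 1) k false).transpose Z.transpose i (c + 2) false := by
  -- Arm first: `a` fills the new cell and `l` is appended to its right. Leg first: `l` fills the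
  -- new cell, is bumped by `a`, and travels as an arm into column `c + 2`.
  have hw := hv.weight
  have hir := hv.tgt_le hs ht
  have hcj := hv.transpose.tgt_le hs' ht'
  have hz : ∀ p, F.legs (i + 1) p = 0 := fun p => hs'.right p (i + 1) (by omega)
  have hza : ∀ p q, c < q → F.arms p q = 0 := hs.right
  have hsh : ¬ F.sh (i + 1) (c + 1) := ht.new_sh rfl
  have hsh2 : ¬ F.sh (i + 1) (c + 2) := fun h => hsh (hv.lower h le_rfl (by omega))
  have hh := hv.hook_off hsh
  have hh2 := hv.hook_off hsh2
  have hll : l ∈ F.legs i j := hs'.mem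
  obtain rfl : k = 0 := (ht.new_eq rfl).trans hh
  obtain rfl : m = 0 := (ht'.new_eq rfl).trans hh
  -- In column `c + 1` the leg `l` would lie below the target of `a`, so that `l + β ≤ a`.
  have hj : c + 2 ≤ j := by
    by_contra hn
    obtain rfl : j = c + 1 := by omega
    have := ht.below i l (by omega) (ent_of_legs hll)
    omega
  have hcj' : j ≠ c := by omega
  have hcj'' : j ≠ c + 1 := by omega
  have hir' : i ≠ r := by omega
  have hmv : ∀ q, (F.arms i j).filter (fun x => q = j ∧ l < x + β) = 0 := by
    simp [hza i j (by omega)]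
  have hmv' : (F.legs r c).filter (fun x => i + 1 = r ∧ a < x + γ) = 0 := by
    by_cases h : i + 1 = r
    · subst h
      simp [hz]
    · simp [h]
  have hvY := (hv.transpose.armRes hs' ht').transpose
  have hYh : (F.transpose.armRes β j i l (c + 1) 0 false).transpose.hook (i + 1) (c + 1) = l :=
    if_pos ⟨rfl, rfl, hh.symm⟩
  have hsY : (F.transpose.armRes β j i l (c + 1) 0 false).transpose.ArmSel r c a :=
    sel_leg_res (F := F.transpose) (by omega) ht' hs
      (mem_legs_res_of_mem (F := F.transpose) (i := c) (j := r) hs.mem (by omega) (by omega))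
  have htY : (F.transpose.armRes β j i l (c + 1) 0 false).transpose.ArmTgt
      β c a (i + 1) l true := by
    refine ⟨fun p hp => Or.inl (ht.below_sh p hp), ?_, fun _ => Or.inr ⟨rfl, rfl⟩,
      fun _ => Or.inl hYh.symm, fun _ => hal, ?_, by simp, by simp⟩
    · intro p x hp hx
      rw [← ent_transpose] at hx
      rcases (ent_res hv.transpose hs' ht' hx).1 with h | h
      · exact ht.below p x hp (ent_transpose.1 h)
      · omega
    · intro _ x hx _
      have := hvY.hook_le hx
      rwa [hYh] at this
  refine ⟨_, _, ⟨a, l, r, hsY, htY, rfl⟩, ⟨l, 0, i + 1, ?_, ?_, rfl⟩, ⟨l, 0, j, ?_, ?_, ?_⟩⟩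
  · refine ⟨?_, ?_, ?_⟩
    · simp [armRes]
    · intro p q hq
      simp only [armRes]
      rw [if_neg (by omega), if_neg (by omega)]
      exact hsY.right p q (by omega)
    · intro p x hx
      rcases mem_arms_res hx with h | h
      · simp [hsY.right p (c + 1) (by omega)] at h
      · omega
  · refine ⟨?_, ?_, by simp, by simp, by simp, by simp, ?_, ?_⟩
    · exact fun p hp => Or.inl (Or.inl (hv.lower (hv.sh_of_legs hll) (by omega) hj))
    · intro p x hp hx
      have hx1 : (F.transpose.armRes β j i l (c + 1) 0 false).transpose.Ent p (c + 2) x := by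
        rcases (ent_res hvY hsY htY hx).1 with h | h
        · exact h
        · omega
      have hx2 : F.Ent p (c + 2) x := by
        rcases (ent_res hv.transpose hs' ht' (ent_transpose.2 hx1)).1 with h | h
        · exact ent_transpose.1 h
        · omega
      suffices x < l + γ by omega
      have hshl := hv.sh_of_legs hll
      have hhl := hv.legs_gt hll
      rcases Nat.lt_or_ge p i with hpi | hpi
      · rcases Nat.lt_or_ge (c + 2) j with hcj | hcj
        · have := hv.diag_lt hshl hpi hcj hx2 (ent_of_legs hll)
          omega
        · obtain rfl : j = c + 2 := by omega
          exact hv.col_lt hshl hpi hx2 (ent_of_legs hll)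
      · obtain rfl : p = i := by omega
        rcases Nat.lt_or_ge (c + 2) j with hcj | hcj
        · have := hv.row_lt hshl hcj hx2 (F.ent_hook _ _)
          omega
        -- This is the cell that `l` has left; for `γ = 0` it contains no second copy of `l`.
        · obtain rfl : j = c + 2 := by omega
          rcases hx2 with h | h | h
          · omega
          · have h1 := hs'.max _ _ h
            by_contra hn
            obtain rfl : x = l := by omega
            have hg : γ = 0 := by omega
            rcases hx1 with h | h | h
            · have h : x = F.hook p (c + 2) := by simpa [armRes, transpose] using h
              omega
            · change x ∈ if _ then _ else _ at h
              simp only [and_self, if_true] at h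
              have := (Multiset.Nodup.mem_erase_iff (hv.legs_nodup hg p (c + 2))).1 h
              omega
            · rcases mem_legs_res (F := F.transpose) (b := false) h with h | h
              · simp [transpose, hza p (c + 2) (by omega)] at h
              · omega
          · simp [hza p (c + 2) (by omega)] at h
    · rintro - ((h | h) | h)
      · exact hsh2 h
      · omega
      · omega
    · intro _
      simp [armRes, transpose, hh2]
  · exact sel_leg_res hw ht hs' (mem_legs_res_of_mem hs'.mem (by omega) (by omega))
  · refine ⟨?_, ?_, by simp, by simp, by simp, by simp, ?_, ?_⟩
    · intro p hp
      rcases Nat.lt_or_ge p (c + 1) with h | h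
      · exact Or.inl (ht'.below_sh p h)
      · exact Or.inr ⟨rfl, by omega⟩
    · intro p x hp hx
      rw [ent_transpose] at hx
      have h1 := ent_res hv hs ht hx
      rcases Nat.lt_or_ge p (c + 1) with h | h
      · rcases h1.1 with h2 | h2
        · exact ht'.below p x h (ent_transpose.2 h2)
        · omega
      · rcases h1.2.2 rfl (by omega) rfl with h2 | ⟨rfl, h2, -⟩
        · omega
        · simp [hz] at h2
    · rintro - (h | h)
      · exact hsh2 h
      · omega
    · intro _
      simp [armRes, transpose, hh2]
  · refine HookArray.ext ?_ ?_ ?_ ?_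
    · funext q p
      simp only [armRes, transpose, and_comm (a := p = i + 1), or_assoc, or_self_left]
    · funext q p
      simp only [armRes, transpose]
      by_cases h1 : p = i + 1 ∧ q = c + 1
      · obtain ⟨rfl, rfl⟩ := h1
        simp [hh]
      by_cases h2 : p = i + 1 ∧ q = c + 2
      · obtain ⟨rfl, rfl⟩ := h2
        simp [hh2]
      have h1' : ¬ (q = c + 1 ∧ p = i + 1) := fun h => h1 h.symm
      have h2' : ¬ (q = c + 2 ∧ p = i + 1) := fun h => h2 h.symm
      simp only [← and_assoc, h1, h1', h2, h2', false_and, if_false]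
    · funext q p
      simp only [armRes, transpose]
      by_cases h1 : p = i + 1 ∧ q = c + 1
      · obtain ⟨rfl, rfl⟩ := h1
        simp [hza (i + 1) (c + 1) (by omega), hh, hmv]
      by_cases h2 : p = i + 1 ∧ q = c + 2
      · obtain ⟨rfl, rfl⟩ := h2
        simp [hza (i + 1) (c + 2) (by omega), hh2, hcj', hir', hza i j (by omega)]
      have h1' : ¬ (q = c + 1 ∧ p = i + 1) := fun h => h1 h.symm
      have h2' : ¬ (q = c + 2 ∧ p = i + 1) := fun h => h2 h.symm
      by_cases h3 : p = i ∧ q = j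
      · obtain ⟨rfl, rfl⟩ := h3
        simp [hcj', hir', hza p q (by omega)]
      have h3' : ¬ (q = j ∧ p = i) := fun h => h3 h.symm
      simp only [h1, h1', h2, h2', h3', if_false]
    · funext q p
      simp only [armRes, transpose]
      by_cases h1 : p = i + 1 ∧ q = c + 1
      · obtain ⟨rfl, rfl⟩ := h1
        simp [hz, hh, hmv', hcj'.symm]
      by_cases h2 : p = i + 1 ∧ q = c + 2
      · obtain ⟨rfl, rfl⟩ := h2
        simp [hz, hh, hh2, hmv', hcj'.symm, hir'.symm]
      have h1' : ¬ (q = c + 1 ∧ p = i + 1) := fun h => h1 h.symm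
      have h2' : ¬ (q = c + 2 ∧ p = i + 1) := fun h => h2 h.symm
      by_cases h3 : p = r ∧ q = c
      · obtain ⟨rfl, rfl⟩ := h3
        simp [hcj'.symm]
        omega
      simp only [h1, h1', h2, h2', h3, if_false]

end HookArray
end Uncrowding

/-! ### The local square in general, and strips of squares -/

namespace Uncrowding
namespace HookArray

variable {β γ : ℕ} {F F' X Y Z W : HookArray} {c s : ℕ} {b : Bool}

/-- Both bumps create the cell `(i + 1, c + 1)`; afterwards the other one ends to the right of
it. -/
def Crosses (β γ : ℕ) (X Y : HookArray) (c i : ℕ) : Prop :=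
  ∃ W Z, AStep β γ Y W c (i + 1) true ∧ AStep β γ W Z (c + 1) (i + 1) false ∧
    AStep γ β X.transpose Z.transpose i (c + 2) false

/-- A bump of an arm and a bump of a leg commute, unless they create the same cell. -/
theorem bump_square (hv : F.Valid β γ) {i t : ℕ} {d : Bool} (hA : AStep β γ F X c s b)
    (hL : AStep γ β F.transpose Y.transpose i t d) :
    (¬ (b = false ∧ d = false ∧ s = i + 1 ∧ t = c + 1) ∧ Commutes β γ X Y c s b i t d) ∨
      (b = false ∧ d = false ∧ s = i + 1 ∧ t = c + 1 ∧
        (Crosses β γ X Y c i ∨ Crosses γ β Y.transpose X.transpose i c)) := by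
  obtain ⟨a, k, r, hs, ht, rfl⟩ := hA
  obtain ⟨l, m, j, hs', ht', hY⟩ := hL
  obtain rfl : Y = (F.transpose.armRes β j i l t m d).transpose := congrArg transpose hY
  have hw := hv.weight
  by_cases h₁ : s = i + 1 ∧ t = c + 1
  · obtain ⟨rfl, rfl⟩ := h₁
    cases b
    · cases d
      · refine Or.inr ⟨rfl, rfl, rfl, rfl, ?_⟩
        -- This comparison decides whether the second new cell lies to the right of the first or
        -- above it.
        by_cases hal : a < l + β
        · exact Or.inl (square_of_same_new hv hs ht hs' ht' hal)
        · exact Or.inr (square_of_same_new hv.transpose hs' ht' hs ht (by omega))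
      · exact absurd (ht'.old_sh rfl) (ht.new_sh rfl)
    · cases d
      · exact absurd (ht.old_sh rfl) (ht'.new_sh rfl)
      · refine Or.inl ⟨by simp, ?_⟩
        by_cases hal : a < l + β
        · exact commutes_of_same_target hv hs ht hs' ht' hal
        · exact (commutes_of_same_target hv.transpose hs' ht' hs ht (by omega)).transpose
  refine Or.inl ⟨by tauto, ?_⟩
  -- The exceptional configurations are an arm and a leg of one cell, one of which takes the other
  -- along, and a bump that hits the only copy of the entry the other bump is to move. All others
  -- are generic.
  by_cases h₃ : r = i ∧ c = j ∧ t = j ∧ l < a + β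
  · obtain ⟨rfl, rfl, rfl, hla⟩ := h₃
    exact commutes_of_moved hv hs ht hs' ht' hla
  by_cases h₃' : r = i ∧ c = j ∧ s = r ∧ a < l + γ
  · obtain ⟨rfl, rfl, rfl, hla⟩ := h₃'
    exact (commutes_of_moved hv.transpose hs' ht' hs ht hla).transpose
  by_cases h₂' : b = true ∧ s = i ∧ j = c + 1 ∧ k = l ∧ k ≠ F.hook s (c + 1) ∧
      (F.legs s (c + 1)).count l < 2
  · obtain ⟨rfl, rfl, rfl, rfl, h4, h5⟩ := h₂'
    exact commutes_of_bumped hv hs ht hs' ht' h4 h5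
  by_cases h₂ : d = true ∧ t = c ∧ r = i + 1 ∧ m = a ∧ m ≠ F.hook (i + 1) t ∧
      (F.arms (i + 1) t).count a < 2
  · obtain ⟨rfl, rfl, rfl, rfl, h4, h5⟩ := h₂
    exact (commutes_of_bumped hv.transpose hs' ht' hs ht h4 h5).transpose
  refine commutes_of_disjoint hv hs ht hs' ht' (fun h h' => h₁ ⟨h, h'⟩) ?_ ?_ ?_ ?_
  · intro e1 e2 e3 e4
    by_contra hn
    push Not at hn
    exact h₂ ⟨e1, e2, e3, e4, hn.1, hn.2⟩
  · intro e1 e2 e3 e4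
    by_contra hn
    push Not at hn
    exact h₂' ⟨e1, e2, e3, e4, hn.1, hn.2⟩
  · intro e1 e2 e3
    by_contra hn
    exact h₃ ⟨e1, e2, e3, by omega⟩
  · intro e1 e2 e3
    by_contra hn
    exact h₃' ⟨e1, e2, e3, by omega⟩

/-! ### Runs of bumps -/

theorem AStep.valid (h : AStep β γ F F' c s b) (hv : F.Valid β γ) : F'.Valid β γ := by
  obtain ⟨a, k, h⟩ := h
  exact h.valid hv

theorem AStep.sh_true (h : AStep β γ F F' c s true) : F'.sh = F.sh := by
  obtain ⟨a, k, r, hs, ht, rfl⟩ := h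
  funext i j
  refine propext ⟨?_, Or.inl⟩
  rintro (h | ⟨rfl, rfl⟩)
  · exact h
  · exact ht.old_sh rfl

/-- A sequence of bumps starting in column `c`, the last of which creates the cell `(p, q)`. -/
inductive Run (β γ : ℕ) : HookArray → HookArray → ℕ → ℕ → ℕ → Prop
  | last {F F' : HookArray} {c s : ℕ} (h : AStep β γ F F' c s false) : Run β γ F F' c s (c + 1)
  | step {F G F' : HookArray} {c s p q : ℕ} (h : AStep β γ F G c s true)
      (h' : Run β γ G F' (c + 1) p q) : Run β γ F F' c p q

theorem Run.valid {p q : ℕ} (h : Run β γ F F' c p q) (hv : F.Valid β γ) : F'.Valid β γ := by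
  induction h with
  | last h => exact h.valid hv
  | step h _ ih => exact ih (h.valid hv)

theorem Run.not_sh {p q : ℕ} (h : Run β γ F F' c p q) : ¬ F.sh p q := by
  induction h with
  | last h =>
    obtain ⟨a, k, r, hs, ht, rfl⟩ := h
    exact ht.new_sh rfl
  | step h _ ih => rwa [← h.sh_true]

theorem Run.col_lt {p q : ℕ} (h : Run β γ F F' c p q) : c < q := by
  induction h with
  | last h => omega
  | step h _ ih => omega

/-- This identifies the runs produced by commuting squares with the actual uncrowding runs. -/
theorem Run.unique {p q c' p' q' : ℕ} {F'' : HookArray} (hv : F.Valid β γ)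
    (h : Run β γ F F' c p q) (h' : Run β γ F F'' c' p' q') :
    F' = F'' ∧ c = c' ∧ p = p' ∧ q = q' := by
  induction h generalizing c' with
  | last h =>
    obtain ⟨a, k, h⟩ := h
    cases h' with
    | last h' =>
      obtain ⟨a', k', h'⟩ := h'
      obtain ⟨rfl, rfl, -, rfl, -⟩ := h.unique hv h'
      exact ⟨rfl, rfl, rfl, rfl⟩
    | step h' =>
      obtain ⟨a', k', h'⟩ := h'
      have := h.unique hv h'
      simp at this
  | step h h₂ ih =>
    cases h' with
    | last h' =>
      obtain ⟨a, k, h⟩ := h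
      obtain ⟨a', k', h'⟩ := h'
      have := h.unique hv h'
      simp at this
    | step h' h₂' =>
      have hv' := h.valid hv
      obtain ⟨a, k, h⟩ := h
      obtain ⟨a', k', h'⟩ := h'
      obtain ⟨rfl, rfl, -⟩ := h.unique hv h'
      obtain ⟨e1, -, e2, e3⟩ := ih hv' h₂'
      exact ⟨e1, rfl, e2, e3⟩

/-- A bump of an arm that creates no cell commutes with a run of leg bumps. -/
theorem run_strip (hv : F.Valid β γ) {i p q : ℕ} (hA : AStep β γ F X c s true)
    (hL : Run γ β F.transpose Y.transpose i q p) :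
    ∃ Z s', AStep β γ Y Z c s' true ∧ Run γ β X.transpose Z.transpose i q p := by
  generalize hG : F.transpose = G at hL
  generalize hH : Y.transpose = H at hL
  induction hL generalizing F X s with
  | last h =>
    subst hG hH
    rcases bump_square hv hA h with ⟨-, Z, s', t', h1, h2, -, h4⟩ | h
    · obtain rfl := h4 rfl
      exact ⟨Z, s', h1, Run.last h2⟩
    · simp at h
  | @step G G' H i t q p h hr ih =>
    subst hG hH
    rcases bump_square hv hA (Y := G'.transpose) h with ⟨-, Z, s', t', h1, h2, -, h4⟩ | h
    · obtain ⟨Z', s'', h5, h6⟩ := ih (F := G'.transpose) ((h.valid hv.transpose).transpose) h1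
        rfl rfl
      exact ⟨Z', s'', h5, Run.step h2 h6⟩
    · simp at h

end HookArray
end Uncrowding

/-! ### Interchanging a whole arm run with a whole leg run -/

namespace Uncrowding
namespace HookArray

variable {β γ : ℕ} {F F' X Y Z W : HookArray} {c s : ℕ} {b : Bool}

/-- A run of arm bumps from `F` to `X`, creating the cell `(p, q)`, and a run of leg bumps from
`F` to `Y`, creating the cell `(p', q')`, can be interchanged. -/
def RunSquare (β γ : ℕ) (X Y : HookArray) (c p q i p' q' : ℕ) : Prop :=
  ∃ Z, (¬ (p = p' ∧ q = q') ∧ Run β γ Y Z c p q ∧ Run γ β X.transpose Z.transpose i q' p') ∨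
    (p = p' ∧ q = q' ∧ ∃ u v, (u = p + 1 ∧ v = q ∨ u = p ∧ v = q + 1) ∧
      Run β γ Y Z c u v ∧ Run γ β X.transpose Z.transpose i v u)

/-- The cell-creating arm bump is carried along the leg run. Before the last leg bump only one of
the two bumps creates a cell, so the square is an ordinary one; a crossing is possible only at the
end. -/
theorem runSquare_of_last (hv : F.Valid β γ) {i p' q' : ℕ} (hA : AStep β γ F X c s false)
    (hL : Run γ β F.transpose Y.transpose i q' p') :
    RunSquare β γ X Y c s (c + 1) i p' q' := by
  generalize hG : F.transpose = G at hL
  generalize hH : Y.transpose = H at hL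
  induction hL generalizing F X with
  | last hl =>
    subst hG hH
    rcases bump_square hv hA hl with ⟨h0, Z, s', t', h1, h2, h3, h4⟩ | ⟨-, -, rfl, rfl, h⟩
    · obtain rfl := h4 rfl
      obtain rfl := h3 rfl
      refine ⟨Z, Or.inl ⟨fun h5 => h0 ⟨rfl, rfl, h5.1, h5.2.symm⟩, Run.last h1, Run.last h2⟩⟩
    · rcases h with ⟨W, Z, h1, h2, h3⟩ | ⟨W, Z, h1, h2, h3⟩
      · exact ⟨Z, Or.inr ⟨rfl, rfl, _, _, Or.inr ⟨rfl, rfl⟩, Run.step h1 (Run.last h2),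
          Run.last h3⟩⟩
      · exact ⟨Z.transpose, Or.inr ⟨rfl, rfl, _, _, Or.inl ⟨rfl, rfl⟩, Run.last h3,
          Run.step h1 (Run.last h2)⟩⟩
  | @step G G' H i t q p h hr ih =>
    subst hG hH
    rcases bump_square hv hA (Y := G'.transpose) h with ⟨-, Z, s', t', h1, h2, h3, h4⟩ | h
    · obtain rfl := h3 rfl
      obtain ⟨Z', h5⟩ := ih (F := G'.transpose) ((h.valid hv.transpose).transpose) h1
        rfl rfl
      refine ⟨Z', h5.imp (fun h => ⟨h.1, h.2.1, Run.step h2 h.2.2⟩) ?_⟩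
      rintro ⟨rfl, rfl, u, v, h6, h7, h8⟩
      exact ⟨rfl, rfl, u, v, h6, h7, Run.step h2 h8⟩
    · simp at h

/-- Induction along the arm run: each bump that creates no cell contributes a strip (`run_strip`),
and the last bump is `runSquare_of_last`. -/
theorem Run.square (hv : F.Valid β γ) {i p q p' q' : ℕ} (hA : Run β γ F X c p q)
    (hL : Run γ β F.transpose Y.transpose i q' p') : RunSquare β γ X Y c p q i p' q' := by
  induction hA generalizing Y with
  | last h => exact runSquare_of_last hv h hL
  | step h _ ih =>
    obtain ⟨Z, s', h1, h2⟩ := run_strip hv h hL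
    obtain ⟨Z', h3⟩ := ih (h.valid hv) h2
    refine ⟨Z', h3.imp (fun h => ⟨h.1, Run.step h1 h.2.1, h.2.2⟩) ?_⟩
    rintro ⟨rfl, rfl, u, v, h6, h7, h8⟩
    exact ⟨rfl, rfl, u, v, h6, Run.step h1 h7, h8⟩

/-! ### Consecutive runs from the same column -/

/-- `x` is a hook or leg entry in column `j`. -/
def ColHas (F : HookArray) (j x : ℕ) : Prop := ∃ i, F.sh i j ∧ (x = F.hook i j ∨ x ∈ F.legs i j)

variable {a k : ℕ}

theorem ArmStep.colHas_of_ne {j x : ℕ} (h : ArmStep β γ F F' c a s k b) (h₁ : j ≠ c)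
    (h₂ : j ≠ c + 1) : F'.ColHas j x ↔ F.ColHas j x := by
  obtain ⟨r, hs, ht, rfl⟩ := h
  simp [ColHas, armRes, h₁, h₂]

/-- Hooks of column `c` do not change, and only legs with `a < x + γ` can leave the column. -/
theorem ArmStep.colHas_source {x : ℕ} (h : ArmStep β γ F F' c a s k b) (hx : F.ColHas c x)
    (hxa : x + γ ≤ a) : F'.ColHas c x := by
  obtain ⟨r, hs, ht, rfl⟩ := h
  obtain ⟨i, hi, hx⟩ := hx
  refine ⟨i, Or.inl hi, ?_⟩
  simp only [armRes]
  rw [if_neg (by omega), if_neg (c := i = s ∧ c = c + 1) (by omega)]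
  refine hx.imp id fun hx => ?_
  split_ifs
  · exact Multiset.mem_filter.2 ⟨hx, by omega⟩
  · exact hx

theorem ArmStep.colHas_target (h : ArmStep β γ F F' c a s k b) : F'.ColHas (c + 1) a := by
  obtain ⟨r, hs, ht, rfl⟩ := h
  refine ⟨s, Or.inr ⟨rfl, rfl⟩, ?_⟩
  simp only [armRes]
  by_cases hk : k = F.hook s (c + 1)
  · simp [hk]
  · simp [hk]

/-- A `Run` that remembers the entry it starts with. -/
inductive RunFrom (β γ : ℕ) : HookArray → HookArray → ℕ → ℕ → ℕ → Prop
  | last {F F' : HookArray} {c a s k : ℕ} (h : ArmStep β γ F F' c a s k false) :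
      RunFrom β γ F F' c a (c + 1)
  | step {F G F' : HookArray} {c a s k q : ℕ} (h : ArmStep β γ F G c a s k true)
      (h' : RunFrom β γ G F' (c + 1) k q) : RunFrom β γ F F' c a q

theorem ArmStep.sel_of_true (h : ArmStep β γ F F' c a s k true) : F'.ArmSel s (c + 1) k := by
  obtain ⟨r, hs, ht, rfl⟩ := h
  refine ⟨?_, ?_, ?_⟩
  · simp [armRes]
  · intro i j hj
    simp only [armRes]
    rw [if_neg (by omega), if_neg (by omega)]
    exact hs.right i j (by omega)
  · intro i x hx
    rcases mem_arms_res hx with h | h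
    · simp [hs.right i (c + 1) (by omega)] at h
    · exact h.2.2.2.le

theorem RunFrom.sel {q : ℕ} (h : RunFrom β γ F F' c a q) : ∃ r, F.ArmSel r c a := by
  cases h with
  | last h =>
    obtain ⟨r, hs, -⟩ := h
    exact ⟨r, hs⟩
  | step h h' =>
    obtain ⟨r, hs, -⟩ := h
    exact ⟨r, hs⟩

theorem Run.runFrom {p q : ℕ} (h : Run β γ F F' c p q) (hv : F.Valid β γ) :
    ∃ a, RunFrom β γ F F' c a q := by
  induction h with
  | last h =>
    obtain ⟨a, k, h⟩ := h
    exact ⟨a, .last h⟩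
  | step h _ ih =>
    have hv' := h.valid hv
    obtain ⟨a, k, h⟩ := h
    obtain ⟨k', h'⟩ := ih hv'
    obtain ⟨r, hs⟩ := h'.sel
    obtain rfl : k' = k := (hs.unique hv' h.sel_of_true).2.2
    exact ⟨a, .step h h'⟩

theorem RunFrom.colHas_of_lt {q j x : ℕ} (h : RunFrom β γ F F' c a q) (hj : j < c) :
    F'.ColHas j x ↔ F.ColHas j x := by
  induction h with
  | last h => exact h.colHas_of_ne (by omega) (by omega)
  | step h _ ih => rw [ih (by omega), h.colHas_of_ne (by omega) (by omega)]

theorem RunFrom.colHas_source {q x : ℕ} (h : RunFrom β γ F F' c a q) (hx : F.ColHas c x)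
    (hxa : x + γ ≤ a) : F'.ColHas c x := by
  cases h with
  | last h => exact h.colHas_source hx hxa
  | step h h' => exact (h'.colHas_of_lt (by omega)).2 (h.colHas_source hx hxa)

theorem RunFrom.col_lt {q : ℕ} (h : RunFrom β γ F F' c a q) : c < q := by
  induction h with
  | last h => omega
  | step h _ ih => omega

/-- The entry `x` is itself a candidate, so the target is not above it and the bumped entry is at
most `x`. -/
theorem ArmStep.true_of_colHas {x : ℕ} (hv : F.Valid β γ) (h : ArmStep β γ F F' c a s k b)
    (hx : F.ColHas (c + 1) x) (hax : a < x + β) : b = true ∧ k ≤ x := by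
  have hw := hv.weight
  obtain ⟨r, hs, ht, rfl⟩ := h
  obtain ⟨i, hi, hx⟩ := hx
  have hx : F.Ent i (c + 1) x := hx.imp id Or.inl
  have his : s ≤ i := by
    by_contra hn
    have := ht.below i x (by omega) hx
    omega
  have hb : b = true := by
    by_contra hb
    exact ht.new_sh (by simpa using hb) (hv.lower hi his le_rfl)
  refine ⟨hb, ?_⟩
  rcases Nat.lt_or_ge s i with h | h
  · have := hv.col_lt hi h (ht.ent hb) hx
    omega
  · obtain rfl : i = s := by omega
    exact ht.old_min hb x hx hax

/-- The entry that the first run leaves in a column can be bumped by the second run, so whatever the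
second run bumps there is no larger. Hence the comparison `a' < a + β` passes on to the entries
bumped next, and in the column where the first run creates a cell the second one still finds
something to bump. -/
theorem RunFrom.col_lt_of_colHas {q q' a' : ℕ} {G G' : HookArray}
    (h : RunFrom β γ F F' c a q) (hv : G.Valid β γ) (h' : RunFrom β γ G G' c a' q')
    (hG : ∀ j x, c < j → F'.ColHas j x → G.ColHas j x) (ha : a' < a + β) : q < q' := by
  have hw := hv.weight
  induction h generalizing G a' with
  | last h =>
    have hx := hG _ _ (by omega) h.colHas_target
    cases h' with
    | last h' => simpa using (h'.true_of_colHas hv hx ha).1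
    | step _ h' => exact h'.col_lt
  | @step F F₁ F' c a s k q h hr ih =>
    have hak : a < k + β := by
      obtain ⟨r, hs, ht, rfl⟩ := h
      exact ht.old_le rfl
    -- The entry `a` stays in column `c + 1` during the rest of the first run, because `a + γ ≤ k`
    -- for the entry `k` that moves on.
    have hx := hG _ _ (by omega) (hr.colHas_source h.colHas_target (by omega))
    cases h' with
    | last h' => simpa using (h'.true_of_colHas hv hx ha).1
    | step hs h' =>
      have := (hs.true_of_colHas hv hx ha).2
      refine ih (hs.valid hv) h' (fun j x hj hx => ?_) (by omega)
      exact (hs.colHas_of_ne (by omega) (by omega)).2 (hG j x (by omega) hx)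

theorem RunFrom.arms_of_lt {q j i : ℕ} (h : RunFrom β γ F F' c a q) (hj : j < c) :
    F'.arms i j = F.arms i j := by
  induction h with
  | last h =>
    obtain ⟨r, hs, ht, rfl⟩ := h
    simp only [armRes]
    rw [if_neg (by omega), if_neg (by omega)]
  | step h _ ih =>
    rw [ih (by omega)]
    obtain ⟨r, hs, ht, rfl⟩ := h
    simp only [armRes]
    rw [if_neg (by omega), if_neg (by omega)]

/-- The entry `a` was a largest arm of its column. Another copy can only be in the same cell, and
only if `β = 1`. -/
theorem ArmStep.arms_source_lt {i x : ℕ} (h : ArmStep β γ F F' c a s k b) (hv : F.Valid β γ)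
    (hx : x ∈ F'.arms i c) : x < a + β := by
  have hw := hv.weight
  obtain ⟨r, hs, ht, rfl⟩ := h
  simp only [armRes] at hx
  rw [if_neg (c := i = s ∧ c = c + 1) (by omega)] at hx
  split_ifs at hx with h1
  · have h2 := hs.max _ _ (Multiset.mem_of_mem_erase hx)
    by_cases hb : β = 0
    · have := (Multiset.Nodup.mem_erase_iff (hv.arms_nodup hb _ _)).1 hx
      omega
    · omega
  · have h2 := hs.max _ _ hx
    by_contra hn
    obtain rfl : x = a := by omega
    have h3 := hv.arms_gt hx
    have h4 := hv.arms_gt hs.mem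
    rcases lt_trichotomy i r with h | h | h
    · have := hv.col_lt (hv.sh_of_arms hs.mem) h (ent_of_arms hx) (F.ent_hook _ _)
      omega
    · simp [h] at h1
    · have := hv.col_lt (hv.sh_of_arms hx) h (ent_of_arms hs.mem) (F.ent_hook _ _)
      omega

theorem RunFrom.arms_source_lt {q i x : ℕ} (h : RunFrom β γ F F' c a q) (hv : F.Valid β γ)
    (hx : x ∈ F'.arms i c) : x < a + β := by
  cases h with
  | last h => exact h.arms_source_lt hv hx
  | step h h' =>
    rw [h'.arms_of_lt (by omega)] at hx
    exact h.arms_source_lt hv hx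

/-- Of two consecutive runs from the same column the second one ends further to the right. -/
theorem Run.col_lt_col {p q p' q' : ℕ} {F'' : HookArray} (hv : F.Valid β γ)
    (h : Run β γ F F' c p q) (h' : Run β γ F' F'' c p' q') : q < q' := by
  have hv' := h.valid hv
  obtain ⟨a, h⟩ := h.runFrom hv
  obtain ⟨a', h'⟩ := h'.runFrom hv'
  refine h.col_lt_of_colHas hv' h' (fun _ _ _ h => h) ?_
  obtain ⟨r, hs⟩ := h'.sel
  exact h.arms_source_lt hv hs.mem

theorem ArmStep.arms_source {r i : ℕ} (h : ArmStep β γ F F' c a s k b) (hv : F.Valid β γ)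
    (hs : F.ArmSel r c a) :
    F'.arms i c = if i = r then (F.arms i c).erase a else F.arms i c := by
  obtain ⟨r', hs', ht, rfl⟩ := h
  obtain ⟨rfl, -⟩ := hs.unique hv hs'
  simp [armRes]

theorem RunFrom.arms_source {r q i : ℕ} (h : RunFrom β γ F F' c a q) (hv : F.Valid β γ)
    (hs : F.ArmSel r c a) :
    F'.arms i c = if i = r then (F.arms i c).erase a else F.arms i c := by
  cases h with
  | last h => exact h.arms_source hv hs
  | step h h' => rw [h'.arms_of_lt (by omega), h.arms_source hv hs]

/-- The travelling entry is the only arm to the right of column `c`, and at the end it becomes a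
hook. -/
theorem RunFrom.arms_right {q i j : ℕ} (h : RunFrom β γ F F' c a q) (hv : F.Valid β γ)
    (hj : c < j) : F'.arms i j = 0 := by
  induction h with
  | last h =>
    obtain ⟨r, hs, ht, rfl⟩ := h
    simp only [armRes]
    rw [if_neg (by omega)]
    simp [hs.right i j hj]
  | @step F F₁ F' c a s k q h hr ih =>
    have hv' := h.valid hv
    rcases Nat.lt_or_ge (c + 1) j with hj' | hj'
    · exact ih hv' hj'
    · obtain rfl : j = c + 1 := by omega
      have hsel := h.sel_of_true
      rw [hr.arms_source hv' hsel]
      obtain ⟨r, hs, ht, rfl⟩ := h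
      simp only [armRes]
      by_cases hi : i = s
      · simp [hi, hs.right s (c + 1) (by omega)]
      · simp [hi, hs.right i (c + 1) (by omega)]

/-- The columns of consecutive runs decrease weakly. -/
theorem Run.col_le {p q c' p' q' : ℕ} {F'' : HookArray} (hv : F.Valid β γ)
    (h : Run β γ F F' c p q) (h' : Run β γ F' F'' c' p' q') : c' ≤ c := by
  have hv' := h.valid hv
  obtain ⟨a, h⟩ := h.runFrom hv
  obtain ⟨a', h'⟩ := h'.runFrom hv'
  obtain ⟨r, hs⟩ := h'.sel
  by_contra hn
  have := hs.mem
  simp [h.arms_right hv (show c < c' by omega)] at this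

end HookArray
end Uncrowding

/-! ### Translating tableaux and their bumps into arrays -/

namespace Uncrowding
open HookArray

theorem Hook.replace_arms {b : Hook} {k x : ℕ} (h : k = b.hook ∨ k ∈ b.legs) :
    (b.replace k x).arms = b.arms := by
  unfold Hook.replace
  split_ifs <;> simp_all

theorem Hook.replace_legs {b : Hook} {k x : ℕ} (h : k ∉ b.legs) :
    (b.replace k x).legs = b.legs := by
  unfold Hook.replace
  split_ifs
  · rfl
  · rfl

namespace Filling

/-- The array of hooks of a filling. -/
def toArray (T : Filling) : HookArray where
  sh i j := (i, j) ∈ T.shape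
  hook i j := (T.box (i, j)).hook
  legs i j := (T.box (i, j)).legs.val
  arms i j := (T.box (i, j)).arms

theorem toArray_injective {S T : Filling} (h : S.toArray = T.toArray) : S = T := by
  have h1 := congrArg HookArray.sh h
  have h2 := congrArg HookArray.hook h
  have h3 := congrArg HookArray.legs h
  have h4 := congrArg HookArray.arms h
  refine Filling.ext ?_ ?_
  · ext ⟨i, j⟩
    exact iff_of_eq (congrFun (congrFun h1 i) j)
  · funext ⟨i, j⟩
    exact Hook.ext (congrFun (congrFun h2 i) j) (Finset.val_injective (congrFun (congrFun h3 i) j))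
      (congrFun (congrFun h4 i) j)

theorem mem_entries {T : Filling} {i j x : ℕ} :
    x ∈ (T.box (i, j)).entries ↔ T.toArray.Ent i j x := by
  simp [Hook.entries, toArray, Ent]

theorem IsHVT.valid {T : Filling} (h : T.IsHVT) : T.toArray.Valid 1 0 where
  weight := rfl
  lower := fun hs hi hj => h.isLowerSet (Prod.mk_le_mk.2 ⟨hi, hj⟩) hs
  hook_off := fun hs => by simp [toArray, h.box_eq_empty _ hs, Hook.empty]
  legs_off := fun hs => by simp [toArray, h.box_eq_empty _ hs, Hook.empty]
  arms_off := fun hs => by simp [toArray, h.box_eq_empty _ hs, Hook.empty]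
  legs_gt := by
    intro i j x hx
    by_cases hs : (i, j) ∈ T.shape
    · exact (h.semistandard _ hs).2.1 x hx
    · simp [toArray, h.box_eq_empty _ hs, Hook.empty] at hx
  arms_gt := by
    intro i j x hx
    by_cases hs : (i, j) ∈ T.shape
    · exact Nat.lt_succ_of_le ((h.semistandard _ hs).2.2 x hx)
    · simp [toArray, h.box_eq_empty _ hs, Hook.empty] at hx
  row := fun hs hx hy =>
    Nat.lt_succ_of_le (h.row_weak _ _ hs _ (mem_entries.2 hx) _ (mem_entries.2 hy))
  col := fun hs hx hy => h.col_strict _ _ hs _ (mem_entries.2 hx) _ (mem_entries.2 hy)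
  legs_nodup := fun _ i j => (T.box (i, j)).legs.nodup
  arms_nodup := by simp

/-- Applied to a row or a column, this makes the number of its cells the position of the first free
cell, where new cells are created. -/
theorem mem_iff_lt_card_of_lower (S : Finset ℕ) (h : ∀ m n, m ≤ n → n ∈ S → m ∈ S) (n : ℕ) :
    n ∈ S ↔ n < S.card := by
  obtain ⟨m, hm⟩ : ∃ m, S = Finset.range m := by
    have hex : ∃ m, m ∉ S := Infinite.exists_notMem_finset S
    classical
    refine ⟨Nat.find hex, ?_⟩
    ext n
    rw [Finset.mem_range]
    refine ⟨fun hn => ?_, fun hn => ?_⟩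
    · by_contra hlt
      exact Nat.find_spec hex (h _ _ (not_lt.1 hlt) hn)
    · by_contra hn'
      exact Nat.find_min hex hn hn'
  subst hm
  simp

variable {T : Filling}

theorem mem_col_iff (hT : T.toArray.Valid 1 0) (i j : ℕ) :
    (i, j) ∈ T.shape ↔ i < (T.col j).card := by
  have hc : (T.col j).card = ((T.col j).image Prod.fst).card := by
    rw [Finset.card_image_of_injOn]
    intro p hp q hq h
    simp only [col, Finset.coe_filter, Set.mem_ofPred_eq] at hp hq
    exact Prod.ext h (hp.2.trans hq.2.symm)
  rw [hc, ← mem_iff_lt_card_of_lower]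
  · simp [col]
  · intro m n hmn hn
    simp only [col, Finset.mem_image, Finset.mem_filter, Prod.exists, exists_and_right,
      exists_eq_right] at hn ⊢
    exact hT.lower (F := T.toArray) hn hmn le_rfl

theorem mem_row_iff (hT : T.toArray.Valid 1 0) (i j : ℕ) :
    (i, j) ∈ T.shape ↔ j < (T.row i).card := by
  have hc : (T.row i).card = ((T.row i).image Prod.snd).card := by
    rw [Finset.card_image_of_injOn]
    intro p hp q hq h
    simp only [row, Finset.coe_filter, Set.mem_ofPred_eq] at hp hq
    exact Prod.ext (hp.2.trans hq.2.symm) h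
  rw [hc, ← mem_iff_lt_card_of_lower]
  · simp [row]
  · intro m n hmn hn
    simp only [row, Finset.mem_image, Finset.mem_filter, Prod.exists, exists_eq_right] at hn ⊢
    exact hT.lower (F := T.toArray) hn le_rfl hmn

theorem armSel (hT : T.toArray.Valid 1 0) (hA : T.armCells.Nonempty) :
    T.toArray.ArmSel T.armRow T.armCol T.armEntry := by
  have hle : ∀ i j x, x ∈ T.toArray.arms i j → j ≤ T.armCol := by
    intro i j x hx
    refine Finset.le_sup (f := Prod.snd) (b := (i, j)) ?_
    simp only [armCells, Finset.mem_filter]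
    refine ⟨hT.sh_of_arms hx, ?_⟩
    rintro h
    simp [toArray, h] at hx
  have hmax : ∀ i x, x ∈ T.toArray.arms i T.armCol → x ≤ T.armEntry := by
    intro i x hx
    have h1 : (i, T.armCol) ∈ T.col T.armCol := by
      simpa [col] using show (i, T.armCol) ∈ T.shape from hT.sh_of_arms hx
    exact (Multiset.le_sup hx).trans
      (Finset.le_sup (f := fun p => (T.box p).arms.sup) h1)
  have hex : ∃ i, T.armEntry ∈ T.toArray.arms i T.armCol := by
    by_contra hn
    push Not at hn
    obtain ⟨⟨i, j⟩, hp, hj⟩ := Finset.exists_mem_eq_sup _ hA Prod.snd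
    simp only [armCells, Finset.mem_filter] at hp
    obtain ⟨x, hx⟩ := Multiset.exists_mem_of_ne_zero hp.2
    replace hj : T.armCol = j := hj
    subst hj
    have h1 := hmax i x hx
    have h2 : x ≠ T.armEntry := fun h => hn i (h ▸ hx)
    -- A supremum that is not attained could be lowered by one.
    have h3 : T.armEntry ≤ T.armEntry - 1 := by
      conv_lhs => rw [armEntry]
      refine Finset.sup_le fun q hq => Multiset.sup_le.2 fun y hy => ?_
      simp only [col, Finset.mem_filter] at hq
      obtain ⟨q1, q2⟩ := q
      obtain rfl : q2 = T.armCol := hq.2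
      have h4 := hmax q1 y hy
      have h5 : y ≠ T.armEntry := fun h => hn q1 (h ▸ hy)
      omega
    omega
  refine ⟨?_, ?_, hmax⟩
  · obtain ⟨i, hi⟩ := hex
    have hne : ((T.col T.armCol).filter fun p => T.armEntry ∈ (T.box p).arms).Nonempty :=
      ⟨(i, T.armCol), by simpa [col] using ⟨hT.sh_of_arms hi, hi⟩⟩
    obtain ⟨⟨q1, q2⟩, hq, h⟩ := Finset.exists_mem_eq_sup _ hne Prod.fst
    simp only [col, Finset.mem_filter] at hq
    obtain rfl : q2 = T.armCol := hq.1.2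
    replace h : T.armRow = q1 := h
    rw [h]
    exact hq.2
  · intro i j hj
    by_contra hn
    obtain ⟨x, hx⟩ := Multiset.exists_mem_of_ne_zero hn
    have := hle i j x hx
    omega

theorem legSel (hT : T.toArray.Valid 1 0) (hA : T.legCells.Nonempty) :
    T.toArray.transpose.ArmSel T.legCol T.legRow T.legEntry := by
  have hle : ∀ i j x, x ∈ T.toArray.legs i j → i ≤ T.legRow := by
    intro i j x hx
    refine Finset.le_sup (f := Prod.fst) (b := (i, j)) ?_
    simp only [legCells, Finset.mem_filter]
    refine ⟨hT.sh_of_legs hx, ?_⟩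
    rintro h
    simp [toArray, h] at hx
  have hmax : ∀ i x, x ∈ T.toArray.legs T.legRow i → x ≤ T.legEntry := by
    intro i x hx
    have h1 : (T.legRow, i) ∈ T.row T.legRow := by
      simpa [row] using show (T.legRow, i) ∈ T.shape from hT.sh_of_legs hx
    exact (Finset.le_sup (f := id) (b := x) (by exact hx)).trans
      (Finset.le_sup (f := fun p => (T.box p).legs.sup id) h1)
  have hex : ∃ i, T.legEntry ∈ T.toArray.legs T.legRow i := by
    by_contra hn
    push Not at hn
    obtain ⟨⟨i, j⟩, hp, hj⟩ := Finset.exists_mem_eq_sup _ hA Prod.fst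
    simp only [legCells, Finset.mem_filter] at hp
    obtain ⟨x, hx⟩ := Finset.nonempty_iff_ne_empty.2 hp.2
    replace hj : T.legRow = i := hj
    subst hj
    have h1 := hmax j x hx
    have h2 : x ≠ T.legEntry := fun h => hn j (h ▸ hx)
    have h3 : T.legEntry ≤ T.legEntry - 1 := by
      conv_lhs => rw [legEntry]
      refine Finset.sup_le fun q hq => Finset.sup_le fun y hy => ?_
      simp only [row, Finset.mem_filter] at hq
      obtain ⟨q1, q2⟩ := q
      obtain rfl : q1 = T.legRow := hq.2
      have h4 := hmax q2 y hy
      have h5 : y ≠ T.legEntry := fun h => hn q2 (h ▸ hy)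
      simp only [id]
      omega
    omega
  refine ⟨?_, ?_, hmax⟩
  · obtain ⟨i, hi⟩ := hex
    have hne : ((T.row T.legRow).filter fun p => T.legEntry ∈ (T.box p).legs).Nonempty :=
      ⟨(T.legRow, i), by simpa [row] using ⟨hT.sh_of_legs hi, hi⟩⟩
    obtain ⟨⟨q1, q2⟩, hq, h⟩ := Finset.exists_mem_eq_sup _ hne Prod.snd
    simp only [row, Finset.mem_filter] at hq
    obtain rfl : q1 = T.legRow := hq.1.2
    replace h : T.legCol = q2 := h
    rw [h]
    exact hq.2
  · intro i j hj
    by_contra hn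
    obtain ⟨x, hx⟩ := Multiset.exists_mem_of_ne_zero hn
    have := hle j i x hx
    omega

theorem mem_armTargets {k : ℕ} : k ∈ T.armTargets ↔
    (∃ i, (i, T.armCol + 1) ∈ T.shape ∧ T.toArray.Ent i (T.armCol + 1) k) ∧ T.armEntry ≤ k := by
  simp only [armTargets, entriesIn, col, Finset.mem_filter, Finset.mem_biUnion,
    Multiset.mem_toFinset, Prod.exists, mem_entries]
  grind

theorem mem_legTargets {k : ℕ} : k ∈ T.legTargets ↔
    (∃ j, (T.legRow + 1, j) ∈ T.shape ∧ T.toArray.Ent (T.legRow + 1) j k) ∧ T.legEntry < k := by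
  simp only [legTargets, entriesIn, row, Finset.mem_filter, Finset.mem_biUnion,
    Multiset.mem_toFinset, Prod.exists, mem_entries]
  grind

theorem val_eq_of_mem_iff {A : Finset ℕ} {M : Multiset ℕ} (hM : M.Nodup)
    (h : ∀ x, x ∈ A ↔ x ∈ M) : A.val = M :=
  (Multiset.Nodup.ext A.nodup hM).2 h

/-- The filling after the arm entry `a` in `(r, c)` has bumped `k` in `(s, c + 1)`. -/
def armBumpOld (T : Filling) (r c a s k : ℕ) : Filling :=
  let b := T.box (r, c)
  let moved := if r = s then b.legs.filter fun l => a < l else ∅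
  let b' := (T.box (s, c + 1)).replace k a
  { shape := T.shape
    box := Function.update
      (Function.update T.box (r, c) ⟨b.hook, b.legs \ moved, b.arms.erase a⟩)
      (s, c + 1) ⟨b'.hook, b'.legs ∪ moved, k ::ₘ b'.arms⟩ }

/-- The filling after the arm entry `a` in `(r, c)` has been moved to the new cell `(s, c + 1)`. -/
def armBumpNew (T : Filling) (r c a s : ℕ) : Filling :=
  let b := T.box (r, c)
  let moved := if r = s then b.legs.filter fun l => a < l else ∅
  { shape := insert (s, c + 1) T.shape
    box := Function.update
      (Function.update T.box (r, c) ⟨b.hook, b.legs \ moved, b.arms.erase a⟩)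
      (s, c + 1) ⟨a, moved, 0⟩ }

theorem armBump_eq_old (hA : T.armCells.Nonempty) (h : T.armTargets.Nonempty) {s : ℕ}
    (hs : ((T.col (T.armCol + 1)).filter fun p =>
      T.armTargets.min' h ∈ (T.box p).entries).sup Prod.fst = s) :
    T.armBump = T.armBumpOld T.armRow T.armCol T.armEntry s (T.armTargets.min' h) := by
  unfold armBump armBumpOld
  rw [if_pos hA]
  simp only [h, dif_pos, hs]

theorem armBump_eq_new (hA : T.armCells.Nonempty) (h : ¬ T.armTargets.Nonempty) :
    T.armBump = T.armBumpNew T.armRow T.armCol T.armEntry (T.col (T.armCol + 1)).card := by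
  unfold armBump armBumpNew
  rw [if_pos hA]
  simp only [h, dif_neg, not_false_eq_true]

/-- On finite sets legs are inserted and united, on multisets they are added. The two agree since
`Valid.armRes` rules out repeated legs in the result, so it suffices to compare members. -/
theorem toArray_armBumpOld {r c a s k : ℕ} (hT : T.toArray.Valid 1 0) (hs : T.toArray.ArmSel r c a)
    (ht : T.toArray.ArmTgt 1 c a s k true) :
    (T.armBumpOld r c a s k).toArray = T.toArray.armRes 0 r c a s k true := by
  have hn := (hT.armRes hs ht).legs_nodup rfl
  have hsh : (s, c + 1) ∈ T.shape := ht.old_sh rfl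
  have hmem : k = (T.box (s, c + 1)).hook ∨ k ∈ (T.box (s, c + 1)).legs := ht.old_mem rfl
  have hza : (T.box (s, c + 1)).arms = 0 := hs.right s (c + 1) (by omega)
  refine HookArray.ext ?_ ?_ ?_ ?_
  · funext i j
    refine propext ⟨Or.inl, ?_⟩
    rintro (h | ⟨rfl, rfl⟩)
    · exact h
    · exact hsh
  · funext i j
    simp only [toArray, armBumpOld, armRes, Function.update_apply, Prod.mk.injEq, Hook.replace]
    grind
  · funext i j
    refine val_eq_of_mem_iff (hn i j) fun x => ?_
    simp only [toArray, armBumpOld, armRes, Function.update_apply, Prod.mk.injEq, Hook.replace]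
    by_cases h1 : i = s ∧ j = c + 1
    · obtain ⟨rfl, rfl⟩ := h1
      by_cases hk : k = (T.box (i, c + 1)).hook
      · by_cases hr : r = i
        · simp [hk, hr]
        · simp [hk, hr, Ne.symm hr]
      · have hk' := hmem.resolve_left hk
        by_cases hr : r = i
        · simp [hk, hk', hr, ← Finset.erase_val]
        · simp [hk, hk', hr, Ne.symm hr, ← Finset.erase_val]
    · by_cases h2 : i = r ∧ j = c
      · obtain ⟨rfl, rfl⟩ := h2
        by_cases hr : i = s
        · simp [hr]
          grind
        · simp [hr, Ne.symm hr]
      · simp [h1, h2]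
  · funext i j
    simp only [toArray, armBumpOld, armRes, Function.update_apply, Prod.mk.injEq,
      Hook.replace_arms hmem]
    by_cases h1 : i = s ∧ j = c + 1
    · obtain ⟨rfl, rfl⟩ := h1
      simp [hza]
    · by_cases h2 : i = r ∧ j = c
      · obtain ⟨rfl, rfl⟩ := h2
        simp
      · simp [h1, h2]

theorem toArray_armBumpNew {r c a s k : ℕ} (hT : T.toArray.Valid 1 0) (hs : T.toArray.ArmSel r c a)
    (ht : T.toArray.ArmTgt 1 c a s k false) :
    (T.armBumpNew r c a s).toArray = T.toArray.armRes 0 r c a s k false := by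
  have hn := (hT.armRes hs ht).legs_nodup rfl
  have hsh : (s, c + 1) ∉ T.shape := ht.new_sh rfl
  have hk : k = (T.box (s, c + 1)).hook := ht.new_eq rfl
  have hza : (T.box (s, c + 1)).arms = 0 := hT.arms_off hsh
  have hzl : (T.box (s, c + 1)).legs = ∅ := Finset.val_eq_zero.1 (hT.legs_off hsh)
  refine HookArray.ext ?_ ?_ ?_ ?_
  · funext i j
    simp [toArray, armBumpNew, armRes, or_comm]
  · funext i j
    simp only [toArray, armBumpNew, armRes, Function.update_apply, Prod.mk.injEq]
    grind
  · funext i j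
    refine val_eq_of_mem_iff (hn i j) fun x => ?_
    simp only [toArray, armBumpNew, armRes, Function.update_apply, Prod.mk.injEq]
    by_cases h1 : i = s ∧ j = c + 1
    · obtain ⟨rfl, rfl⟩ := h1
      by_cases hr : r = i
      · simp [hk, hr, hzl]
      · simp [hk, hr, Ne.symm hr, hzl]
    · by_cases h2 : i = r ∧ j = c
      · obtain ⟨rfl, rfl⟩ := h2
        by_cases hr : i = s
        · simp [hr]
          grind
        · simp [hr, Ne.symm hr]
      · simp [h1, h2]
  · funext i j
    simp only [toArray, armBumpNew, armRes, Function.update_apply, Prod.mk.injEq]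
    by_cases h1 : i = s ∧ j = c + 1
    · obtain ⟨rfl, rfl⟩ := h1
      simp [hza]
    · by_cases h2 : i = r ∧ j = c
      · obtain ⟨rfl, rfl⟩ := h2
        simp
      · simp [h1, h2]

theorem armBump_step (hT : T.toArray.Valid 1 0) (hA : T.armCells.Nonempty) :
    ∃ s k b, ArmStep 1 0 T.toArray T.armBump.toArray T.armCol T.armEntry s k b ∧
      T.armBump.shape = insert (s, T.armCol + 1) T.shape := by
  have hs := armSel hT hA
  by_cases h : T.armTargets.Nonempty
  · have hk := T.armTargets.min'_mem h
    have hkmin : ∀ x ∈ T.armTargets, T.armTargets.min' h ≤ x :=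
      fun x hx => T.armTargets.min'_le x hx
    obtain ⟨⟨i, hi, hik⟩, hak⟩ := mem_armTargets.1 hk
    have hne : ((T.col (T.armCol + 1)).filter fun p =>
        T.armTargets.min' h ∈ (T.box p).entries).Nonempty :=
      ⟨(i, T.armCol + 1), by simpa [col] using ⟨hi, mem_entries.2 hik⟩⟩
    -- Any row containing `k` would do: `ArmTgt` is verified for it directly, and targets are
    -- unique.
    obtain ⟨⟨s, q⟩, hq, hsup⟩ := Finset.exists_mem_eq_sup _ hne Prod.fst
    simp only [col, Finset.mem_filter] at hq
    obtain ⟨⟨hsh, rfl⟩, hsk⟩ := hq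
    have hb := armBump_eq_old hA h hsup
    generalize T.armTargets.min' h = k at *
    rw [mem_entries] at hsk
    have ht : T.toArray.ArmTgt 1 T.armCol T.armEntry s k true := by
      refine ⟨fun p hp => hT.lower hsh hp.le le_rfl, ?_, fun _ => hsh, fun _ => ?_,
        fun _ => by omega, ?_, by simp, by simp⟩
      · intro p x hp hx
        by_contra hn
        have h1 := hkmin x (mem_armTargets.2 ⟨⟨p, hT.lower hsh hp.le le_rfl, hx⟩, by omega⟩)
        have h2 := hT.col_lt hsh hp hx hsk
        omega
      · rcases hsk with h | h | h
        · exact Or.inl h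
        · exact Or.inr h
        · simp [hs.right s (T.armCol + 1) (by omega)] at h
      · intro _ x hx hax
        exact hkmin x (mem_armTargets.2 ⟨⟨s, hsh, hx⟩, by omega⟩)
    refine ⟨s, k, true, ⟨T.armRow, hs, ht, ?_⟩, ?_⟩
    · rw [hb, toArray_armBumpOld hT hs ht]
    · rw [hb]
      exact (Finset.insert_eq_of_mem hsh).symm
  · have hb := armBump_eq_new hA h
    have hcard := mem_col_iff hT (j := T.armCol + 1)
    generalize (T.col (T.armCol + 1)).card = s at *
    have ht : T.toArray.ArmTgt 1 T.armCol T.armEntry s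
        (T.toArray.hook s (T.armCol + 1)) false := by
      refine ⟨fun p hp => (hcard p).2 hp, ?_, by simp, by simp, by simp, by simp, ?_, fun _ => rfl⟩
      · intro p x hp hx
        by_contra hn
        exact h ⟨x, mem_armTargets.2 ⟨⟨p, (hcard p).2 hp, hx⟩, by omega⟩⟩
      · intro _ hn
        exact lt_irrefl _ ((hcard s).1 hn)
    refine ⟨s, _, false, ⟨T.armRow, hs, ht, ?_⟩, ?_⟩
    · rw [hb, toArray_armBumpNew hT hs ht]
    · rw [hb]
      rfl

/-- The filling after the leg entry `l` in `(r, c)` has bumped `k` in `(r + 1, s)`. -/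
def legBumpOld (T : Filling) (r c l s k : ℕ) : Filling :=
  let b := T.box (r, c)
  let moved := if c = s then b.arms.filter fun a => l ≤ a else 0
  let b' := (T.box (r + 1, s)).replace k l
  { shape := T.shape
    box := Function.update
      (Function.update T.box (r, c) ⟨b.hook, b.legs.erase l, b.arms - moved⟩)
      (r + 1, s) ⟨b'.hook, insert k b'.legs, b'.arms + moved⟩ }

/-- The filling after the leg entry `l` in `(r, c)` has been moved to the new cell `(r + 1, s)`. -/
def legBumpNew (T : Filling) (r c l s : ℕ) : Filling :=
  let b := T.box (r, c)
  let moved := if c = s then b.arms.filter fun a => l ≤ a else 0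
  { shape := insert (r + 1, s) T.shape
    box := Function.update
      (Function.update T.box (r, c) ⟨b.hook, b.legs.erase l, b.arms - moved⟩)
      (r + 1, s) ⟨l, ∅, moved⟩ }

theorem legBump_eq_old (hA : T.legCells.Nonempty) (h : T.legTargets.Nonempty)
    (hs : (((T.row (T.legRow + 1)).filter fun p =>
      T.legTargets.min' h ∈ (T.box p).entries).image Prod.snd).Nonempty) :
    T.legBump = T.legBumpOld T.legRow T.legCol T.legEntry
      ((((T.row (T.legRow + 1)).filter fun p =>
        T.legTargets.min' h ∈ (T.box p).entries).image Prod.snd).min' hs)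
      (T.legTargets.min' h) := by
  unfold legBump legBumpOld
  rw [if_pos hA]
  simp only [h, dif_pos, hs]

theorem legBump_eq_new (hA : T.legCells.Nonempty) (h : ¬ T.legTargets.Nonempty) :
    T.legBump = T.legBumpNew T.legRow T.legCol T.legEntry (T.row (T.legRow + 1)).card := by
  unfold legBump legBumpNew
  rw [if_pos hA]
  simp only [h, dif_neg, not_false_eq_true]

theorem sub_filter_ite (M : Multiset ℕ) (P : Prop) [Decidable P] (l : ℕ) :
    M - (if P then M.filter fun a => l ≤ a else 0) = M.filter fun x => ¬ (P ∧ l < x + 1) := by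
  by_cases h : P
  · simp only [h, if_true, true_and, Nat.lt_succ_iff]
    exact Multiset.sub_filter_eq_filter_not _ _
  · simp [h]

/-- Repetitions are harmless here: row `r + 1` has no legs, so `k` becomes the only leg of its cell,
and arms are multisets on both sides. -/
theorem toArray_legBumpOld {r c l s k : ℕ}
    (hs : T.toArray.transpose.ArmSel c r l)
    (ht : T.toArray.transpose.ArmTgt 0 r l s k true) :
    (T.legBumpOld r c l s k).toArray.transpose =
      T.toArray.transpose.armRes 1 c r l s k true := by
  have hsh : (r + 1, s) ∈ T.shape := ht.old_sh rfl
  have hmem : k = (T.box (r + 1, s)).hook ∨ k ∈ (T.box (r + 1, s)).arms := ht.old_mem rfl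
  have hz : (T.box (r + 1, s)).legs = ∅ := Finset.val_eq_zero.1 (hs.right s (r + 1) (by omega))
  refine HookArray.ext ?_ ?_ ?_ ?_
  · funext j i
    refine propext ⟨Or.inl, ?_⟩
    rintro (h | ⟨rfl, rfl⟩)
    · exact h
    · exact hsh
  · funext j i
    simp only [toArray, transpose, legBumpOld, armRes, Function.update_apply, Prod.mk.injEq,
      Hook.replace]
    grind
  · funext j i
    simp only [toArray, transpose, legBumpOld, armRes, Function.update_apply, Prod.mk.injEq,
      sub_filter_ite]
    by_cases h1 : i = r + 1 ∧ j = s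
    · obtain ⟨rfl, rfl⟩ := h1
      by_cases hk : k = (T.box (r + 1, j)).hook
      · by_cases hr : c = j
        · simp [hk, hr, Hook.replace]
        · simp [hk, hr, Ne.symm hr, Hook.replace]
      · by_cases hr : c = j
        · simp [hk, hr, Hook.replace, hz]
        · simp [hk, hr, Ne.symm hr, Hook.replace, hz]
    · by_cases h2 : i = r ∧ j = c
      · obtain ⟨rfl, rfl⟩ := h2
        simp [eq_comm]
      · simp [h1, h2, and_comm (a := j = c), and_comm (a := j = s)]
  · funext j i
    simp only [toArray, transpose, legBumpOld, armRes, Function.update_apply, Prod.mk.injEq]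
    by_cases h1 : i = r + 1 ∧ j = s
    · obtain ⟨rfl, rfl⟩ := h1
      simp [Hook.replace_legs (show k ∉ (T.box (r + 1, j)).legs by simp [hz]), hz]
    · by_cases h2 : i = r ∧ j = c
      · obtain ⟨rfl, rfl⟩ := h2
        simp
      · simp [h1, h2, and_comm (a := j = c), and_comm (a := j = s)]

theorem toArray_legBumpNew {r c l s k : ℕ} (hT : T.toArray.Valid 1 0)
    (ht : T.toArray.transpose.ArmTgt 0 r l s k false) :
    (T.legBumpNew r c l s).toArray.transpose =
      T.toArray.transpose.armRes 1 c r l s k false := by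
  have hsh : (r + 1, s) ∉ T.shape := ht.new_sh rfl
  have hk : k = (T.box (r + 1, s)).hook := ht.new_eq rfl
  have hza : (T.box (r + 1, s)).arms = 0 := hT.arms_off hsh
  have hz : (T.box (r + 1, s)).legs = ∅ := Finset.val_eq_zero.1 (hT.legs_off hsh)
  refine HookArray.ext ?_ ?_ ?_ ?_
  · funext j i
    simp [toArray, transpose, legBumpNew, armRes, or_comm, and_comm]
  · funext j i
    simp only [toArray, transpose, legBumpNew, armRes, Function.update_apply, Prod.mk.injEq]
    grind
  · funext j i
    simp only [toArray, transpose, legBumpNew, armRes, Function.update_apply, Prod.mk.injEq,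
      sub_filter_ite]
    by_cases h1 : i = r + 1 ∧ j = s
    · obtain ⟨rfl, rfl⟩ := h1
      by_cases hr : c = j
      · simp [hk, hr, hza]
      · simp [hk, hr, Ne.symm hr, hza]
    · by_cases h2 : i = r ∧ j = c
      · obtain ⟨rfl, rfl⟩ := h2
        simp [eq_comm]
      · simp [h1, h2, and_comm (a := j = c), and_comm (a := j = s)]
  · funext j i
    simp only [toArray, transpose, legBumpNew, armRes, Function.update_apply, Prod.mk.injEq]
    by_cases h1 : i = r + 1 ∧ j = s
    · obtain ⟨rfl, rfl⟩ := h1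
      simp [hz]
    · by_cases h2 : i = r ∧ j = c
      · obtain ⟨rfl, rfl⟩ := h2
        simp
      · simp [h1, h2, and_comm (a := j = c), and_comm (a := j = s)]

theorem legBump_step (hT : T.toArray.Valid 1 0) (hA : T.legCells.Nonempty) :
    ∃ s k b, ArmStep 0 1 T.toArray.transpose T.legBump.toArray.transpose
      T.legRow T.legEntry s k b ∧ T.legBump.shape = insert (T.legRow + 1, s) T.shape := by
  have hs := legSel hT hA
  by_cases h : T.legTargets.Nonempty
  · have hk := T.legTargets.min'_mem h
    have hkmin : ∀ x ∈ T.legTargets, T.legTargets.min' h ≤ x :=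
      fun x hx => T.legTargets.min'_le x hx
    obtain ⟨⟨j, hj, hjk⟩, hlk⟩ := mem_legTargets.1 hk
    have hne : (((T.row (T.legRow + 1)).filter fun p =>
        T.legTargets.min' h ∈ (T.box p).entries).image Prod.snd).Nonempty :=
      ⟨j, Finset.mem_image.2 ⟨(T.legRow + 1, j),
        by simpa [row] using ⟨hj, mem_entries.2 hjk⟩, rfl⟩⟩
    have hb := legBump_eq_old hA h hne
    have hs' := Finset.min'_mem _ hne
    have hsmin : ∀ x ∈ _, Finset.min' _ hne ≤ x := fun x hx => Finset.min'_le _ x hx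
    generalize Finset.min' _ hne = s at hb hs' hsmin
    generalize T.legTargets.min' h = k at *
    have hmem : ∀ q, q ∈ ((T.row (T.legRow + 1)).filter fun p =>
        k ∈ (T.box p).entries).image Prod.snd ↔
        (T.legRow + 1, q) ∈ T.shape ∧ T.toArray.Ent (T.legRow + 1) q k := by
      intro q
      simp only [row, Finset.mem_image, Finset.mem_filter, Prod.exists, exists_eq_right,
        ← mem_entries]
      grind
    obtain ⟨hsh, hsk⟩ := (hmem s).1 hs'
    have ht : T.toArray.transpose.ArmTgt 0 T.legRow T.legEntry s k true := by
      refine ⟨fun p hp => hT.lower hsh le_rfl hp.le, ?_, fun _ => hsh, fun _ => ?_,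
        fun _ => by omega, ?_, by simp, by simp⟩
      · intro p x hp hx
        rw [ent_transpose] at hx
        have hps := hT.lower (i' := T.legRow + 1) hsh le_rfl hp.le
        by_contra hn
        have h1 := hkmin x (mem_legTargets.2 ⟨⟨p, hps, hx⟩, by omega⟩)
        have h2 := hT.row_lt hsh hp hx hsk
        -- Rows increase only weakly, so `k` might occur further to the left; the choice of the
        -- leftmost occurrence excludes this.
        obtain rfl : x = k := by omega
        have := hsmin p ((hmem p).2 ⟨hps, hx⟩)
        omega
      · rcases hsk with h | h | h
        · exact Or.inl h
        · have := hs.right s (T.legRow + 1) (by omega)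
          change T.toArray.legs _ _ = 0 at this
          simp [this] at h
        · exact Or.inr h
      · intro _ x hx hax
        exact hkmin x (mem_legTargets.2 ⟨⟨s, hsh, ent_transpose.1 hx⟩, by omega⟩)
    refine ⟨s, k, true, ⟨T.legCol, hs, ht, ?_⟩, ?_⟩
    · rw [hb, toArray_legBumpOld hs ht]
    · rw [hb]
      exact (Finset.insert_eq_of_mem hsh).symm
  · have hb := legBump_eq_new hA h
    have hcard := mem_row_iff hT (T.legRow + 1)
    generalize (T.row (T.legRow + 1)).card = s at *
    have ht : T.toArray.transpose.ArmTgt 0 T.legRow T.legEntry s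
        (T.toArray.hook (T.legRow + 1) s) false := by
      refine ⟨fun p hp => (hcard p).2 hp, ?_, by simp, by simp, by simp, by simp, ?_, fun _ => rfl⟩
      · intro p x hp hx
        by_contra hn
        exact h ⟨x, mem_legTargets.2 ⟨⟨p, (hcard p).2 hp, ent_transpose.1 hx⟩, by omega⟩⟩
      · intro _ hn
        exact lt_irrefl _ ((hcard s).1 hn)
    refine ⟨s, _, false, ⟨T.legCol, hs, ht, ?_⟩, ?_⟩
    · rw [hb, toArray_legBumpNew hT ht]
    · rw [hb]
      rfl

end Filling
end Uncrowding

/-! ### Iterated bumps as runs, and the number of arms and legs -/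

namespace Uncrowding
open HookArray

theorem iterateUntil_eq {X : Type} {f : X → X} {P : X → Prop} {x : X} {n : ℕ} (hn : P (f^[n] x))
    (h : ∀ m < n, ¬ P (f^[m] x)) : iterateUntil f P x = f^[n] x := by
  unfold iterateUntil
  congr 1
  refine le_antisymm (Nat.sInf_le hn) ?_
  by_contra hlt
  exact h _ (not_le.1 hlt) (Nat.sInf_mem (s := {m | P (f^[m] x)}) ⟨n, hn⟩)

theorem iterateUntil_of_pos {X : Type} {f : X → X} {P : X → Prop} {x : X} (h : P x) :
    iterateUntil f P x = x :=
  iterateUntil_eq (n := 0) h (by simp)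

/-- The condition `P y` excludes that `P` never holds from `f x` on: the infimum of the empty set is
`0`, so `iterateUntil` would return its starting point. -/
theorem iterateUntil_of_not {X : Type} {f : X → X} {P : X → Prop} {x y : X} (h : ¬ P x)
    (hy : iterateUntil f P (f x) = y) (hP : P y) : iterateUntil f P x = y := by
  subst hy
  have h0 := hP
  unfold iterateUntil at hP
  set n := sInf {m | P (f^[m] (f x))} with hn
  have : iterateUntil f P x = f^[n + 1] x := by
    refine iterateUntil_eq hP fun m hm => ?_
    rcases m with _ | m
    · exact h
    · exact Nat.notMem_of_lt_sInf (s := {m | P (f^[m] (f x))}) (by omega)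
  rw [this]
  rfl

namespace HookArray

variable {β γ : ℕ} {F F' : HookArray} {c a s k r : ℕ} {b : Bool}

/-- A bump trades the arm `a` for the arm `k`, unless it creates a cell. The additive form avoids
truncated subtraction. -/
theorem card_arms_res (hs : F.ArmSel r c a) (i j : ℕ) :
    ((F.armRes γ r c a s k b).arms i j).card + (if i = r ∧ j = c then 1 else 0) =
      (F.arms i j).card + (if i = s ∧ j = c + 1 then (if b = true then 1 else 0) else 0) := by
  simp only [armRes]
  by_cases h1 : i = r ∧ j = c
  · obtain ⟨rfl, rfl⟩ := h1
    simp [Multiset.card_erase_add_one hs.mem]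
  · by_cases h2 : i = s ∧ j = c + 1
    · obtain ⟨rfl, rfl⟩ := h2
      simp only [h1, and_self, if_true, if_false]
      split_ifs <;> simp [add_comm]
    · simp [h1, h2]

/-- Legs are replaced one for one or moved from the source to the target, so their total is
preserved. -/
theorem card_legs_res (ht : F.ArmTgt β c a s k b) (i j : ℕ) :
    ((F.armRes γ r c a s k b).legs i j).card +
        (if i = r ∧ j = c then ((F.legs r c).filter fun x => s = r ∧ a < x + γ).card else 0) =
      (F.legs i j).card +
        (if i = s ∧ j = c + 1 then ((F.legs r c).filter fun x => s = r ∧ a < x + γ).card else 0)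
      := by
  simp only [armRes]
  by_cases h1 : i = r ∧ j = c
  · obtain ⟨rfl, rfl⟩ := h1
    have := congrArg Multiset.card
      (Multiset.filter_add_not (fun x => s = i ∧ a < x + γ) (F.legs i j))
    rw [Multiset.card_add] at this
    simp only [and_self, if_true]
    rw [if_neg (by omega)]
    omega
  · by_cases h2 : i = s ∧ j = c + 1
    · obtain ⟨rfl, rfl⟩ := h2
      simp only [h1, and_self, if_true, if_false]
      split_ifs with h3
      · simp
      · have hk : k ∈ F.legs i (c + 1) := by
          cases b
          · exact absurd (ht.new_eq rfl) h3
          · exact (ht.old_mem rfl).resolve_left h3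
        simp only [Multiset.card_add, Multiset.card_cons, ← Multiset.card_erase_add_one hk]
        omega
    · simp [h1, h2]

theorem sum_card_arms_res {S : Finset (ℕ × ℕ)} (hs : F.ArmSel r c a) (h₁ : (r, c) ∈ S)
    (h₂ : (s, c + 1) ∈ S) :
    ∑ p ∈ S, ((F.armRes γ r c a s k b).arms p.1 p.2).card + 1 =
      ∑ p ∈ S, (F.arms p.1 p.2).card + (if b = true then 1 else 0) := by
  have h := Finset.sum_congr (rfl : S = S) fun p _ =>
    card_arms_res (γ := γ) (s := s) (k := k) (b := b) hs p.1 p.2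
  simp only [Finset.sum_add_distrib, ← Prod.mk_inj (a₁ := (_ : ℕ × ℕ).1)] at h
  simpa [h₁, h₂] using h

theorem sum_card_legs_res {S : Finset (ℕ × ℕ)} (ht : F.ArmTgt β c a s k b) (h₁ : (r, c) ∈ S)
    (h₂ : (s, c + 1) ∈ S) :
    ∑ p ∈ S, ((F.armRes γ r c a s k b).legs p.1 p.2).card = ∑ p ∈ S, (F.legs p.1 p.2).card := by
  have h := Finset.sum_congr (rfl : S = S) fun p _ =>
    card_legs_res (γ := γ) (r := r) ht p.1 p.2
  simp only [Finset.sum_add_distrib, ← Prod.mk_inj (a₁ := (_ : ℕ × ℕ).1)] at h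
  simpa [h₁, h₂] using h

end HookArray

namespace Filling

variable {T : Filling}

/-- This allows the arms before and after a bump to be counted over the same set of cells. -/
theorem armCount_eq (hT : T.toArray.Valid 1 0) {S : Finset (ℕ × ℕ)} (hS : T.shape ⊆ S) :
    T.armCount = ∑ p ∈ S, (T.toArray.arms p.1 p.2).card :=
  Finset.sum_subset hS fun p _ hp =>
    Multiset.card_eq_zero.2 (hT.arms_off (i := p.1) (j := p.2) hp)

theorem legCount_eq (hT : T.toArray.Valid 1 0) {S : Finset (ℕ × ℕ)} (hS : T.shape ⊆ S) :
    T.legCount = ∑ p ∈ S, (T.toArray.legs p.1 p.2).card :=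
  Finset.sum_subset hS fun p _ hp =>
    Multiset.card_eq_zero.2 (hT.legs_off (i := p.1) (j := p.2) hp)

theorem armCells_nonempty_iff : T.armCells.Nonempty ↔ T.armCount ≠ 0 := by
  simp only [Finset.nonempty_iff_ne_empty, armCells, armCount, ne_eq, Finset.sum_eq_zero_iff,
    Finset.filter_eq_empty_iff, not_not, Multiset.card_eq_zero]

theorem legCells_nonempty_iff : T.legCells.Nonempty ↔ T.legCount ≠ 0 := by
  simp only [Finset.nonempty_iff_ne_empty, legCells, legCount, ne_eq, Finset.sum_eq_zero_iff,
    Finset.filter_eq_empty_iff, not_not, Finset.card_eq_zero]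

theorem armStep_counts {S : Filling} {c a s k : ℕ} {b : Bool} (hT : T.toArray.Valid 1 0)
    (h : ArmStep 1 0 T.toArray S.toArray c a s k b) (hsh : S.shape = insert (s, c + 1) T.shape) :
    S.armCount + 1 = T.armCount + (if b = true then 1 else 0) ∧ S.legCount = T.legCount := by
  have hS := h.valid hT
  obtain ⟨r, hs, ht, he⟩ := h
  have hr : (r, c) ∈ S.shape := by
    rw [hsh]
    exact Finset.mem_insert_of_mem (hT.sh_of_arms hs.mem)
  have hs' : (s, c + 1) ∈ S.shape := by simp [hsh]
  have hsub : T.shape ⊆ S.shape := by simp [hsh]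
  rw [armCount_eq hS subset_rfl, armCount_eq hT hsub, legCount_eq hS subset_rfl,
    legCount_eq hT hsub, he]
  exact ⟨sum_card_arms_res hs hr hs', sum_card_legs_res ht hr hs'⟩

theorem sum_swap (S : Finset (ℕ × ℕ)) (f : ℕ → ℕ → ℕ) :
    ∑ p ∈ S, f p.1 p.2 = ∑ p ∈ S.map (Equiv.prodComm ℕ ℕ).toEmbedding, f p.2 p.1 := by
  simp

theorem legStep_counts {S : Filling} {c a s k : ℕ} {b : Bool} (hT : T.toArray.Valid 1 0)
    (h : ArmStep 0 1 T.toArray.transpose S.toArray.transpose c a s k b)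
    (hsh : S.shape = insert (c + 1, s) T.shape) :
    S.legCount + 1 = T.legCount + (if b = true then 1 else 0) ∧ S.armCount = T.armCount := by
  have hS := (h.valid hT.transpose).transpose
  obtain ⟨r, hs, ht, he⟩ := h
  have hr : (c, r) ∈ S.shape := by
    rw [hsh]
    exact Finset.mem_insert_of_mem (hT.transpose.sh_of_arms hs.mem)
  have hs' : (c + 1, s) ∈ S.shape := by simp [hsh]
  have hsub : T.shape ⊆ S.shape := by simp [hsh]
  have h1 : S.toArray.legs = fun i j => S.toArray.transpose.arms j i := rfl
  have h2 : S.toArray.arms = fun i j => S.toArray.transpose.legs j i := rfl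
  rw [armCount_eq hS subset_rfl, armCount_eq hT hsub, legCount_eq hS subset_rfl,
    legCount_eq hT hsub, h1, h2, he]
  rw [sum_swap S.shape fun i j => ((T.toArray.transpose.armRes 1 r c a s k b).arms j i).card,
    sum_swap S.shape fun i j => ((T.toArray.transpose.armRes 1 r c a s k b).legs j i).card,
    sum_swap S.shape fun i j => (T.toArray.arms i j).card,
    sum_swap S.shape fun i j => (T.toArray.legs i j).card]
  exact ⟨sum_card_arms_res hs (by simpa using hr) (by simpa using hs'),
    sum_card_legs_res ht (by simpa using hr) (by simpa using hs')⟩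

/-- The shape `U` is the one at the start of the uncrowding and stays fixed in the induction. The
travelling arm moves one column to the right in each step and stays left of `B`, so `n` steps
suffice. -/
theorem iterate_armBump_run {U : Finset (ℕ × ℕ)} {B : ℕ} (hB : ∀ p ∈ U, p.2 < B) (n : ℕ)
    (hT : T.toArray.Valid 1 0) (hA : T.armCells.Nonempty) (hU : T.shape = U)
    (hn : B ≤ T.armCol + n) :
    ∃ S p q, iterateUntil armBump (fun S => U ⊂ S.shape) T = S ∧
      Run 1 0 T.toArray S.toArray T.armCol p q ∧ S.shape = insert (p, q) T.shape ∧
      S.armCount + 1 = T.armCount ∧ S.legCount = T.legCount := by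
  have hnP : ¬ U ⊂ T.shape := by simp [hU]
  have hlt : T.armCol < B := by
    have := hB (T.armRow, T.armCol) (hU ▸ hT.sh_of_arms (armSel hT hA).mem)
    exact this
  induction n generalizing T with
  | zero => omega
  | succ n ih =>
    obtain ⟨s, k, b, hstep, hsh⟩ := armBump_step hT hA
    obtain ⟨h1, h2⟩ := armStep_counts hT hstep hsh
    have hv' := hstep.valid hT
    cases b
    · have hnot : (s, T.armCol + 1) ∉ T.shape := by
        obtain ⟨r, hs, ht, -⟩ := hstep
        exact ht.new_sh rfl
      have hP : U ⊂ T.armBump.shape := by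
        rw [hsh, ← hU]
        exact Finset.ssubset_insert hnot
      refine ⟨T.armBump, s, T.armCol + 1, ?_, Run.last ⟨_, _, hstep⟩, hsh, by simpa using h1, h2⟩
      exact iterateUntil_of_not hnP (iterateUntil_of_pos hP) hP
    · have hmem : (s, T.armCol + 1) ∈ T.shape := by
        obtain ⟨r, hs, ht, -⟩ := hstep
        exact ht.old_sh rfl
      have hsh' : T.armBump.shape = T.shape := by rw [hsh, Finset.insert_eq_of_mem hmem]
      have hsel := hstep.sel_of_true
      have h1 : T.armBump.armCount = T.armCount := by simpa using h1
      have hA' : T.armBump.armCells.Nonempty := by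
        rw [armCells_nonempty_iff, h1]
        exact armCells_nonempty_iff.1 hA
      -- The entry just bumped into the next column is the arm that is selected next.
      have hc : T.armCol + 1 = T.armBump.armCol := (hsel.unique hv' (armSel hv' hA')).2.1
      have hlt' : T.armCol + 1 < B := hB _ (hU ▸ hmem)
      obtain ⟨S, p, q, h3, h4, h5, h6, h7⟩ := ih hv' hA' (hsh'.trans hU) (by omega)
        (by simp [hsh', hU]) (by omega)
      rw [hsh'] at h5
      rw [← hc] at h4
      have hr := Run.step ⟨_, _, hstep⟩ h4
      have hP : U ⊂ S.shape := by
        rw [h5, ← hU]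
        exact Finset.ssubset_insert hr.not_sh
      exact ⟨S, p, q, iterateUntil_of_not hnP h3 hP, hr, h5, h6.trans h1, h7.trans h2⟩

theorem iterate_legBump_run {U : Finset (ℕ × ℕ)} {B : ℕ} (hB : ∀ p ∈ U, p.1 < B) (n : ℕ)
    (hT : T.toArray.Valid 1 0) (hA : T.legCells.Nonempty) (hU : T.shape = U)
    (hn : B ≤ T.legRow + n) :
    ∃ S p q, iterateUntil legBump (fun S => U ⊂ S.shape) T = S ∧
      Run 0 1 T.toArray.transpose S.toArray.transpose T.legRow q p ∧
      S.shape = insert (p, q) T.shape ∧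
      S.legCount + 1 = T.legCount ∧ S.armCount = T.armCount := by
  have hnP : ¬ U ⊂ T.shape := by simp [hU]
  have hlt : T.legRow < B := by
    have := hB (T.legRow, T.legCol) (hU ▸ hT.transpose.sh_of_arms (legSel hT hA).mem)
    exact this
  induction n generalizing T with
  | zero => omega
  | succ n ih =>
    obtain ⟨s, k, b, hstep, hsh⟩ := legBump_step hT hA
    obtain ⟨h1, h2⟩ := legStep_counts hT hstep hsh
    have hv' := (hstep.valid hT.transpose).transpose
    cases b
    · have hnot : (T.legRow + 1, s) ∉ T.shape := by
        obtain ⟨r, hs, ht, -⟩ := hstep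
        exact ht.new_sh rfl
      have hP : U ⊂ T.legBump.shape := by
        rw [hsh, ← hU]
        exact Finset.ssubset_insert hnot
      refine ⟨T.legBump, T.legRow + 1, s, ?_, Run.last ⟨_, _, hstep⟩, hsh, by simpa using h1, h2⟩
      exact iterateUntil_of_not hnP (iterateUntil_of_pos hP) hP
    · have hmem : (T.legRow + 1, s) ∈ T.shape := by
        obtain ⟨r, hs, ht, -⟩ := hstep
        exact ht.old_sh rfl
      have hsh' : T.legBump.shape = T.shape := by rw [hsh, Finset.insert_eq_of_mem hmem]
      have hsel := hstep.sel_of_true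
      have h1 : T.legBump.legCount = T.legCount := by simpa using h1
      have hA' : T.legBump.legCells.Nonempty := by
        rw [legCells_nonempty_iff, h1]
        exact legCells_nonempty_iff.1 hA
      have hc : T.legRow + 1 = T.legBump.legRow :=
        (hsel.unique hv'.transpose (legSel hv' hA')).2.1
      have hlt' : T.legRow + 1 < B := hB _ (hU ▸ hmem)
      obtain ⟨S, p, q, h3, h4, h5, h6, h7⟩ := ih hv' hA' (hsh'.trans hU) (by omega)
        (by simp [hsh', hU]) (by omega)
      rw [hsh'] at h5
      rw [← hc] at h4
      have hr := Run.step ⟨_, _, hstep⟩ h4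
      have hP : U ⊂ S.shape := by
        rw [h5, ← hU]
        exact Finset.ssubset_insert hr.not_sh
      exact ⟨S, p, q, iterateUntil_of_not hnP h3 hP, hr, h5, h6.trans h1, h7.trans h2⟩

theorem singleArm_run (hT : T.toArray.Valid 1 0) (hA : T.armCount ≠ 0) :
    ∃ p q, Run 1 0 T.toArray T.singleArm.toArray T.armCol p q ∧
      T.singleArm.shape = insert (p, q) T.shape ∧
      T.singleArm.armCount + 1 = T.armCount ∧ T.singleArm.legCount = T.legCount := by
  have hA := armCells_nonempty_iff.2 hA
  obtain ⟨S, p, q, h, h'⟩ := iterate_armBump_run (U := T.shape) (B := T.shape.sup Prod.snd + 1)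
    (fun p hp => Nat.lt_succ_of_le (Finset.le_sup (f := Prod.snd) hp)) (T.shape.sup Prod.snd + 1)
    hT hA rfl (by omega)
  have : T.singleArm = S := by
    unfold singleArm
    rw [if_pos hA, h]
  exact ⟨p, q, this ▸ h'⟩

theorem singleLeg_run (hT : T.toArray.Valid 1 0) (hA : T.legCount ≠ 0) :
    ∃ p q, Run 0 1 T.toArray.transpose T.singleLeg.toArray.transpose T.legRow q p ∧
      T.singleLeg.shape = insert (p, q) T.shape ∧
      T.singleLeg.legCount + 1 = T.legCount ∧ T.singleLeg.armCount = T.armCount := by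
  have hA := legCells_nonempty_iff.2 hA
  obtain ⟨S, p, q, h, h'⟩ := iterate_legBump_run (U := T.shape) (B := T.shape.sup Prod.fst + 1)
    (fun p hp => Nat.lt_succ_of_le (Finset.le_sup (f := Prod.fst) hp)) (T.shape.sup Prod.fst + 1)
    hT hA rfl (by omega)
  have : T.singleLeg = S := by
    unfold singleLeg
    rw [if_pos hA, h]
  exact ⟨p, q, this ▸ h'⟩

end Filling
end Uncrowding

/-! ### Grids of shapes, and the slide of one `α` through them -/

namespace Uncrowding
open Recording

/-- A grid of growing shapes `shape p q`, where `x p q` is the cell added in the step from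
`(p, q)` to `(p + 1, q)` and `y p q` the cell added in the step from `(p, q)` to `(p, q + 1)`.
The two steps are interchanged by switching adjacent cells. -/
structure SwitchGrid (a l : ℕ) where
  shape : ℕ → ℕ → Finset (ℕ × ℕ)
  x : ℕ → ℕ → ℕ × ℕ
  y : ℕ → ℕ → ℕ × ℕ
  κ : ℕ → ℕ
  ρ : ℕ → ℤ
  lower : ∀ {p q}, p ≤ a → q ≤ l → IsLowerSet (shape p q : Set (ℕ × ℕ))
  x_notMem : ∀ {p q}, p < a → q ≤ l → x p q ∉ shape p q
  y_notMem : ∀ {p q}, p ≤ a → q < l → y p q ∉ shape p q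
  shape_x : ∀ {p q}, p < a → q ≤ l → shape (p + 1) q = insert (x p q) (shape p q)
  shape_y : ∀ {p q}, p ≤ a → q < l → shape p (q + 1) = insert (y p q) (shape p q)
  rule : ∀ {p q}, p < a → q < l →
    (x p (q + 1) = x p q ∧ y (p + 1) q = y p q) ∨
    (x p q = y p q ∧ x p (q + 1) = y (p + 1) q ∧
      (y (p + 1) q = up (x p q) ∨ y (p + 1) q = right (x p q)))
  κ_anti : ∀ {i j}, i ≤ j → j < a → κ j ≤ κ i
  κ_strict : ∀ {i j}, i < j → j < a → κ i = κ j → (x i 0).2 < (x j 0).2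
  ρ_anti : ∀ {i j}, i ≤ j → j < l → ρ j ≤ ρ i
  ρ_strict : ∀ {p i j}, p ≤ a → i < j → j < l → ρ i = ρ j → (y p i).1 < (y p j).1

namespace SwitchGrid

variable {a l : ℕ} (G : SwitchGrid a l)

theorem shape_mono {p q p' q' : ℕ} (hp : p ≤ p') (hq : q ≤ q') (ha : p' ≤ a) (hl : q' ≤ l) :
    G.shape p q ⊆ G.shape p' q' := by
  have h1 : G.shape p q ⊆ G.shape p' q := by
    induction p', hp using Nat.le_induction with
    | base => exact subset_rfl
    | succ n hn ih =>
      rw [G.shape_x (by omega) (by omega)]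
      exact (ih (by omega)).trans (Finset.subset_insert _ _)
  refine h1.trans ?_
  clear h1
  induction q', hq using Nat.le_induction with
  | base => exact subset_rfl
  | succ n hn ih =>
    rw [G.shape_y (by omega) (by omega)]
    exact (ih (by omega)).trans (Finset.subset_insert _ _)

theorem x_mem {p q p' q' : ℕ} (hp : p < p') (hq : q ≤ q') (ha : p' ≤ a) (hl : q' ≤ l) :
    G.x p q ∈ G.shape p' q' := by
  refine G.shape_mono (p := p + 1) hp hq ha hl ?_
  rw [G.shape_x (by omega) (by omega)]
  exact Finset.mem_insert_self _ _

theorem y_mem {p q p' q' : ℕ} (hp : p ≤ p') (hq : q < q') (ha : p' ≤ a) (hl : q' ≤ l) :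
    G.y p q ∈ G.shape p' q' := by
  refine G.shape_mono (q := q + 1) hp hq ha hl ?_
  rw [G.shape_y (by omega) (by omega)]
  exact Finset.mem_insert_self _ _

theorem notMem_of_gt {p q : ℕ} (hp : p < a) (hq : q ≤ l) {z : ℕ × ℕ} (h : G.x p q ≤ z) :
    z ∉ G.shape p q :=
  fun hz => G.x_notMem hp hq (G.lower (by omega) hq h hz)

theorem le_up (z : ℕ × ℕ) : z ≤ up z := ⟨Nat.le_succ _, le_rfl⟩

theorem le_right (z : ℕ × ℕ) : z ≤ right z := ⟨le_rfl, Nat.le_succ _⟩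

/-- The letters after `α`s number `p + 1, …` have been moved past all `β`s, and `α` number `p` has
been moved past the first `q` of them. -/
def Has (p q : ℕ) (z : ℕ × ℕ) (t : Letter) : Prop :=
  (∃ i, i < p ∧ z = G.x i 0 ∧ t = .alpha (G.κ i)) ∨
  (∃ j, j < q ∧ z = G.y p j ∧ t = .beta (G.ρ j)) ∨
  (z = G.x p q ∧ t = .alpha (G.κ p)) ∨
  (∃ j, q ≤ j ∧ j < l ∧ z = G.y (p + 1) j ∧ t = .beta (G.ρ j)) ∨
  (∃ i, p < i ∧ i < a ∧ z = G.x i l ∧ t = .alpha (G.κ i))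

/-- The letters after the `α`s number `p, …` have been moved past all `β`s. -/
def Has' (p : ℕ) (z : ℕ × ℕ) (t : Letter) : Prop :=
  (∃ i, i < p ∧ z = G.x i 0 ∧ t = .alpha (G.κ i)) ∨
  (∃ j, j < l ∧ z = G.y p j ∧ t = .beta (G.ρ j)) ∨
  (∃ i, p ≤ i ∧ i < a ∧ z = G.x i l ∧ t = .alpha (G.κ i))

theorem has_zero (p : ℕ) (z : ℕ × ℕ) (t : Letter) :
    G.Has p 0 z t ↔ G.Has' (p + 1) z t := by
  unfold Has Has'
  constructor
  · rintro (⟨i, hi, h⟩ | ⟨j, hj, h⟩ | h | ⟨j, -, h⟩ | h)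
    · exact Or.inl ⟨i, by omega, h⟩
    · omega
    · exact Or.inl ⟨p, by omega, h⟩
    · exact Or.inr (Or.inl ⟨j, h⟩)
    · exact Or.inr (Or.inr h)
  · rintro (⟨i, hi, h⟩ | ⟨j, h⟩ | h)
    · rcases Nat.lt_or_ge i p with h' | h'
      · exact Or.inl ⟨i, h', h⟩
      · obtain rfl : i = p := by omega
        exact Or.inr (Or.inr (Or.inl h))
    · exact Or.inr (Or.inr (Or.inr (Or.inl ⟨j, by omega, h⟩)))
    · exact Or.inr (Or.inr (Or.inr (Or.inr h)))

theorem has_last {p : ℕ} (hp : p < a) (z : ℕ × ℕ) (t : Letter) :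
    G.Has p l z t ↔ G.Has' p z t := by
  unfold Has Has'
  constructor
  · rintro (h | h | h | ⟨j, h, h', -⟩ | ⟨i, hi, h⟩)
    · exact Or.inl h
    · exact Or.inr (Or.inl h)
    · exact Or.inr (Or.inr ⟨p, le_rfl, hp, h⟩)
    · omega
    · exact Or.inr (Or.inr ⟨i, by omega, h⟩)
  · rintro (h | h | ⟨i, hi, hi', h⟩)
    · exact Or.inl h
    · exact Or.inr (Or.inl h)
    · rcases Nat.lt_or_ge p i with h' | h'
      · exact Or.inr (Or.inr (Or.inr (Or.inr ⟨i, h', hi', h⟩)))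
      · obtain rfl : i = p := by omega
        exact Or.inr (Or.inr (Or.inl h))

/-- `Q` is a recording on the grid with the given letters. -/
structure Records (E : ℕ × ℕ → Letter → Prop) (Q : Recording) : Prop where
  inner : Q.inner = G.shape 0 0
  outer : Q.outer = G.shape a l
  entry : ∀ z t, Q.entry z = some t ↔ E z t

variable {G}

theorem Records.unique {E : ℕ × ℕ → Letter → Prop} {Q Q' : Recording} (h : G.Records E Q)
    (h' : G.Records E Q') : Q = Q' := by
  refine Recording.ext (h.inner.trans h'.inner.symm) (h.outer.trans h'.outer.symm) ?_
  funext z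
  refine Option.ext fun t => ?_
  rw [h.entry, h'.entry]

theorem Records.congr {E E' : ℕ × ℕ → Letter → Prop} {Q : Recording} (h : G.Records E Q)
    (hE : ∀ z t, E z t ↔ E' z t) : G.Records E' Q :=
  ⟨h.inner, h.outer, fun z t => (h.entry z t).trans (hE z t)⟩

theorem betaAt_eq_some {Q : Recording} {z : ℕ × ℕ} {k : ℤ} :
    Q.betaAt z = some k ↔ Q.entry z = some (.beta k) := by
  unfold Recording.betaAt
  split <;> simp_all

theorem alphaAt_eq_some {Q : Recording} {z : ℕ × ℕ} {k : ℕ} :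
    Q.alphaAt z = some k ↔ Q.entry z = some (.alpha k) := by
  unfold Recording.alphaAt
  split <;> simp_all

variable {p q : ℕ} {Q : Recording}

/-- The only `β`s next to the moving `α` are those it has not met. -/
theorem has_beta_of_gt (hp : p < a) (hq : q ≤ l) {z : ℕ × ℕ} {k : ℤ} (hz : G.x p q ≤ z)
    (h : G.Has p q z (.beta k)) :
    ∃ j, q ≤ j ∧ j < l ∧ z = G.y (p + 1) j ∧ k = G.ρ j := by
  rcases h with ⟨i, _, _, h⟩ | ⟨j, hj, rfl, h⟩ | ⟨_, h⟩ | ⟨j, h1, h2, h3, h4⟩ | ⟨i, _, _, _, h⟩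
  · cases h
  · exact absurd (G.y_mem le_rfl hj (by omega) hq) (G.notMem_of_gt hp hq hz)
  · cases h
  · exact ⟨j, h1, h2, h3, by cases h4; rfl⟩
  · cases h

/-- A square without interaction moves no letter; only the bookkeeping of which `β`s have been
passed changes. -/
theorem has_succ_of_eq (hq : q < l) (h₁ : G.x p (q + 1) = G.x p q)
    (h₂ : G.y (p + 1) q = G.y p q) (z : ℕ × ℕ) (t : Letter) :
    G.Has p q z t ↔ G.Has p (q + 1) z t := by
  unfold Has
  rw [h₁]
  refine or_congr Iff.rfl ?_
  constructor
  · rintro (⟨j, hj, h⟩ | h | ⟨j, hj, hj', h⟩ | h)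
    · exact Or.inl ⟨j, by omega, h⟩
    · exact Or.inr (Or.inl h)
    · rcases Nat.lt_or_ge q j with h' | h'
      · exact Or.inr (Or.inr (Or.inl ⟨j, h', hj', h⟩))
      · obtain rfl : j = q := by omega
        exact Or.inl ⟨j, by omega, h₂ ▸ h⟩
    · exact Or.inr (Or.inr (Or.inr h))
  · rintro (⟨j, hj, h⟩ | h | ⟨j, hj, hj', h⟩ | h)
    · rcases Nat.lt_or_ge j q with h' | h'
      · exact Or.inl ⟨j, h', h⟩
      · obtain rfl : j = q := by omega
        exact Or.inr (Or.inr (Or.inl ⟨j, le_rfl, hq, h₂.symm ▸ h⟩))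
    · exact Or.inr (Or.inl h)
    · exact Or.inr (Or.inr (Or.inl ⟨j, by omega, hj', h⟩))
    · exact Or.inr (Or.inr (Or.inr h))

/-- The two switched cells are the difference between `shape p q` and `shape (p + 1) (q + 1)`. Every
other letter lies in the smaller shape or outside the larger one and is not affected. -/
theorem has_succ_of_switch (hp : p < a) (hq : q < l) (h₁ : G.x p q = G.y p q)
    (h₂ : G.x p (q + 1) = G.y (p + 1) q) (z : ℕ × ℕ) (t : Letter) :
    G.Has p q (Equiv.swap (G.x p q) (G.y (p + 1) q) z) t ↔ G.Has p (q + 1) z t := by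
  have hu : ∀ w, w ∈ G.shape p q → Equiv.swap (G.x p q) (G.y (p + 1) q) w = w := by
    intro w hw
    refine Equiv.swap_apply_of_ne_of_ne ?_ ?_
    · rintro rfl
      exact G.x_notMem hp hq.le hw
    · rintro rfl
      exact G.y_notMem hp hq (G.shape_mono (Nat.le_succ p) le_rfl hp hq.le hw)
  have hv : ∀ w, w ∉ G.shape (p + 1) (q + 1) →
      Equiv.swap (G.x p q) (G.y (p + 1) q) w = w := by
    intro w hw
    refine Equiv.swap_apply_of_ne_of_ne ?_ ?_
    · rintro rfl
      exact hw (G.x_mem (Nat.lt_succ_self p) (Nat.le_succ q) hp hq)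
    · rintro rfl
      exact hw (G.y_mem le_rfl (Nat.lt_succ_self q) hp hq)
  have hC1 : ∀ i, i < p → Equiv.swap (G.x p q) (G.y (p + 1) q) (G.x i 0) = G.x i 0 :=
    fun i hi => hu _ (G.x_mem hi (by omega) hp.le hq.le)
  have hC2 : ∀ j, j < q → Equiv.swap (G.x p q) (G.y (p + 1) q) (G.y p j) = G.y p j :=
    fun j hj => hu _ (G.y_mem le_rfl hj hp.le hq.le)
  have hC4 : ∀ j, q < j → j < l →
      Equiv.swap (G.x p q) (G.y (p + 1) q) (G.y (p + 1) j) = G.y (p + 1) j :=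
    fun j hj hj' => hv _ fun h => G.y_notMem hp hj' (G.shape_mono le_rfl hj hp hj'.le h)
  have hC5 : ∀ i, p < i → i < a →
      Equiv.swap (G.x p q) (G.y (p + 1) q) (G.x i l) = G.x i l :=
    fun i hi hi' => hv _ fun h => G.x_notMem hi' le_rfl (G.shape_mono hi hq hi'.le le_rfl h)
  have hsw : ∀ w, Equiv.swap (G.x p q) (G.y (p + 1) q) z = w ↔
      z = Equiv.swap (G.x p q) (G.y (p + 1) q) w := by
    intro w
    constructor
    · rintro rfl
      simp
    · rintro rfl
      simp
  unfold Has
  simp only [hsw]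
  constructor
  · rintro (⟨i, hi, h, h'⟩ | ⟨j, hj, h, h'⟩ | ⟨h, h'⟩ | ⟨j, hj, hj', h, h'⟩ | ⟨i, hi, hi', h, h'⟩)
    · rw [hC1 i hi] at h
      exact Or.inl ⟨i, hi, h, h'⟩
    · rw [hC2 j hj] at h
      exact Or.inr (Or.inl ⟨j, by omega, h, h'⟩)
    · rw [Equiv.swap_apply_left] at h
      exact Or.inr (Or.inr (Or.inl ⟨h.trans h₂.symm, h'⟩))
    · rcases Nat.lt_or_ge q j with h3 | h3
      · rw [hC4 j h3 hj'] at h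
        exact Or.inr (Or.inr (Or.inr (Or.inl ⟨j, h3, hj', h, h'⟩)))
      · obtain rfl : j = q := by omega
        rw [Equiv.swap_apply_right] at h
        exact Or.inr (Or.inl ⟨j, by omega, h.trans h₁, h'⟩)
    · rw [hC5 i hi hi'] at h
      exact Or.inr (Or.inr (Or.inr (Or.inr ⟨i, hi, hi', h, h'⟩)))
  · rintro (⟨i, hi, h, h'⟩ | ⟨j, hj, h, h'⟩ | ⟨h, h'⟩ | ⟨j, hj, hj', h, h'⟩ | ⟨i, hi, hi', h, h'⟩)
    · exact Or.inl ⟨i, hi, (hC1 i hi).symm ▸ h, h'⟩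
    · rcases Nat.lt_or_ge j q with h3 | h3
      · exact Or.inr (Or.inl ⟨j, h3, (hC2 j h3).symm ▸ h, h'⟩)
      · obtain rfl : j = q := by omega
        refine Or.inr (Or.inr (Or.inr (Or.inl ⟨j, le_rfl, hq, ?_, h'⟩)))
        rw [Equiv.swap_apply_right, h, h₁]
    · refine Or.inr (Or.inr (Or.inl ⟨?_, h'⟩))
      rw [Equiv.swap_apply_left, h, h₂]
    · exact Or.inr (Or.inr (Or.inr (Or.inl ⟨j, by omega, hj', (hC4 j hj hj').symm ▸ h, h'⟩)))
    · exact Or.inr (Or.inr (Or.inr (Or.inr ⟨i, hi, hi', (hC5 i hi hi').symm ▸ h, h'⟩)))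

/-- Any competing `β` was added after number `q`, so its index is at most `ρ q`, with equality only
in a strictly higher row. The tie rule of the slide therefore agrees with the grid: a competitor on
the right has a strictly smaller index than the `β` above, and a competitor above has at most the
index of the `β` on the right. -/
theorem slideStep_eq (hp : p < a) (hq : q < l) (hQ : G.Records (G.Has p q) Q)
    (h : G.y (p + 1) q = up (G.x p q) ∨ G.y (p + 1) q = right (G.x p q)) :
    slideStep (Q, G.x p q) = (Q.switch (G.x p q) (G.y (p + 1) q), G.y (p + 1) q) ∧
      ¬ Q.Settled (G.x p q) := by
  have hv : Q.betaAt (G.y (p + 1) q) = some (G.ρ q) := by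
    rw [betaAt_eq_some, hQ.entry]
    exact Or.inr (Or.inr (Or.inr (Or.inl ⟨q, le_rfl, hq, rfl, rfl⟩)))
  have hother : ∀ z k, G.x p q ≤ z → z ≠ G.y (p + 1) q → Q.betaAt z = some k →
      k ≤ G.ρ q ∧ (k = G.ρ q → (G.y (p + 1) q).1 < z.1) := by
    intro z k hz hne hk
    rw [betaAt_eq_some, hQ.entry] at hk
    obtain ⟨j, hj, hj', rfl, rfl⟩ := has_beta_of_gt hp hq.le hz hk
    have hlt : q < j := lt_of_le_of_ne hj (by rintro rfl; exact hne rfl)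
    exact ⟨G.ρ_anti hlt.le hj', fun h => G.ρ_strict hp hlt hj' h.symm⟩
  have hur : up (G.x p q) ≠ right (G.x p q) := fun h => by
    have := congrArg Prod.fst h
    simp [up, right] at this
  unfold slideStep Settled
  rcases h with h | h
  · rw [h] at hv hother ⊢
    simp only [hv]
    refine ⟨?_, by simp⟩
    cases hr : Q.betaAt (right (G.x p q)) with
    | none => rfl
    | some k =>
      obtain ⟨h1, h2⟩ := hother _ k (le_right _) hur.symm hr
      have : k < G.ρ q := by
        refine lt_of_le_of_ne h1 fun h => ?_
        have := h2 h
        simp [up, right] at this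
      simp [this]
  · rw [h] at hv hother ⊢
    simp only [hv]
    refine ⟨?_, by simp⟩
    cases hr : Q.betaAt (up (G.x p q)) with
    | none => rfl
    | some k =>
      obtain ⟨h1, -⟩ := hother _ k (le_up _) hur hr
      simp [not_lt.2 h1]

/-- Induction on the number of `β`s still to be passed. Squares without interaction take no step of
the slide, and after the last `β` none is left above or to the right. -/
theorem slide_eq (hp : p < a) (hq : q ≤ l) (hQ : G.Records (G.Has p q) Q) :
    ∃ R, G.Records (G.Has p l) R ∧ R.Settled (G.x p l) ∧
      iterateUntil slideStep (fun s => s.1.Settled s.2) (Q, G.x p q) = (R, G.x p l) := by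
  obtain ⟨n, hn⟩ : ∃ n, q + n = l := ⟨l - q, by omega⟩
  induction n generalizing q Q with
  | zero =>
    obtain rfl : q = l := by omega
    have hs : Q.Settled (G.x p q) := by
      have hz : ∀ z, G.x p q ≤ z → Q.betaAt z = none := by
        intro z hz
        rw [Option.eq_none_iff_forall_ne_some]
        intro k hk
        rw [betaAt_eq_some, hQ.entry] at hk
        obtain ⟨j, h1, h2, -⟩ := has_beta_of_gt hp hq hz hk
        omega
      exact ⟨hz _ (le_up _), hz _ (le_right _)⟩
    exact ⟨Q, hQ, hs, iterateUntil_of_pos hs⟩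
  | succ n ih =>
    have hq' : q < l := by omega
    rcases G.rule hp hq' with ⟨h1, h2⟩ | ⟨h1, h2, h3⟩
    · obtain ⟨R, hR, hs, hi⟩ := ih (Q := Q) hq' (hQ.congr (has_succ_of_eq hq' h1 h2)) (by omega)
      rw [h1] at hi
      exact ⟨R, hR, hs, hi⟩
    · obtain ⟨h4, h5⟩ := slideStep_eq hp hq' hQ h3
      have hsw : G.Records (G.Has p (q + 1)) (Q.switch (G.x p q) (G.y (p + 1) q)) := by
        refine ⟨hQ.inner, hQ.outer, fun z t => ?_⟩
        rw [← has_succ_of_switch hp hq' h1 h2]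
        exact hQ.entry _ _
      obtain ⟨R, hR, hs, hi⟩ := ih hq' hsw (by omega)
      rw [h2, ← h4] at hi
      exact ⟨R, hR, hs, iterateUntil_of_not h5 hi hs⟩

end SwitchGrid
end Uncrowding

/-! ### The shuffle as a passage across the grid -/

namespace Uncrowding
open Recording
namespace SwitchGrid

variable {a l : ℕ} {G : SwitchGrid a l} {p : ℕ} {Q : Recording}

theorem mem_movable_iff {z : ℕ × ℕ} : z ∈ Q.movable ↔ z ∈ Q.outer ∧ (∃ k, Q.alphaAt z = some k) ∧
    ¬ Q.Settled z := by
  unfold Recording.movable Recording.Settled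
  rw [Finset.mem_filter, Option.isSome_iff_exists, Option.isSome_iff_ne_none,
    Option.isSome_iff_ne_none]
  tauto

/-- An `α` with `p ≤ i` has passed every `β`: all of them lie in `shape i l`, a lower set that
misses the cell of this `α`. -/
theorem exists_of_mem_movable (hQ : G.Records (G.Has' p) Q) {z : ℕ × ℕ}
    (hz : z ∈ Q.movable) : ∃ i < p, z = G.x i 0 ∧ Q.alphaAt z = some (G.κ i) := by
  obtain ⟨-, ⟨k, hk⟩, hs⟩ := mem_movable_iff.1 hz
  have hk' := hk
  rw [alphaAt_eq_some, hQ.entry] at hk'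
  rcases hk' with ⟨i, hi, h, h'⟩ | ⟨j, _, _, h⟩ | ⟨i, hi, hia, rfl, -⟩
  · cases h'
    exact ⟨i, hi, h, hk⟩
  · cases h
  · exfalso
    have hw : ∀ w, G.x i l ≤ w → Q.betaAt w = none := by
      intro w hw
      rw [Option.eq_none_iff_forall_ne_some]
      intro m hm
      rw [betaAt_eq_some, hQ.entry] at hm
      rcases hm with ⟨_, _, _, h⟩ | ⟨j, hj, rfl, -⟩ | ⟨_, _, _, _, h⟩
      · cases h
      · exact G.notMem_of_gt hia le_rfl hw (G.y_mem hi hj hia.le le_rfl)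
      · cases h
    exact hs ⟨hw _ (le_up _), hw _ (le_right _)⟩

/-- The indices `κ` decrease weakly, so `α` number `p` has the smallest index among those that can
move. Among equal indices it is the rightmost, by `κ_strict`. -/
theorem shuffleRound_eq (hp : p < a) (hQ : G.Records (G.Has' (p + 1)) Q)
    (hs : ¬ Q.Settled (G.x p 0)) : Q.movable ≠ ∅ ∧ Q.shuffleRound = Q.slide (G.x p 0) := by
  have hα : Q.alphaAt (G.x p 0) = some (G.κ p) := by
    rw [alphaAt_eq_some, hQ.entry]
    exact Or.inl ⟨p, by omega, rfl, rfl⟩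
  have hm : G.x p 0 ∈ Q.movable := by
    refine mem_movable_iff.2 ⟨?_, ⟨_, hα⟩, hs⟩
    rw [hQ.outer]
    exact G.x_mem hp (Nat.zero_le _) le_rfl le_rfl
  have hmi : G.κ p ∈ Q.movableIndices := Finset.mem_image.2 ⟨_, hm, by rw [hα]; rfl⟩
  refine ⟨Finset.ne_empty_of_mem hm, ?_⟩
  have hne : Q.movableIndices.Nonempty := ⟨_, hmi⟩
  have hmin : Q.movableIndices.min' hne = G.κ p := by
    refine le_antisymm (Finset.min'_le _ _ hmi) (Finset.le_min' _ _ _ fun k hk => ?_)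
    obtain ⟨z, hz, rfl⟩ := Finset.mem_image.1 hk
    obtain ⟨i, hi, -, h⟩ := exists_of_mem_movable hQ hz
    rw [h]
    exact G.κ_anti (by omega) hp
  unfold Recording.shuffleRound
  rw [dif_pos hne]
  simp only [hmin]
  set s := Q.movable.filter fun z => Q.alphaAt z = some (G.κ p) with hsdef
  have hxs : G.x p 0 ∈ s := Finset.mem_filter.2 ⟨hm, hα⟩
  have hall : ∀ z ∈ s, z = G.x p 0 ∨ z.2 < (G.x p 0).2 := by
    intro z hz
    obtain ⟨hz, hz'⟩ := Finset.mem_filter.1 hz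
    obtain ⟨i, hi, rfl, h⟩ := exists_of_mem_movable hQ hz
    rcases Nat.lt_or_ge i p with h' | h'
    · exact Or.inr (G.κ_strict h' hp (Option.some.inj (h.symm.trans hz')))
    · obtain rfl : i = p := by omega
      exact Or.inl rfl
  have hc : s.sup Prod.snd = (G.x p 0).2 := by
    refine le_antisymm (Finset.sup_le fun z hz => ?_) (Finset.le_sup (f := Prod.snd) hxs)
    rcases hall z hz with rfl | h
    · exact le_rfl
    · exact h.le
  have hf : s.filter (fun z => z.2 = (G.x p 0).2) = {G.x p 0} := by
    ext z
    rw [Finset.mem_filter, Finset.mem_singleton]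
    constructor
    · rintro ⟨hz, h⟩
      exact (hall z hz).resolve_right (by omega)
    · rintro rfl
      exact ⟨hxs, rfl⟩
  rw [hc, hf, Finset.sup_singleton]

/-- The slide of `α` number `p` turns `Has' (p + 1)` into `Has' p`. If this `α` is settled already,
the shuffle spends no round on it, and the description changes without any switch. -/
theorem Records.shuff (hp : p ≤ a) (hQ : G.Records (G.Has' p) Q) :
    G.Records (G.Has' 0) Q.shuff ∧ Q.shuff.movable = ∅ := by
  induction p generalizing Q with
  | zero =>
    have hm : Q.movable = ∅ := by
      rw [Finset.eq_empty_iff_forall_notMem]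
      intro z hz
      obtain ⟨i, hi, -⟩ := exists_of_mem_movable hQ hz
      omega
    have : Q.shuff = Q := iterateUntil_of_pos hm
    rw [this]
    exact ⟨hQ, hm⟩
  | succ p ih =>
    obtain ⟨R, hR, -, hi⟩ := slide_eq (q := 0) hp (Nat.zero_le _)
      (hQ.congr fun z t => (G.has_zero p z t).symm)
    obtain ⟨h1, h2⟩ := ih (by omega) (hR.congr (G.has_last hp))
    suffices h : Q.shuff = R.shuff by
      rw [h]
      exact ⟨h1, h2⟩
    by_cases hs : Q.Settled (G.x p 0)
    · rw [iterateUntil_of_pos (P := fun s : Recording × (ℕ × ℕ) => s.1.Settled s.2) hs] at hi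
      rw [(Prod.mk.inj hi).1]
    · obtain ⟨h3, h4⟩ := shuffleRound_eq hp hQ hs
      refine iterateUntil_of_not h3 ?_ h2
      rw [h4, Recording.slide, hi]
      rfl

/-- The intermediate partition is `shape a 0`. Since the shapes are lower sets, a cell added later
is never weakly southwest of an earlier one, so the conditions along southwest pairs reduce to
monotonicity in time. -/
theorem Records.isShufflable (hQ : G.Records (G.Has' a) Q)
    (hκ : ∀ i < a, 0 < G.κ i ∧ G.κ i < (G.x i 0).2 + 1)
    (hρ : ∀ j < l, 0 < G.ρ j ∧ G.ρ j < ((G.y a j).1 : ℤ) + 1) : Q.IsShufflable := by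
  have hα : ∀ z k, Q.entry z = some (.alpha k) ↔ ∃ i < a, z = G.x i 0 ∧ k = G.κ i := by
    intro z k
    rw [hQ.entry]
    constructor
    · rintro (⟨i, hi, h, h'⟩ | ⟨_, _, _, h⟩ | ⟨i, h, h', -⟩)
      · cases h'
        exact ⟨i, hi, h, rfl⟩
      · cases h
      · omega
    · rintro ⟨i, hi, h, rfl⟩
      exact Or.inl ⟨i, hi, h, rfl⟩
  have hβ : ∀ z k, Q.entry z = some (.beta k) ↔ ∃ j < l, z = G.y a j ∧ k = G.ρ j := by
    intro z k
    rw [hQ.entry]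
    constructor
    · rintro (⟨_, _, _, h⟩ | ⟨j, hj, h, h'⟩ | ⟨i, h, h', -⟩)
      · cases h
      · cases h'
        exact ⟨j, hj, h, rfl⟩
      · omega
    · rintro ⟨j, hj, h, rfl⟩
      exact Or.inr (Or.inl ⟨j, hj, h, rfl⟩)
  have hα' : ∀ z, (∃ k, Q.entry z = some (.alpha k)) ↔
      z ∈ G.shape a 0 ∧ z ∉ G.shape 0 0 := by
    have key : ∀ n ≤ a, ∀ z, (∃ i < n, z = G.x i 0) ↔ z ∈ G.shape n 0 ∧ z ∉ G.shape 0 0 := by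
      intro n hn z
      induction n with
      | zero => simp
      | succ n ih =>
        rw [G.shape_x hn (Nat.zero_le _), Finset.mem_insert, or_and_right, ← ih (by omega)]
        constructor
        · rintro ⟨i, hi, rfl⟩
          rcases Nat.lt_or_ge i n with h | h
          · exact Or.inr ⟨i, h, rfl⟩
          · obtain rfl : i = n := by omega
            exact Or.inl ⟨rfl, fun h => G.x_notMem hn (Nat.zero_le _)
              (G.shape_mono (Nat.zero_le _) le_rfl (by omega) (Nat.zero_le _) h)⟩
        · rintro (⟨rfl, -⟩ | ⟨i, hi, rfl⟩)
          · exact ⟨n, by omega, rfl⟩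
          · exact ⟨i, by omega, rfl⟩
    intro z
    rw [← key a le_rfl]
    simp only [hα]
    constructor
    · rintro ⟨_, i, hi, h, -⟩
      exact ⟨i, hi, h⟩
    · rintro ⟨i, hi, h⟩
      exact ⟨_, i, hi, h, rfl⟩
  have hβ' : ∀ z, (∃ k, Q.entry z = some (.beta k)) ↔
      z ∈ G.shape a l ∧ z ∉ G.shape a 0 := by
    have key : ∀ n ≤ l, ∀ z, (∃ j < n, z = G.y a j) ↔ z ∈ G.shape a n ∧ z ∉ G.shape a 0 := by
      intro n hn z
      induction n with
      | zero => simp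
      | succ n ih =>
        rw [G.shape_y le_rfl hn, Finset.mem_insert, or_and_right, ← ih (by omega)]
        constructor
        · rintro ⟨i, hi, rfl⟩
          rcases Nat.lt_or_ge i n with h | h
          · exact Or.inr ⟨i, h, rfl⟩
          · obtain rfl : i = n := by omega
            exact Or.inl ⟨rfl, fun h => G.y_notMem le_rfl hn
              (G.shape_mono le_rfl (Nat.zero_le _) le_rfl (by omega) h)⟩
        · rintro (⟨rfl, -⟩ | ⟨i, hi, rfl⟩)
          · exact ⟨n, by omega, rfl⟩
          · exact ⟨i, by omega, rfl⟩
    intro z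
    rw [← key l le_rfl]
    simp only [hβ]
    constructor
    · rintro ⟨_, i, hi, h, -⟩
      exact ⟨i, hi, h⟩
    · rintro ⟨i, hi, h⟩
      exact ⟨_, i, hi, h, rfl⟩
  have hsub₁ : G.shape 0 0 ⊆ G.shape a 0 :=
    G.shape_mono (Nat.zero_le _) le_rfl le_rfl (Nat.zero_le _)
  have hsub₂ : G.shape a 0 ⊆ G.shape a l := G.shape_mono le_rfl (Nat.zero_le _) le_rfl le_rfl
  constructor
  · refine ⟨⟨?_, ?_, ?_, ?_, ?_⟩, ?_, ?_⟩
    · rw [hQ.inner]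
      exact G.lower (Nat.zero_le _) (Nat.zero_le _)
    · rw [hQ.outer]
      exact G.lower le_rfl le_rfl
    · rw [hQ.inner, hQ.outer]
      exact hsub₁.trans hsub₂
    · intro z
      have : (Q.entry z).isSome ↔ (∃ k, Q.entry z = some (.alpha k)) ∨
          ∃ k, Q.entry z = some (.beta k) := by
        rw [Option.isSome_iff_exists]
        constructor
        · rintro ⟨k | k, h⟩
          · exact Or.inl ⟨k, h⟩
          · exact Or.inr ⟨k, h⟩
        · rintro (⟨k, h⟩ | ⟨k, h⟩)
          · exact ⟨_, h⟩
          · exact ⟨_, h⟩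
      rw [this, hα', hβ', hQ.outer, hQ.inner]
      have h1 := @hsub₁ z
      have h2 := @hsub₂ z
      tauto
    · intro z k h
      obtain ⟨i, hi, rfl, rfl⟩ := (hα z k).1 h
      exact (hκ i hi).1
    · intro i j k h
      obtain ⟨n, hn, h1, rfl⟩ := (hα _ k).1 h
      have := hκ n hn
      rwa [← h1] at this
    · intro i j k h
      obtain ⟨n, hn, h1, rfl⟩ := (hβ _ k).1 h
      have := hρ n hn
      rwa [← h1] at this
  · intro z w k m hz hw
    obtain ⟨i, hi, rfl, rfl⟩ := (hα _ _).1 hz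
    obtain ⟨j, hj, rfl, rfl⟩ := (hα _ _).1 hw
    constructor
    · intro h
      rcases Nat.lt_or_ge j i with h' | h'
      · exact absurd (G.x_mem h' le_rfl hi.le (Nat.zero_le _))
          (G.notMem_of_gt hi (Nat.zero_le _) h)
      · exact G.κ_anti h' hj
    · intro hne hc hk
      rcases lt_trichotomy i j with h | rfl | h
      · have := G.κ_strict h hj hk
        omega
      · exact hne rfl
      · have := G.κ_strict h hi hk.symm
        omega
  · intro z w k m hz hw
    obtain ⟨i, hi, rfl, rfl⟩ := (hβ _ _).1 hz
    obtain ⟨j, hj, rfl, rfl⟩ := (hβ _ _).1 hw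
    constructor
    · intro h
      rcases Nat.lt_or_ge j i with h' | h'
      · exact absurd (G.lower le_rfl hi.le h (G.y_mem le_rfl h' le_rfl hi.le))
          (G.y_notMem le_rfl hi)
      · exact G.ρ_anti h' hj
    · intro hne hc hk
      rcases lt_trichotomy i j with h | rfl | h
      · have := G.ρ_strict le_rfl h hj hk
        omega
      · exact hne rfl
      · have := G.ρ_strict le_rfl h hi hk.symm
        omega
  · refine ⟨⟨G.shape a 0, G.lower le_rfl (Nat.zero_le _)⟩, ?_, ?_, ?_, ?_⟩
    · rw [hQ.inner]
      exact hsub₁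
    · rw [hQ.outer]
      exact hsub₂
    · rw [hQ.inner]
      exact hα'
    · rw [hQ.outer]
      exact hβ'

end SwitchGrid
end Uncrowding

/-! ### The grid of all partial uncrowdings -/

namespace Uncrowding
open HookArray

namespace Filling

variable {T : Filling}

/-- The cell added by `singleArm`. -/
noncomputable def armCell (T : Filling) : ℕ × ℕ := (T.singleArm.shape \ T.shape).sup id

/-- The cell added by `singleLeg`. -/
noncomputable def legCell (T : Filling) : ℕ × ℕ := (T.singleLeg.shape \ T.shape).sup id

theorem armCell_spec (hT : T.toArray.Valid 1 0) (hA : T.armCount ≠ 0) :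
    Run 1 0 T.toArray T.singleArm.toArray T.armCol T.armCell.1 T.armCell.2 ∧
      T.singleArm.shape = insert T.armCell T.shape ∧ T.armCell ∉ T.shape ∧
      T.singleArm.armCount + 1 = T.armCount ∧ T.singleArm.legCount = T.legCount := by
  obtain ⟨p, q, h1, h2, h3⟩ := singleArm_run hT hA
  have hn : (p, q) ∉ T.shape := h1.not_sh
  have : T.armCell = (p, q) := by
    unfold armCell
    rw [h2, Finset.insert_sdiff_of_notMem _ hn, sdiff_self]
    exact Finset.sup_singleton
  rw [this]
  exact ⟨h1, h2, hn, h3⟩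

theorem legCell_spec (hT : T.toArray.Valid 1 0) (hL : T.legCount ≠ 0) :
    Run 0 1 T.toArray.transpose T.singleLeg.toArray.transpose T.legRow T.legCell.2 T.legCell.1 ∧
      T.singleLeg.shape = insert T.legCell T.shape ∧ T.legCell ∉ T.shape ∧
      T.singleLeg.legCount + 1 = T.legCount ∧ T.singleLeg.armCount = T.armCount := by
  obtain ⟨p, q, h1, h2, h3⟩ := singleLeg_run hT hL
  have hn : (p, q) ∉ T.shape := h1.not_sh
  have : T.legCell = (p, q) := by
    unfold legCell
    rw [h2, Finset.insert_sdiff_of_notMem _ hn, sdiff_self]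
    exact Finset.sup_singleton
  rw [this]
  exact ⟨h1, h2, hn, h3⟩

theorem valid_singleArm (hT : T.toArray.Valid 1 0) (hA : T.armCount ≠ 0) :
    T.singleArm.toArray.Valid 1 0 :=
  (armCell_spec hT hA).1.valid hT

theorem valid_singleLeg (hT : T.toArray.Valid 1 0) (hL : T.legCount ≠ 0) :
    T.singleLeg.toArray.Valid 1 0 :=
  ((legCell_spec hT hL).1.valid hT.transpose).transpose

/-- Arm uncrowding and leg uncrowding commute, up to a switch of the cells that are added. -/
theorem singleArm_singleLeg (hT : T.toArray.Valid 1 0) (hA : T.armCount ≠ 0)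
    (hL : T.legCount ≠ 0) :
    T.singleLeg.singleArm = T.singleArm.singleLeg ∧ T.singleLeg.armCol = T.armCol ∧
      T.singleArm.legRow = T.legRow ∧
      ((T.singleLeg.armCell = T.armCell ∧ T.singleArm.legCell = T.legCell) ∨
        (T.armCell = T.legCell ∧ T.singleLeg.armCell = T.singleArm.legCell ∧
          (T.singleArm.legCell = Recording.up T.armCell ∨
            T.singleArm.legCell = Recording.right T.armCell))) := by
  obtain ⟨hRA, -, -, -, hcA⟩ := armCell_spec hT hA
  obtain ⟨hRL, -, -, -, hcL⟩ := legCell_spec hT hL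
  have hvA := valid_singleArm hT hA
  have hvL := valid_singleLeg hT hL
  have hRA' := (armCell_spec hvL (by rwa [hcL])).1
  have hRL' := (legCell_spec hvA (by rwa [hcA])).1
  -- Two runs with a common final array must be the actual uncrowdings, by uniqueness of runs.
  have key : ∀ (Z : HookArray) (u v u' v' : ℕ), Run 1 0 T.singleLeg.toArray Z T.armCol u v →
      Run 0 1 T.singleArm.toArray.transpose Z.transpose T.legRow v' u' →
      T.singleLeg.singleArm = T.singleArm.singleLeg ∧ T.singleLeg.armCol = T.armCol ∧
      T.singleArm.legRow = T.legRow ∧ T.singleLeg.armCell = (u, v) ∧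
      T.singleArm.legCell = (u', v') := by
    intro Z u v u' v' h1 h2
    obtain ⟨e1, e2, e3, e4⟩ := Run.unique hvL hRA' h1
    obtain ⟨f1, f2, f3, f4⟩ := Run.unique hvA.transpose hRL' h2
    exact ⟨toArray_injective (e1.trans (congrArg HookArray.transpose f1).symm), e2, f2,
      Prod.ext e3 e4, Prod.ext f4 f3⟩
  obtain ⟨Z, ⟨-, h1, h2⟩ | ⟨h0, h0', u, v, huv, h1, h2⟩⟩ := Run.square hT hRA hRL
  · obtain ⟨k1, k2, k3, k4, k5⟩ := key Z _ _ _ _ h1 h2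
    exact ⟨k1, k2, k3, Or.inl ⟨k4, k5⟩⟩
  · obtain ⟨k1, k2, k3, k4, k5⟩ := key Z _ _ _ _ h1 h2
    refine ⟨k1, k2, k3, Or.inr ⟨Prod.ext h0 h0', k4.trans k5.symm, ?_⟩⟩
    rw [k5]
    rcases huv with ⟨rfl, rfl⟩ | ⟨rfl, rfl⟩
    · exact Or.inl rfl
    · exact Or.inr rfl

/-- The result of uncrowding `q` legs and then `p` arms. -/
noncomputable def uncrowdGrid (T : Filling) (p q : ℕ) : Filling :=
  singleArm^[p] (singleLeg^[q] T)

theorem uncrowdGrid_succ_left (T : Filling) (p q : ℕ) :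
    T.uncrowdGrid (p + 1) q = (T.uncrowdGrid p q).singleArm :=
  Function.iterate_succ_apply' _ _ _

theorem uncrowdGrid_spec (hT : T.toArray.Valid 1 0) {p q : ℕ} (hp : p ≤ T.armCount)
    (hq : q ≤ T.legCount) : (T.uncrowdGrid p q).toArray.Valid 1 0 ∧
      (T.uncrowdGrid p q).armCount + p = T.armCount ∧
      (T.uncrowdGrid p q).legCount + q = T.legCount := by
  induction p with
  | zero =>
    induction q with
    | zero => exact ⟨hT, rfl, rfl⟩
    | succ q ih =>
      obtain ⟨h1, h2, h3⟩ := ih (by omega)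
      have hL : (T.uncrowdGrid 0 q).legCount ≠ 0 := by omega
      have h : T.uncrowdGrid 0 (q + 1) = (T.uncrowdGrid 0 q).singleLeg :=
        Function.iterate_succ_apply' _ _ _
      obtain ⟨-, -, -, h4, h5⟩ := legCell_spec h1 hL
      rw [h]
      exact ⟨valid_singleLeg h1 hL, by omega, by omega⟩
  | succ p ih =>
    obtain ⟨h1, h2, h3⟩ := ih (by omega)
    have hA : (T.uncrowdGrid p q).armCount ≠ 0 := by omega
    obtain ⟨-, -, -, h4, h5⟩ := armCell_spec h1 hA
    rw [uncrowdGrid_succ_left]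
    exact ⟨valid_singleArm h1 hA, by omega, by omega⟩

theorem armCount_uncrowdGrid_ne_zero (hT : T.toArray.Valid 1 0) {p q : ℕ} (hp : p < T.armCount)
    (hq : q ≤ T.legCount) : (T.uncrowdGrid p q).armCount ≠ 0 := by
  have := (uncrowdGrid_spec hT hp.le hq).2.1
  omega

theorem legCount_uncrowdGrid_ne_zero (hT : T.toArray.Valid 1 0) {p q : ℕ} (hp : p ≤ T.armCount)
    (hq : q < T.legCount) : (T.uncrowdGrid p q).legCount ≠ 0 := by
  have := (uncrowdGrid_spec hT hp hq.le).2.2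
  omega

/-- The asymmetric definition of the grid becomes symmetric by commuting the new leg past all `p`
arms. -/
theorem uncrowdGrid_succ_right (hT : T.toArray.Valid 1 0) {p q : ℕ} (hp : p ≤ T.armCount)
    (hq : q < T.legCount) : T.uncrowdGrid p (q + 1) = (T.uncrowdGrid p q).singleLeg := by
  induction p with
  | zero => exact Function.iterate_succ_apply' _ _ _
  | succ p ih =>
    rw [uncrowdGrid_succ_left, uncrowdGrid_succ_left, ih (by omega)]
    exact (singleArm_singleLeg (uncrowdGrid_spec hT (by omega) hq.le).1
      (armCount_uncrowdGrid_ne_zero hT hp hq.le)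
      (legCount_uncrowdGrid_ne_zero hT (by omega) hq)).1

/-- This makes the index of an `α` independent of the number of legs uncrowded before it. -/
theorem armCol_uncrowdGrid (hT : T.toArray.Valid 1 0) {p q : ℕ} (hp : p < T.armCount)
    (hq : q ≤ T.legCount) : (T.uncrowdGrid p q).armCol = (T.uncrowdGrid p 0).armCol := by
  induction q with
  | zero => rfl
  | succ q ih =>
    rw [← ih (by omega), uncrowdGrid_succ_right hT hp.le hq]
    exact (singleArm_singleLeg (uncrowdGrid_spec hT hp.le (by omega)).1
      (armCount_uncrowdGrid_ne_zero hT hp (by omega))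
      (legCount_uncrowdGrid_ne_zero hT hp.le hq)).2.1

theorem legRow_uncrowdGrid (hT : T.toArray.Valid 1 0) {p q : ℕ} (hp : p ≤ T.armCount)
    (hq : q < T.legCount) : (T.uncrowdGrid p q).legRow = (T.uncrowdGrid 0 q).legRow := by
  induction p with
  | zero => rfl
  | succ p ih =>
    rw [← ih (by omega), uncrowdGrid_succ_left]
    exact (singleArm_singleLeg (uncrowdGrid_spec hT (by omega) hq.le).1
      (armCount_uncrowdGrid_ne_zero hT hp hq.le)
      (legCount_uncrowdGrid_ne_zero hT (by omega) hq)).2.2.1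

theorem armCol_succ (hT : T.toArray.Valid 1 0) {p q : ℕ} (hp : p + 1 < T.armCount)
    (hq : q ≤ T.legCount) :
    (T.uncrowdGrid (p + 1) q).armCol ≤ (T.uncrowdGrid p q).armCol ∧
      ((T.uncrowdGrid p q).armCol = (T.uncrowdGrid (p + 1) q).armCol →
        (T.uncrowdGrid p q).armCell.2 < (T.uncrowdGrid (p + 1) q).armCell.2) := by
  have hv := (uncrowdGrid_spec hT (show p ≤ T.armCount by omega) hq).1
  have hv' := (uncrowdGrid_spec hT hp.le hq).1
  have h := (armCell_spec hv (armCount_uncrowdGrid_ne_zero hT (by omega) hq)).1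
  have h' := (armCell_spec hv' (armCount_uncrowdGrid_ne_zero hT hp hq)).1
  rw [← uncrowdGrid_succ_left] at h
  exact ⟨h.col_le hv h', fun he => (he ▸ h).col_lt_col hv h'⟩

theorem legRow_succ (hT : T.toArray.Valid 1 0) {p q : ℕ} (hp : p ≤ T.armCount)
    (hq : q + 1 < T.legCount) :
    (T.uncrowdGrid p (q + 1)).legRow ≤ (T.uncrowdGrid p q).legRow ∧
      ((T.uncrowdGrid p q).legRow = (T.uncrowdGrid p (q + 1)).legRow →
        (T.uncrowdGrid p q).legCell.1 < (T.uncrowdGrid p (q + 1)).legCell.1) := by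
  have hv := (uncrowdGrid_spec hT hp (show q ≤ T.legCount by omega)).1
  have hv' := (uncrowdGrid_spec hT hp hq.le).1
  have h := (legCell_spec hv (legCount_uncrowdGrid_ne_zero hT hp (by omega))).1
  have h' := (legCell_spec hv' (legCount_uncrowdGrid_ne_zero hT hp hq)).1
  rw [← uncrowdGrid_succ_right hT hp (by omega)] at h
  exact ⟨h.col_le hv.transpose h', fun he => (he ▸ h).col_lt_col hv.transpose h'⟩

end Filling

theorem le_of_succ_le {α : Type*} [Preorder α] {f : ℕ → α} {n : ℕ}
    (h : ∀ i, i + 1 < n → f (i + 1) ≤ f i) {i j : ℕ} (hij : i ≤ j) (hj : j < n) : f j ≤ f i := by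
  induction j, hij using Nat.le_induction with
  | base => exact le_rfl
  | succ j _ ih => exact (h j hj).trans (ih (by omega))

/-- Since `f` decreases weakly, equal values at the ends force equal values in between. -/
theorem lt_of_succ_lt {α : Type*} [PartialOrder α] {f : ℕ → α} {g : ℕ → ℕ} {n : ℕ}
    (h : ∀ i, i + 1 < n → f (i + 1) ≤ f i) (h' : ∀ i, i + 1 < n → f i = f (i + 1) → g i < g (i + 1))
    {i j : ℕ} (hij : i < j) (hj : j < n) (hf : f i = f j) : g i < g j := by
  induction j, hij using Nat.le_induction with
  | base => exact h' i hj hf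
  | succ j hle ih =>
    have h1 : f j = f (j + 1) := le_antisymm
      ((le_of_succ_le h (show i ≤ j by omega) (by omega)).trans hf.le) (h j hj)
    exact (ih (by omega) (hf.trans h1.symm)).trans (h' j hj h1)

namespace Filling

variable {T : Filling}

/-- The grid of the shapes that occur when arms and legs are uncrowded in any order. -/
noncomputable def switchGrid (hT : T.toArray.Valid 1 0) : SwitchGrid T.armCount T.legCount where
  shape p q := (T.uncrowdGrid p q).shape
  x p q := (T.uncrowdGrid p q).armCell
  y p q := (T.uncrowdGrid p q).legCell
  κ p := (T.uncrowdGrid p 0).armCol + 1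
  ρ q := (T.uncrowdGrid 0 q).legRow + 1
  lower hp hq := fun _ _ hle h => (uncrowdGrid_spec hT hp hq).1.lower h hle.1 hle.2
  x_notMem hp hq := (armCell_spec (uncrowdGrid_spec hT hp.le hq).1
    (armCount_uncrowdGrid_ne_zero hT hp hq)).2.2.1
  y_notMem hp hq := (legCell_spec (uncrowdGrid_spec hT hp hq.le).1
    (legCount_uncrowdGrid_ne_zero hT hp hq)).2.2.1
  shape_x hp hq := by
    rw [uncrowdGrid_succ_left]
    exact (armCell_spec (uncrowdGrid_spec hT hp.le hq).1
      (armCount_uncrowdGrid_ne_zero hT hp hq)).2.1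
  shape_y hp hq := by
    rw [uncrowdGrid_succ_right hT hp hq]
    exact (legCell_spec (uncrowdGrid_spec hT hp hq.le).1
      (legCount_uncrowdGrid_ne_zero hT hp hq)).2.1
  rule hp hq := by
    rw [uncrowdGrid_succ_left, uncrowdGrid_succ_right hT hp.le hq]
    exact (singleArm_singleLeg (uncrowdGrid_spec hT hp.le hq.le).1
      (armCount_uncrowdGrid_ne_zero hT hp hq.le)
      (legCount_uncrowdGrid_ne_zero hT hp.le hq)).2.2.2
  κ_anti hij hj := Nat.succ_le_succ
    (le_of_succ_le (f := fun i => (T.uncrowdGrid i 0).armCol)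
      (fun _ h => (armCol_succ hT h (Nat.zero_le _)).1) hij hj)
  κ_strict hij hj h := lt_of_succ_lt (f := fun i => (T.uncrowdGrid i 0).armCol)
    (g := fun i => (T.uncrowdGrid i 0).armCell.2) (fun _ h => (armCol_succ hT h (Nat.zero_le _)).1)
    (fun _ h => (armCol_succ hT h (Nat.zero_le _)).2) hij hj (Nat.succ.inj h)
  ρ_anti hij hj := by
    have := le_of_succ_le (f := fun i => (T.uncrowdGrid 0 i).legRow)
      (fun _ h => (legRow_succ hT (Nat.zero_le _) h).1) hij hj
    omega
  -- Strictness of the rows is needed for every `p`, since each slide compares the `β`s after a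
  -- different number of arm steps; the indices themselves do not depend on `p`.
  ρ_strict {p i j} hp hij hj h := by
    refine lt_of_succ_lt (f := fun i => (T.uncrowdGrid p i).legRow)
      (g := fun i => (T.uncrowdGrid p i).legCell.1) (fun _ h => (legRow_succ hT hp h).1)
      (fun _ h => (legRow_succ hT hp h).2) hij hj ?_
    simp only [legRow_uncrowdGrid hT hp (hij.trans hj), legRow_uncrowdGrid hT hp hj]
    omega

end Filling
end Uncrowding

/-! ### Recording tableaux along the two border paths of the grid -/

namespace Uncrowding
open Filling

variable {T : Filling}

/-- By `hE` the letters recorded before lie in the current shape, so the letter of a new cell never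
overwrites one of them. -/
theorem iterate_uncrowdStep_arm (hT : T.toArray.Valid 1 0) {q n : ℕ} (hq : q ≤ T.legCount)
    (hn : n ≤ T.armCount) {E : ℕ × ℕ → Option Letter}
    (hE : ∀ z t, E z = some t → z ∈ (T.uncrowdGrid 0 q).shape) :
    ∃ E', (uncrowdStep .A)^[n] (T.uncrowdGrid 0 q, E) = (T.uncrowdGrid n q, E') ∧
      ∀ z t, E' z = some t ↔ E z = some t ∨
        ∃ i < n, z = (switchGrid hT).x i q ∧ t = .alpha ((switchGrid hT).κ i) := by
  induction n with
  | zero => exact ⟨E, rfl, by simp⟩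
  | succ n ih =>
    obtain ⟨E', h1, h2⟩ := ih (by omega)
    have hA := armCount_uncrowdGrid_ne_zero hT hn hq
    obtain ⟨-, hs, hm, -⟩ := armCell_spec (uncrowdGrid_spec hT (by omega) hq).1 hA
    rw [Function.iterate_succ_apply', h1, uncrowdStep, if_pos (armCells_nonempty_iff.2 hA),
      uncrowdGrid_succ_left]
    refine ⟨_, rfl, fun z t => ?_⟩
    dsimp only
    rw [hs, Finset.insert_sdiff_of_notMem _ hm, sdiff_self, Finset.bot_eq_empty, insert_empty_eq,
      armCol_uncrowdGrid hT hn hq]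
    split_ifs with hz
    · rw [Finset.mem_singleton] at hz
      constructor
      · intro h
        exact Or.inr ⟨n, by omega, hz, (Option.some.inj h).symm⟩
      · rintro (h | ⟨i, hi, h, h'⟩)
        · exact absurd ((switchGrid hT).shape_mono (Nat.zero_le n) le_rfl (by omega) hq (hE z t h))
            (hz ▸ hm)
        · rcases Nat.lt_or_ge i n with h3 | h3
          · exact absurd ((switchGrid hT).x_mem h3 le_rfl (by omega) hq) (h ▸ hz ▸ hm)
          · obtain rfl : i = n := by omega
            rw [h']
            rfl
    · rw [Finset.mem_singleton] at hz
      rw [h2]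
      refine or_congr Iff.rfl ⟨?_, ?_⟩
      · rintro ⟨i, hi, h⟩
        exact ⟨i, by omega, h⟩
      · rintro ⟨i, hi, h⟩
        refine ⟨i, lt_of_le_of_ne (by omega) ?_, h⟩
        rintro rfl
        exact hz h.1

theorem iterate_uncrowdStep_leg (hT : T.toArray.Valid 1 0) {p n : ℕ} (hp : p ≤ T.armCount)
    (hn : n ≤ T.legCount) {E : ℕ × ℕ → Option Letter}
    (hE : ∀ z t, E z = some t → z ∈ (T.uncrowdGrid p 0).shape) :
    ∃ E', (uncrowdStep .L)^[n] (T.uncrowdGrid p 0, E) = (T.uncrowdGrid p n, E') ∧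
      ∀ z t, E' z = some t ↔ E z = some t ∨
        ∃ j < n, z = (switchGrid hT).y p j ∧ t = .beta ((switchGrid hT).ρ j) := by
  induction n with
  | zero => exact ⟨E, rfl, by simp⟩
  | succ n ih =>
    obtain ⟨E', h1, h2⟩ := ih (by omega)
    have hL := legCount_uncrowdGrid_ne_zero hT hp hn
    obtain ⟨-, hs, hm, -⟩ := legCell_spec (uncrowdGrid_spec hT hp (by omega)).1 hL
    rw [Function.iterate_succ_apply', h1, uncrowdStep, if_pos (legCells_nonempty_iff.2 hL),
      uncrowdGrid_succ_right hT hp hn]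
    refine ⟨_, rfl, fun z t => ?_⟩
    dsimp only
    rw [hs, Finset.insert_sdiff_of_notMem _ hm, sdiff_self, Finset.bot_eq_empty, insert_empty_eq,
      legRow_uncrowdGrid hT hp hn]
    split_ifs with hz
    · rw [Finset.mem_singleton] at hz
      constructor
      · intro h
        exact Or.inr ⟨n, by omega, hz, (Option.some.inj h).symm⟩
      · rintro (h | ⟨i, hi, h, h'⟩)
        · exact absurd ((switchGrid hT).shape_mono le_rfl (Nat.zero_le n) hp (by omega) (hE z t h))
            (hz ▸ hm)
        · rcases Nat.lt_or_ge i n with h3 | h3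
          · exact absurd ((switchGrid hT).y_mem le_rfl h3 hp (by omega)) (h ▸ hz ▸ hm)
          · obtain rfl : i = n := by omega
            rw [h']
            rfl
    · rw [Finset.mem_singleton] at hz
      rw [h2]
      refine or_congr Iff.rfl ⟨?_, ?_⟩
      · rintro ⟨i, hi, h⟩
        exact ⟨i, by omega, h⟩
      · rintro ⟨i, hi, h⟩
        refine ⟨i, lt_of_le_of_ne (by omega) ?_, h⟩
        rintro rfl
        exact hz h.1

theorem foldr_replicate_eq_iterate {α β : Type*} (f : α → β → β) (x : α) (y : β) (n : ℕ) :
    (List.replicate n x).foldr f y = (f x)^[n] y := by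
  induction n with
  | zero => rfl
  | succ n ih => rw [List.replicate_succ, List.foldr_cons, ih, Function.iterate_succ_apply']

/-- Once all arms are used up the operator fixes the pair, so the exact number of letters in the
word does not matter. -/
theorem foldr_replicate_arm (hT : T.toArray.Valid 1 0) {q M : ℕ} (hq : q ≤ T.legCount)
    (hM : T.armCount ≤ M) {E : ℕ × ℕ → Option Letter}
    (hE : ∀ z t, E z = some t → z ∈ (T.uncrowdGrid 0 q).shape) :
    ∃ E', (List.replicate M Op.A).foldr uncrowdStep (T.uncrowdGrid 0 q, E) =
        (T.uncrowdGrid T.armCount q, E') ∧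
      ∀ z t, E' z = some t ↔ E z = some t ∨ ∃ i < T.armCount,
        z = (switchGrid hT).x i q ∧ t = .alpha ((switchGrid hT).κ i) := by
  obtain ⟨E', h1, h2⟩ := iterate_uncrowdStep_arm hT hq le_rfl hE
  refine ⟨E', ?_, h2⟩
  obtain ⟨k, rfl⟩ := Nat.exists_eq_add_of_le' hM
  rw [foldr_replicate_eq_iterate, Function.iterate_add_apply, h1]
  refine Function.iterate_fixed ?_ k
  rw [uncrowdStep, if_neg]
  rw [armCells_nonempty_iff]
  have := (uncrowdGrid_spec hT le_rfl hq).2.1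
  dsimp only
  omega

theorem foldr_replicate_leg (hT : T.toArray.Valid 1 0) {p N : ℕ} (hp : p ≤ T.armCount)
    (hN : T.legCount ≤ N) {E : ℕ × ℕ → Option Letter}
    (hE : ∀ z t, E z = some t → z ∈ (T.uncrowdGrid p 0).shape) :
    ∃ E', (List.replicate N Op.L).foldr uncrowdStep (T.uncrowdGrid p 0, E) =
        (T.uncrowdGrid p T.legCount, E') ∧
      ∀ z t, E' z = some t ↔ E z = some t ∨ ∃ j < T.legCount,
        z = (switchGrid hT).y p j ∧ t = .beta ((switchGrid hT).ρ j) := by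
  obtain ⟨E', h1, h2⟩ := iterate_uncrowdStep_leg hT hp le_rfl hE
  refine ⟨E', ?_, h2⟩
  obtain ⟨k, rfl⟩ := Nat.exists_eq_add_of_le' hN
  rw [foldr_replicate_eq_iterate, Function.iterate_add_apply, h1]
  refine Function.iterate_fixed ?_ k
  rw [uncrowdStep, if_neg]
  rw [legCells_nonempty_iff]
  have := (uncrowdGrid_spec hT hp le_rfl).2.2
  dsimp only
  omega

/-- The path through the corner `(armCount, 0)`: the starting state of the shuffle. -/
theorem uncrowd_arm_leg (hT : T.toArray.Valid 1 0) {M N : ℕ} (hM : T.armCount ≤ M)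
    (hN : T.legCount ≤ N) :
    ∃ Q, uncrowd (List.replicate N Op.L ++ List.replicate M Op.A) T =
        (T.uncrowdGrid T.armCount T.legCount, Q) ∧
      (switchGrid hT).Records ((switchGrid hT).Has' T.armCount) Q := by
  obtain ⟨E, h1, h2⟩ := foldr_replicate_arm hT (Nat.zero_le _) hM (E := fun _ => none)
    (fun _ _ h => nomatch h)
  obtain ⟨E', h3, h4⟩ := foldr_replicate_leg hT le_rfl hN (E := E) (by
    intro z t h
    rcases (h2 z t).1 h with h | ⟨i, hi, rfl, -⟩
    · exact nomatch h
    · exact (switchGrid hT).x_mem hi le_rfl le_rfl (Nat.zero_le _))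
  refine ⟨⟨T.shape, (T.uncrowdGrid T.armCount T.legCount).shape, E'⟩, ?_, rfl, rfl, fun z t => ?_⟩
  · unfold uncrowd
    rw [List.foldr_append, show List.foldr uncrowdStep (T, fun _ => none) _ = _ from h1, h3]
  · rw [h4, h2]
    constructor
    · rintro ((h | h) | h)
      · exact nomatch h
      · exact Or.inl h
      · exact Or.inr (Or.inl h)
    · rintro (h | h | ⟨i, h, h', -⟩)
      · exact Or.inl (Or.inr h)
      · exact Or.inr h
      · omega

/-- The path through the corner `(0, legCount)`: the state in which every `α` has passed every `β`.
-/
theorem uncrowd_leg_arm (hT : T.toArray.Valid 1 0) {M N : ℕ} (hM : T.armCount ≤ M)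
    (hN : T.legCount ≤ N) :
    ∃ Q, uncrowd (List.replicate M Op.A ++ List.replicate N Op.L) T =
        (T.uncrowdGrid T.armCount T.legCount, Q) ∧
      (switchGrid hT).Records ((switchGrid hT).Has' 0) Q := by
  obtain ⟨E, h1, h2⟩ := foldr_replicate_leg hT (Nat.zero_le _) hN (E := fun _ => none)
    (fun _ _ h => nomatch h)
  obtain ⟨E', h3, h4⟩ := foldr_replicate_arm hT le_rfl hM (E := E) (by
    intro z t h
    rcases (h2 z t).1 h with h | ⟨i, hi, rfl, -⟩
    · exact nomatch h
    · exact (switchGrid hT).y_mem le_rfl hi (Nat.zero_le _) le_rfl)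
  refine ⟨⟨T.shape, (T.uncrowdGrid T.armCount T.legCount).shape, E'⟩, ?_, rfl, rfl, fun z t => ?_⟩
  · unfold uncrowd
    rw [List.foldr_append, show List.foldr uncrowdStep (T, fun _ => none) _ = _ from h1, h3]
  · rw [h4, h2]
    constructor
    · rintro ((h | h) | ⟨i, h⟩)
      · exact nomatch h
      · exact Or.inr (Or.inl h)
      · exact Or.inr (Or.inr ⟨i, Nat.zero_le _, h⟩)
    · rintro (⟨i, h, -⟩ | h | ⟨i, -, h⟩)
      · omega
      · exact Or.inl (Or.inr h)
      · exact Or.inr ⟨i, h⟩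

end Uncrowding
open Uncrowding in
/-- `U_{L^∞ A^∞}(T)` is the common value of `U_{L^N A^M}(T)` for all `M ≥ #arms` and `N ≥ #legs`,
and likewise for `U_{A^∞ L^∞}(T)`. -/
theorem mainTheorem3 (T : Filling) (hT : T.IsHVT)
    (M N M' N' : ℕ) (hM : T.armCount ≤ M) (hN : T.legCount ≤ N)
    (hM' : T.armCount ≤ M') (hN' : T.legCount ≤ N')
    (P₁ P₂ : Filling) (Q₁ Q₂ : Recording)
    (h₁ : uncrowd (List.replicate N Op.L ++ List.replicate M Op.A) T = (P₁, Q₁))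
    (h₂ : uncrowd (List.replicate M' Op.A ++ List.replicate N' Op.L) T = (P₂, Q₂)) :
    Q₁.IsShufflable ∧ P₂ = P₁ ∧ Q₂ = Q₁.shuff := by
  obtain ⟨R₁, e₁, hR₁⟩ := uncrowd_arm_leg hT.valid hM hN
  obtain ⟨R₂, e₂, hR₂⟩ := uncrowd_leg_arm hT.valid hM' hN'
  obtain ⟨rfl, rfl⟩ := Prod.mk.inj (h₁.symm.trans e₁)
  obtain ⟨rfl, rfl⟩ := Prod.mk.inj (h₂.symm.trans e₂)
  refine ⟨hR₁.isShufflable (fun i hi => ?_) (fun j hj => ?_), rfl,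
    hR₂.unique (hR₁.shuff le_rfl).1⟩
  -- The flag condition: a run ends strictly to the right of the column in which it starts.
  · have := (Filling.armCell_spec (Filling.uncrowdGrid_spec hT.valid hi.le (Nat.zero_le _)).1
      (Filling.armCount_uncrowdGrid_ne_zero hT.valid hi (Nat.zero_le _))).1.col_lt
    exact ⟨Nat.succ_pos _, Nat.succ_lt_succ this⟩
  · have := (Filling.legCell_spec (Filling.uncrowdGrid_spec hT.valid le_rfl hj.le).1
      (Filling.legCount_uncrowdGrid_ne_zero hT.valid le_rfl hj)).1.col_lt
    rw [Filling.legRow_uncrowdGrid hT.valid le_rfl hj] at this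
    simp only [Filling.switchGrid]
    omega
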